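/- **Setting.** Let $e_1,e_2,e_3$ be the standard basis of $\mathbb R^3$, $|\cdot|$ the Euclidean norm, $T^3=\mathbb R^3/\mathbb Z^3$, and identify $H_1(T^3,\mathbb R)=\mathbb R^3$. Put $l_1=\mathbb R\times\{0\}\times\{0\}$, $l_2=\{0\}\times\mathbb R\times\{\tfrac12\}$, $l_3=\{\tfrac12\}\times\{\tfrac12\}\times\mathbb R$, $L_i=l_i+\mathbb Z^3$, $L=L_1\cup L_2\cup L_3$, and let $B_\varepsilon(\cdot)$ denote open Euclidean $\varepsilon$-neighbourhoods. Let $(v_1,v_2,v_3)$ be an orthonormal basis with $v_1=\tfrac1{\sqrt3}(1,1,1)$ and let $(v_1^*,v_2^*,v_3^*)$ be the dual basis. Let $\lambda_1,\lambda_2,\lambda_3>0$ with $\sum\lambda_i=1$, and let $0<\varepsilon<10^{-2}$ with $3\varepsilon^2<(1-2\varepsilon^2)\lambda_i^2$ for $i=1,2,3$. Put $$g_\varepsilon=-\tfrac{\varepsilon^2}{4}\,v_1^*\otimes v_1^*+v_2^*\otimes v_2^*+v_3^*\otimes v_3^*,\qquad g_i=\lambda_i^2\Big(-(dx^i)^2+\tfrac13\sum_{j\ne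 i}(dx^j)^2\Big).$$ For Lorentzian inner products write $a\ge b$ if $a(v,v)\le b(v,v)$ for every $v$ with $b(v,v)\le 0$. Let $g$ be a smooth Lorentzian metric on $T^3$ whose lift $\overline g$ to $\mathbb R^3$ satisfies 1. $\overline g_p\ge g_\varepsilon$ for all $p\in\mathbb R^3$; 2. $g_{2\varepsilon}\ge\overline g_p$ for all $p\in\mathbb R^3\setminus B_\varepsilon(L)$; 3. for $p\in B_\varepsilon(L_i)$, $g_i\ge\overline g_p$, with equality exactly on $L_i$: if $p\in L_i$ then $\overline g_p=g_i$, and if $p\notin L_i$ then $g_i(v,v)<\overline g_p(v,v)$ for all $v\neq0$ with $\overline g_p(v,v)\le0$. By 1, $v_1$ is timelike everywhere; it fixes the time orientation. A future pointing curve is a Lipschitz curve $\gamma\colon[a,b]\to\mathbb R^3$, $a<b$, whose derivative is almost everywhere a (nonzero) future pointing causal vector; $L^g(\gamma)=\int\sqrt{|\overline g(\dot\gamma,\dot\gamma)|}\,dt$, $L^{R}(\gamma)=\int|\dot\gamma|\,dt$, and $d(p,q)$ is the supremum of $L^g(\gamma)$ over the future pointing curves from $p$ to $q$ ($\sup\emptyset=0$).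 The *stable time cone* $\mathfrak T\subset\mathbb R^3$ is the cone over the set of accumulation points of sequences $(\gamma_n(b_n)-\gamma_n(a_n))/L^{R}(\gamma_n)$, where $\gamma_n\colon[a_n,b_n]\to\mathbb R^3$ are future pointing curves with $L^{R}(\gamma_n)\to\infty$. For $\delta>0$ let $\mathfrak T_\delta=\{h\in\mathfrak T:\operatorname{dist}(h,\partial\mathfrak T)\ge\delta|h|\}$. A *stable time separation* is a concave function $\mathfrak l\colon\mathfrak T\to\mathbb R$ such that for every $\delta>0$ there is $C(\delta)<\infty$ with $|\mathfrak l(y-x)-d(x,y)|\le C(\delta)$ whenever $y-x\in\mathfrak T_\delta$, such that $\mathfrak l(ch)=c\,\mathfrak l(h)$ for $c\ge0$ and $\mathfrak l(h+h')\ge\mathfrak l(h)+\mathfrak l(h')$, and such that $\mathfrak l(h)=\limsup_{h'\to h,\,h'\in\mathfrak T}\mathfrak l(h')$ for $h\in\partial\mathfrak T\cap\mathfrak T$. The *pregeodesic flow* $\Phi$ on the Euclidean unit tangent bundle $T^3\times S^2$ moves a unit vector along the tangent curve of the $g$-geodesic that it generates, parametrized by Euclidean arclength. For a finite Borel measure $\mu$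 on $T^3\times S^2$ put $\rho(\mu)=\int v\,d\mu\in H_1(T^3,\mathbb R)$ and, if $\mu$ is carried by future pointing causal vectors, $\mathfrak L(\mu)=\int\sqrt{-g(v,v)}\,d\mu$. A *maximal ergodic measure* is a $\Phi$-invariant ergodic probability measure carried by the future pointing causal vectors with $\mathfrak L(\mu)=\mathfrak l(\rho(\mu))$. **Proposition.** For every such $g$: (a) $\mathfrak T=\operatorname{pos}\{e_1,e_2,e_3\}$, the convex cone generated by $e_1,e_2,e_3$. (b) There is exactly one stable time separation, namely $\mathfrak l(h)=\sum_i\lambda_ih^i$ for $h\in\operatorname{pos}\{e_1,e_2,e_3\}$. (c) The pregeodesic flow exists for all times, and there are exactly three maximal ergodic measures $\mu_1,\mu_2,\mu_3$. The line $l_i$, parametrized with velocity $e_i$, projects to a closed future pointing timelike geodesic of $(T^3,g)$ of period $1$; $\mu_i$ is the uniform probability measure on its tangent curve, and the support of $\mu_i$ is that tangent curve. -/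

import Mathlib

open Set Filter Topology MeasureTheory
open scoped ContDiff ENNReal

noncomputable section

namespace Hedlund

/-- `ℝ³` with the flat background metric `g_R`; it is the Abelian cover of `T³`, and also
`H₁(T³, ℝ)`, with the Euclidean norm as stable norm. -/
abbrev E3 : Type := EuclideanSpace ℝ (Fin 3)

/-- `T³ = ℝ³ / ℤ³`. -/
abbrev T3 : Type := UnitAddTorus (Fin 3)

/-- The covering map `ℝ³ → T³`. -/
def proj (x : E3) : T3 := fun i => (x i : UnitAddCircle)

/-- The unit tangent bundle of the flat torus, in its canonical trivialization. -/
abbrev UT : Type := T3 × Metric.sphere (0 : E3) 1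

/-- The standard basis of `ℝ³`. -/
def stdE (i : Fin 3) : E3 := EuclideanSpace.single i 1

/-- `v₁ = (1, 1, 1) / √3`. -/
def vOne : E3 := (1 / √3 : ℝ) • (stdE 0 + stdE 1 + stdE 2)

/-! ### Lorentzian metrics on the torus -/

/-- A smooth Lorentzian metric on `T³`, of signature `(-, +, +)`, in the canonical trivialization
of the tangent bundle. -/
structure LorentzMetric where
  /-- the metric tensor -/
  form : T3 → E3 →L[ℝ] E3 →L[ℝ] ℝ
  smooth : ContDiff ℝ ∞ (fun x : E3 => form (proj x))
  symm : ∀ p v w, form p v w = form p w v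
  signature : ∀ p, ∃ v, form p v v < 0 ∧ ∀ w, w ≠ 0 → form p v w = 0 → 0 < form p w w

/-- The lifted, `ℤ³`-invariant metric on `ℝ³`. -/
def LorentzMetric.lift (g : LorentzMetric) (x : E3) : E3 →L[ℝ] E3 →L[ℝ] ℝ := g.form (proj x)

/-- Future pointing causal vectors over a point of `T³`, for the time orientation given by `v₁`. -/
def FutureCausal (g : LorentzMetric) (p : T3) (v : E3) : Prop :=
  v ≠ 0 ∧ g.form p v v ≤ 0 ∧ g.form p v vOne < 0

/-- Future pointing curves `[a, b] → ℝ³`: Lipschitz, with future pointing causal derivative almost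
everywhere. -/
def IsFuturePointing (g : LorentzMetric) (γ : ℝ → E3) (a b : ℝ) : Prop :=
  a < b ∧ (∃ K, LipschitzOnWith K γ (Icc a b)) ∧
    ∀ᵐ t ∂(volume.restrict (Icc a b)), DifferentiableAt ℝ γ t ∧
      FutureCausal g (proj (γ t)) (deriv γ t)

/-- The length with respect to `g_R`. -/
def riemLength (γ : ℝ → E3) (a b : ℝ) : ℝ := ∫ t in a..b, ‖deriv γ t‖

/-- The Lorentzian length. -/
def lorentzLength (g : LorentzMetric) (γ : ℝ → E3) (a b : ℝ) : ℝ :=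
  ∫ t in a..b, √|g.lift (γ t) (deriv γ t) (deriv γ t)|

/-- The time separation of `ℝ³` with the lifted metric (`0` if there is no future pointing curve
from `p` to `q`). -/
def timeSep (g : LorentzMetric) (p q : E3) : ℝ≥0∞ :=
  ⨆ (γ : ℝ → E3) (a : ℝ) (b : ℝ) (_ : IsFuturePointing g γ a b ∧ γ a = p ∧ γ b = q),
    ENNReal.ofReal (lorentzLength g γ a b)

/-! ### Stable time cone and stable time separation -/

/-- The accumulation points of the rotation vectors (displacement per unit of `g_R`-length) of
sequences of future pointing curves whose `g_R`-lengths tend to infinity. -/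
def stableTimeConeOne (g : LorentzMetric) : Set E3 :=
  {h | ∃ (γ : ℕ → ℝ → E3) (a b : ℕ → ℝ), (∀ n, IsFuturePointing g (γ n) (a n) (b n)) ∧
    Tendsto (fun n => riemLength (γ n) (a n) (b n)) atTop atTop ∧
    MapClusterPt h atTop
      (fun n => (riemLength (γ n) (a n) (b n))⁻¹ • (γ n (b n) - γ n (a n)))}

/-- The stable time cone: the cone over `stableTimeConeOne`. -/
def stableTimeCone (g : LorentzMetric) : Set E3 :=
  {h | ∃ c : ℝ, 0 ≤ c ∧ ∃ k ∈ stableTimeConeOne g, h = c • k}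

/-- The elements of a cone `T` at distance at least `δ ‖h‖` from its boundary. -/
def innerCone (T : Set E3) (δ : ℝ) : Set E3 :=
  {h | h ∈ T ∧ δ * ‖h‖ ≤ Metric.infDist h (frontier T)}

/-- The properties that define the stable time separation. Only the values of `l` on the
stable time cone matter. -/
structure IsStableTimeSeparation (g : LorentzMetric) (l : E3 → ℝ) : Prop where
  concave : ConcaveOn ℝ (stableTimeCone g) l
  close : ∀ δ > 0, ∃ C : ℝ, ∀ x y : E3, y - x ∈ innerCone (stableTimeCone g) δ →
    timeSep g x y ≠ ⊤ ∧ |l (y - x) - (timeSep g x y).toReal| ≤ C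
  homogeneous : ∀ c : ℝ, 0 ≤ c → ∀ h ∈ stableTimeCone g, l (c • h) = c * l h
  superadditive : ∀ h ∈ stableTimeCone g, ∀ h' ∈ stableTimeCone g, l h' + l h ≤ l (h' + h)
  boundary : ∀ h ∈ frontier (stableTimeCone g), h ∈ stableTimeCone g →
    (l h : EReal) = limsup (fun h' => (l h' : EReal)) (𝓝[stableTimeCone g] h)

/-! ### Geodesics and the pregeodesic flow -/

/-- `ḡ(∇_{γ'} γ', w)` for the Levi-Civita connection of the lifted metric `ḡ`, where `γ` passes
through `x` with velocity `v` and second derivative `a` (Koszul formula in coordinates):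
`ḡ(a, w) + (D_v ḡ)(v, w) - (D_w ḡ)(v, v) / 2`. -/
def covAccel (g : LorentzMetric) (x v a w : E3) : ℝ :=
  g.lift x a w + fderiv ℝ g.lift x v v w - 1 / 2 * fderiv ℝ g.lift x w v v

/-- Geodesics of the lifted metric: `∇_{γ'} γ' = 0`. -/
def IsGeodesic (g : LorentzMetric) (γ : ℝ → E3) : Prop :=
  ContDiff ℝ 2 γ ∧ ∀ t w, covAccel g (γ t) (deriv γ t) (deriv (deriv γ) t) w = 0

/-- Pregeodesics of the lifted metric that are parametrized by `g_R`-arclength: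
`‖γ'‖ = 1` and `∇_{γ'} γ'` is a multiple of `γ'`. -/
def IsUnitPregeodesic (g : LorentzMetric) (γ : ℝ → E3) : Prop :=
  ContDiff ℝ 2 γ ∧ (∀ t, ‖deriv γ t‖ = 1) ∧
    ∀ t, ∃ c : ℝ, ∀ w, covAccel g (γ t) (deriv γ t) (deriv (deriv γ) t) w =
      c * g.lift (γ t) (deriv γ t) w

/-- `Φ` is the pregeodesic flow on the unit tangent bundle: the orbit of `z` is the tangent curve
of the pregeodesic with initial velocity `z` that is parametrized by `g_R`-arclength. -/
def IsPregeodesicFlow (g : LorentzMetric) (Φ : ℝ → UT → UT) : Prop :=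
  ∀ z : UT, Φ 0 z = z ∧ ∃ γ : ℝ → E3, IsUnitPregeodesic g γ ∧
    ∀ t, (Φ t z).1 = proj (γ t) ∧ ((Φ t z).2 : E3) = deriv γ t

/-! ### Invariant measures -/

/-- The rotation class `ρ(μ)`: its pairing with the class of `dxⁱ` is the integral of `dxⁱ`. -/
def rotationClass (μ : Measure UT) : E3 := WithLp.toLp 2 fun i => ∫ z, (z.2 : E3) i ∂μ

/-- The average length `𝔏(μ)`. -/
def averageLength (g : LorentzMetric) (μ : Measure UT) : ℝ :=
  ∫ z, √(-(g.form z.1 (z.2 : E3) (z.2 : E3))) ∂μ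

/-- Maximal ergodic measures: probability measures that are invariant and ergodic under the flow
`Φ`, live on the future pointing causal vectors and satisfy `𝔏(μ) = l(ρ(μ))`. -/
structure IsMaximalErgodic (g : LorentzMetric) (Φ : ℝ → UT → UT) (l : E3 → ℝ)
    (μ : Measure UT) : Prop where
  prob : IsProbabilityMeasure μ
  invariant : ∀ t, MeasurePreserving (Φ t) μ μ
  ergodic : ∀ A : Set UT, MeasurableSet A → (∀ t, Φ t ⁻¹' A = A) → μ A = 0 ∨ μ Aᶜ = 0
  future : ∀ᵐ z ∂μ, FutureCausal g z.1 (z.2 : E3)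
  maximal : averageLength g μ = l (rotationClass μ)

/-! ### The Hedlund metrics -/

/-- Base points of the lines `l₁`, `l₂`, `l₃`. -/
def basePt : Fin 3 → E3 := ![!₂[0, 0, 0], !₂[0, 0, 1 / 2], !₂[1 / 2, 1 / 2, 0]]

/-- The line `l_i`, parametrized by `t ↦ basePt i + t e_i`. -/
def line (i : Fin 3) (t : ℝ) : E3 := basePt i + t • stdE i

/-- The family `L_i = l_i + ℤ³`. -/
def lineFamily (i : Fin 3) : Set E3 :=
  {x | ∃ (t : ℝ) (k : Fin 3 → ℤ), x = line i t + WithLp.toLp 2 fun j => (k j : ℝ)}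

/-- The quadratic form of `g_ε = -(ε²/4) v₁* ⊗ v₁* + v₂* ⊗ v₂* + v₃* ⊗ v₃*`, where `(v₁, v₂, v₃)` is
an orthonormal basis; the last two terms are the square of the norm of the part orthogonal to
`v₁`. -/
def flatForm (ε : ℝ) (v : E3) : ℝ :=
  -(ε ^ 2 / 4) * (inner ℝ vOne v) ^ 2 + (‖v‖ ^ 2 - (inner ℝ vOne v) ^ 2)

/-- The quadratic form of `g_i = λ_i² (-(dxⁱ)² + ∑_{j ≠ i} (dxʲ)² / 3)`. -/
def tubeForm (lam : Fin 3 → ℝ) (i : Fin 3) (v : E3) : ℝ :=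
  lam i ^ 2 * (-(v i) ^ 2 + ∑ j ∈ Finset.univ.erase i, 1 / 3 * (v j) ^ 2)

/-- The relation `q ≥ q'` between (the quadratic forms of) Lorentzian inner products: every
`q'`-causal vector is `q`-causal, with at least the same `q`-length. -/
def Dominates (q q' : E3 → ℝ) : Prop := ∀ v, q' v ≤ 0 → q v ≤ q' v

/-- The Lorentzian Hedlund metrics. In the third condition the comparison `g_i ≥ ḡ_p` holds on the
`ε`-tube around `L_i`, with equality exactly for `p ∈ L_i`. -/
structure IsHedlundMetric (lam : Fin 3 → ℝ) (ε : ℝ) (g : LorentzMetric) : Prop where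
  lower : ∀ p : E3, Dominates (fun v => g.lift p v v) (flatForm ε)
  upper_off : ∀ p : E3, p ∉ Metric.thickening ε (⋃ i, lineFamily i) →
    Dominates (flatForm (2 * ε)) (fun v => g.lift p v v)
  upper_on : ∀ i, ∀ p ∈ Metric.thickening ε (lineFamily i),
    (p ∈ lineFamily i → ∀ v, g.lift p v v = tubeForm lam i v) ∧
    (p ∉ lineFamily i → ∀ v, v ≠ 0 → g.lift p v v ≤ 0 → tubeForm lam i v < g.lift p v v)

/-- The unit vector `e_i` as a point of the sphere. -/
def stdS (i : Fin 3) : Metric.sphere (0 : E3) 1 := ⟨stdE i, by simp [stdE]⟩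

/-- The tangent curve, in the unit tangent bundle of `T³`, of the projection of `l_i`. -/
def tangentLine (i : Fin 3) (t : ℝ) : UT := (proj (line i t), stdS i)

/-- The uniform probability measure on the closed orbit `tangentLine i`, of period `1`. -/
def lineMeasure (i : Fin 3) : Measure UT :=
  Measure.map (tangentLine i) (volume.restrict (Icc (0 : ℝ) 1))

end Hedlund

end

open Set Filter Topology MeasureTheory
open scoped ContDiff ENNReal

noncomputable section

namespace Hedlund

/-! ### The model quadratic forms in coordinates -/

/-! The proof is a calibration argument. For weights `w ≥ 0` the linear form `∑ w_j x_j` is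
corrected by a bounded function on the torus to a Lipschitz function `potential w` that is `w_i x_i`
plus a constant around each line of `L_i`. The local estimate `IsHedlundMetric.exists_index` gives
every future pointing `v` at `x` an index `i` with `√(-g(v,v)) ≤ λ_i v_i`, such that all these
potentials grow along `v` at rate at least `w_i v_i`; equality of lengths forces `x ∈ L_i` and `v`
parallel to `e_i`. In the tubes this is the comparison with `g_i`. Outside, the cone of `g_{2ε}` is
so thin around `v₁` that the coordinates of `v` are positive and nearly equal and every `λ_i v_i`
exceeds the length, so the index can be adapted to the potential.

Integration along curves yields the upper bounds. For `w = λ`, the Lorentzian length is at most `∑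
λ_j h_j` plus a constant, where `h` is the displacement; for `w` a coordinate vector, no coordinate
drops by more than a constant. Conversely, long diagonal segments are future pointing by condition
1, so one can travel along a line of `L_1`, then of `L_2`, then of `L_3`, joined by diagonal
segments of bounded length. The curves of `IsHedlundMetric.exists_reach` have Lorentzian length at
least `∑ λ_j h_j - C` and Euclidean length within `C` of `∑ h_j`. Together these bounds determine
the cone and the time separation up to constants. Homogeneity then fixes `l` in the interior;
superadditivity and the limsup condition fix it on the boundary.

The lines are geodesics because `ḡ` is constant along `L_i` and `ḡ(e_i, e_i)` is minimal there. For
a maximal measure, the estimates are integrated over orbit pieces of unit length. The correction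
contributes a coboundary, of integral zero, so maximality forces equality in the local estimate;
almost every orbit meets, hence is, the tangent curve of a line. Ergodicity selects one curve, and a
closed orbit carries only one invariant probability measure. -/

lemma inner_vOne (v : E3) : inner ℝ vOne v = (v 0 + v 1 + v 2) / √3 := by
  simp [vOne, stdE, inner_smul_left, inner_add_left, EuclideanSpace.inner_single_left]
  ring

lemma inner_vOne_sq (v : E3) : (inner ℝ vOne v) ^ 2 = (v 0 + v 1 + v 2) ^ 2 / 3 := by
  rw [inner_vOne, div_pow, Real.sq_sqrt (by norm_num)]

lemma norm_sq_eq_coords (v : E3) : ‖v‖ ^ 2 = v 0 ^ 2 + v 1 ^ 2 + v 2 ^ 2 := by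
  simp [EuclideanSpace.norm_sq_eq, Fin.sum_univ_three]

lemma flatForm_eq_coords (ε : ℝ) (v : E3) :
    flatForm ε v = -(ε ^ 2 / 4) * ((v 0 + v 1 + v 2) ^ 2 / 3) +
      (v 0 ^ 2 + v 1 ^ 2 + v 2 ^ 2 - (v 0 + v 1 + v 2) ^ 2 / 3) := by
  rw [flatForm, inner_vOne_sq, norm_sq_eq_coords]

lemma eq_zero_of_coords {v : E3} (h0 : v 0 = 0) (h1 : v 1 = 0) (h2 : v 2 = 0) : v = 0 := by
  ext j; fin_cases j <;> simpa

lemma vOne_apply (j : Fin 3) : vOne j = 1 / √3 := by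
  fin_cases j <;> simp [vOne, stdE]

lemma sqrt_three_inv_sq : (1 / √3 : ℝ) ^ 2 = 1 / 3 := by
  rw [div_pow, Real.sq_sqrt (by norm_num)]; norm_num

lemma sum_vOne : vOne 0 + vOne 1 + vOne 2 = √3 := by
  have h : (0 : ℝ) < √3 := by positivity
  have h2 : √3 * √3 = (3 : ℝ) := Real.mul_self_sqrt (by norm_num)
  simp only [vOne_apply]; field_simp; nlinarith

lemma flatForm_vOne (ε : ℝ) : flatForm ε vOne = -(ε ^ 2 / 4) := by
  rw [flatForm_eq_coords, sum_vOne]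
  simp only [vOne_apply, sqrt_three_inv_sq]
  rw [Real.sq_sqrt (by norm_num)]; ring

lemma eq_zero_of_flatForm_nonpos {ε : ℝ} {v : E3} (h : flatForm ε v ≤ 0)
    (hS : v 0 + v 1 + v 2 = 0) : v = 0 := by
  rw [flatForm_eq_coords, hS] at h
  have h0 : v 0 ^ 2 + v 1 ^ 2 + v 2 ^ 2 ≤ 0 := by nlinarith
  apply eq_zero_of_coords <;> nlinarith [sq_nonneg (v 0), sq_nonneg (v 1), sq_nonneg (v 2)]

lemma eq_zero_of_tubeForm_nonpos {lam : Fin 3 → ℝ} {i : Fin 3} (hlam : 0 < lam i) {v : E3}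
    (h : tubeForm lam i v ≤ 0) (hi : v i = 0) : v = 0 := by
  rw [tubeForm, hi] at h
  have hp : 0 < lam i ^ 2 := by positivity
  have h' : ∑ j ∈ Finset.univ.erase i, 1 / 3 * (v j) ^ 2 ≤ 0 := by
    have := nonpos_of_mul_nonpos_right h hp
    simpa using this
  have h'' : ∀ j ∈ Finset.univ.erase i, 1 / 3 * (v j) ^ 2 = 0 := by
    rw [← Finset.sum_eq_zero_iff_of_nonneg (fun j _ => by positivity)]
    exact le_antisymm h' (Finset.sum_nonneg fun j _ => by positivity)
  ext j
  by_cases hj : j = i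
  · simpa [hj] using hi
  · have := h'' j (by simp [hj])
    simpa using this

/-- With `S` the coordinate sum, the part of `v` orthogonal to the diagonal has squared norm `∑ (v_j
- S/3)²`. Causality bounds this by `ε² S² / 3 ≤ S² / 30000`, which is below `(S / 150)²`. -/
lemma abs_sub_third_le_of_flatForm {ε : ℝ} (hε : 0 < ε) (hε' : ε < 1 / 100) {v : E3}
    (h : flatForm (2 * ε) v ≤ 0) (hS : 0 < v 0 + v 1 + v 2) (j : Fin 3) :
    |v j - (v 0 + v 1 + v 2) / 3| ≤ (v 0 + v 1 + v 2) / 150 := by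
  rw [flatForm_eq_coords] at h
  set S := v 0 + v 1 + v 2 with hSdef
  have hεS : ε ^ 2 * S ^ 2 ≤ 1 / 10000 * S ^ 2 := by
    apply mul_le_mul_of_nonneg_right _ (sq_nonneg _); nlinarith
  apply abs_le_of_sq_le_sq _ (by positivity)
  fin_cases j <;> simp <;>
    nlinarith [sq_nonneg (v 0 - v 1), sq_nonneg (v 0 - v 2), sq_nonneg (v 1 - v 2)]

/-- For a given coordinate sum `S`, the minimum of `(l x)² + (3/2)(x - S/3)²` over `x` is `l² S² /
(6 (l² + 3/2))`. The smallness hypothesis says exactly that this exceeds `ε² S² / 3`. -/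
lemma neg_flatForm_lt_sq {ε l : ℝ} (hsmall : 3 * ε ^ 2 < (1 - 2 * ε ^ 2) * l ^ 2) {v : E3}
    (hS : 0 < v 0 + v 1 + v 2) (i : Fin 3) :
    -flatForm (2 * ε) v < (l * v i) ^ 2 := by
  have key : ∀ x y z : ℝ, 0 < x + y + z →
      ε ^ 2 * (x + y + z) ^ 2 / 3 - (x ^ 2 + y ^ 2 + z ^ 2 - (x + y + z) ^ 2 / 3) < (l * x) ^ 2 := by
    intro x y z h
    set S := x + y + z with hSd
    -- For given `x` and `S` the left side is smallest at `y = z`.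
    have hQ : x ^ 2 + y ^ 2 + z ^ 2 - S ^ 2 / 3 ≥ 3 / 2 * (x - S / 3) ^ 2 := by
      rw [hSd]; nlinarith [sq_nonneg (y - z)]
    suffices h3 : 0 < (l * x) ^ 2 + 3 / 2 * (x - S / 3) ^ 2 - ε ^ 2 * S ^ 2 / 3 by linarith
    have hL : 0 < l ^ 2 + 3 / 2 := by positivity
    have h1 : 0 < S ^ 2 / 6 * ((1 - 2 * ε ^ 2) * l ^ 2 - 3 * ε ^ 2) :=
      mul_pos (by positivity) (by linarith)
    have h2 : (l ^ 2 + 3 / 2) * ((l * x) ^ 2 + 3 / 2 * (x - S / 3) ^ 2 - ε ^ 2 * S ^ 2 / 3) =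
      ((l ^ 2 + 3 / 2) * (x - S / 3) + l ^ 2 * S / 3) ^ 2 +
        S ^ 2 / 6 * ((1 - 2 * ε ^ 2) * l ^ 2 - 3 * ε ^ 2) := by ring
    exact pos_of_mul_pos_right (h2 ▸ add_pos_of_nonneg_of_pos (sq_nonneg _) h1) hL.le
  rw [flatForm_eq_coords]
  fin_cases i <;> simp only [Fin.zero_eta, Fin.mk_one, Fin.reduceFinMk]
  · have := key (v 0) (v 1) (v 2) hS; linarith
  · have := key (v 1) (v 0) (v 2) (by linarith)
    rw [show v 1 + v 0 + v 2 = v 0 + v 1 + v 2 by ring] at this; linarith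
  · have := key (v 2) (v 0) (v 1) (by linarith)
    rw [show v 2 + v 0 + v 1 = v 0 + v 1 + v 2 by ring] at this; linarith

lemma tubeForm_ge (lam : Fin 3 → ℝ) (i : Fin 3) (v : E3) :
    -(lam i * v i) ^ 2 ≤ tubeForm lam i v := by
  have : 0 ≤ ∑ j ∈ Finset.univ.erase i, 1 / 3 * (v j) ^ 2 :=
    Finset.sum_nonneg fun j _ => by positivity
  rw [tubeForm]; nlinarith [mul_nonneg (sq_nonneg (lam i)) this]

lemma coord_eq_zero_of_tubeForm_eq {lam : Fin 3 → ℝ} {i : Fin 3} (hlam : 0 < lam i) {v : E3}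
    (h : tubeForm lam i v = -(lam i * v i) ^ 2) {j : Fin 3} (hj : j ≠ i) : v j = 0 := by
  have hp : 0 < lam i ^ 2 := by positivity
  have h' : ∑ j ∈ Finset.univ.erase i, 1 / 3 * (v j) ^ 2 = 0 := by
    rw [tubeForm] at h
    have : lam i ^ 2 * ∑ j ∈ Finset.univ.erase i, 1 / 3 * (v j) ^ 2 = 0 := by nlinarith
    simpa [hp.ne'] using this
  rw [Finset.sum_eq_zero_iff_of_nonneg (fun j _ => by positivity)] at h'
  simpa using h' j (by simp [hj])

/-! ### Causal vectors of a Hedlund metric -/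

variable {lam : Fin 3 → ℝ} {ε : ℝ} {g : LorentzMetric}

lemma form_add_smul (g : LorentzMetric) (p : T3) (v w : E3) (s : ℝ) :
    g.form p (v + s • w) (v + s • w) =
      g.form p v v + 2 * s * g.form p v w + s ^ 2 * g.form p w w := by
  simp only [map_add, map_smul, add_apply, smul_apply,
    smul_eq_mul, g.symm p w v]
  ring

lemma IsHedlundMetric.form_vOne_neg (hg : IsHedlundMetric lam ε g) (hε : 0 < ε) (p : E3) :
    g.form (proj p) vOne vOne < 0 := by
  have h := hg.lower p vOne (by rw [flatForm_vOne]; nlinarith)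
  rw [flatForm_vOne] at h
  have : 0 < ε ^ 2 := by positivity
  simp only [LorentzMetric.lift] at h
  linarith

/-- If a linear functional is positive at `v₁` and every causal vector in its kernel vanishes,
then it is positive on the future pointing causal vectors. -/
lemma FutureCausal.pos_of_ker {p : T3} {v : E3} (hv : FutureCausal g p v)
    (h1 : g.form p vOne vOne < 0) (φ : E3 →ₗ[ℝ] ℝ) (hφ : 0 < φ vOne)
    (hker : ∀ u, g.form p u u ≤ 0 → φ u = 0 → u = 0) : 0 < φ v := by
  by_contra! hle
  obtain ⟨hv0, hvv, hv1⟩ := hv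
  -- Moving from `v` in the direction `v₁` keeps the vector causal and reaches the kernel of `φ`.
  -- There it must vanish, so `v` is a nonpositive multiple of `v₁`.
  set s := -φ v / φ vOne with hs
  have hs0 : 0 ≤ s := div_nonneg (by linarith) hφ.le
  have hz := hker (v + s • vOne) (by rw [form_add_smul]; nlinarith [sq_nonneg s]) (by
    simp only [map_add, map_smul, smul_eq_mul, hs]; field_simp; ring)
  have hvs : v = -s • vOne := by rw [neg_smul]; exact eq_neg_of_add_eq_zero_left hz
  rw [hvs] at hv1
  simp only [map_smul, smul_apply, smul_eq_mul] at hv1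
  nlinarith

lemma IsHedlundMetric.tube_le (hg : IsHedlundMetric lam ε g) {i : Fin 3} {p : E3}
    (hp : p ∈ Metric.thickening ε (lineFamily i)) {v : E3} (hv : g.form (proj p) v v ≤ 0) :
    tubeForm lam i v ≤ g.form (proj p) v v := by
  by_cases hpi : p ∈ lineFamily i
  · exact ((hg.upper_on i p hp).1 hpi v).ge
  · by_cases h0 : v = 0
    · simp [h0, tubeForm]
    · exact ((hg.upper_on i p hp).2 hpi v h0 hv).le

lemma IsHedlundMetric.coord_pos (hg : IsHedlundMetric lam ε g) (hε : 0 < ε) {i : Fin 3}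
    (hlam : 0 < lam i) {p : E3} (hp : p ∈ Metric.thickening ε (lineFamily i)) {v : E3}
    (hv : FutureCausal g (proj p) v) : 0 < v i := by
  refine hv.pos_of_ker (hg.form_vOne_neg hε p) (EuclideanSpace.proj i : E3 →L[ℝ] ℝ).toLinearMap ?_ ?_
  · simp [vOne_apply]
  · intro u hu hi
    exact eq_zero_of_tubeForm_nonpos hlam ((hg.tube_le hp hu).trans hu) (by simpa using hi)

lemma IsHedlundMetric.sum_coord_pos (hg : IsHedlundMetric lam ε g) (hε : 0 < ε) {p : E3}
    (hp : p ∉ Metric.thickening ε (⋃ i, lineFamily i)) {v : E3}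
    (hv : FutureCausal g (proj p) v) : 0 < v 0 + v 1 + v 2 := by
  refine hv.pos_of_ker (hg.form_vOne_neg hε p)
    ((EuclideanSpace.proj 0 : E3 →L[ℝ] ℝ) + (EuclideanSpace.proj 1 : E3 →L[ℝ] ℝ) +
      (EuclideanSpace.proj 2 : E3 →L[ℝ] ℝ)).toLinearMap ?_ ?_
  · change 0 < vOne 0 + vOne 1 + vOne 2
    rw [sum_vOne]; positivity
  · intro u hu hi
    exact eq_zero_of_flatForm_nonpos ((hg.upper_off p hp u hu).trans hu) (by simpa using hi)

/-- A combination of `u` and `w` lies in the complement of the timelike vector from `signature`,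
where the form is definite. As `u` and `w` are orthogonal and causal, so is their combination
causal, hence zero. -/
lemma LorentzMetric.eq_zero_of_orthogonal (g : LorentzMetric) {p : T3} {u w : E3}
    (hw : g.form p w w < 0) (hu : g.form p u u ≤ 0) (huw : g.form p u w = 0) : u = 0 := by
  obtain ⟨v, hv, hpos⟩ := g.signature p
  by_contra hu0
  have hvw : g.form p v w ≠ 0 := fun h => by
    have := hpos w (fun h0 => by simp [h0] at hw) h
    linarith
  set n := g.form p v w • u + (-g.form p v u) • w with hn
  have hn0 : n = 0 := by
    by_contra hne
    have h1 := hpos n hne (by simp [hn]; ring)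
    rw [hn, form_add_smul] at h1
    simp only [map_smul, smul_apply, smul_eq_mul, huw] at h1
    nlinarith [mul_nonneg (sq_nonneg (g.form p v w)) (neg_nonneg.2 hu),
      mul_nonneg (sq_nonneg (g.form p v u)) (neg_nonneg.2 hw.le)]
  have h2 : g.form p n w = 0 := by rw [hn0]; simp
  simp only [hn, map_add, map_smul, add_apply, smul_apply,
    smul_eq_mul, huw] at h2
  have hvu : g.form p v u = 0 := by
    have : g.form p v u * g.form p w w = 0 := by linarith
    exact (mul_eq_zero.1 this).resolve_right hw.ne
  rw [hn, hvu] at hn0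
  simp [hvw, hu0] at hn0

lemma LorentzMetric.nondegenerate (g : LorentzMetric) {p : T3} {a : E3}
    (h : ∀ w, g.form p a w = 0) : a = 0 := by
  obtain ⟨v, hv, hpos⟩ := g.signature p
  by_contra h0
  have := hpos a h0 (by rw [g.symm, h])
  rw [h] at this; exact lt_irrefl _ this

/-- Vectors in the thin cone of `g_ε` around `v₁` are future pointing. -/
lemma IsHedlundMetric.futureCausal_of_flatForm (hg : IsHedlundMetric lam ε g) (hε : 0 < ε) (p : E3)
    {w : E3} (hw : flatForm ε w ≤ 0) (hS : 0 < w 0 + w 1 + w 2) : FutureCausal g (proj p) w := by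
  have h1 := hg.form_vOne_neg hε p
  refine ⟨fun h => by simp [h] at hS, (hg.lower p w hw).trans hw, ?_⟩
  by_contra! hle
  -- This `s ≥ 0` makes `w + s v₁` orthogonal to `v₁`. The sum stays in the thin cone, hence is
  -- causal and vanishes, against its positive coordinate sum.
  set s := g.form (proj p) w vOne / -g.form (proj p) vOne vOne with hs
  have hs0 : 0 ≤ s := div_nonneg hle (by linarith)
  have hflat : flatForm ε (w + s • vOne) ≤ 0 := by
    rw [flatForm_eq_coords] at hw ⊢
    have h3 : (0 : ℝ) < √3 := by positivity
    simp only [PiLp.add_apply, PiLp.smul_apply, vOne_apply, smul_eq_mul]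
    set c := s * (1 / √3) with hc
    have hc0 : 0 ≤ c := by positivity
    nlinarith [mul_nonneg hc0 hS.le, mul_nonneg (sq_nonneg ε) (mul_nonneg hc0 hS.le),
      mul_nonneg (sq_nonneg ε) (sq_nonneg c)]
  have h0 := g.eq_zero_of_orthogonal h1 ((hg.lower p _ hflat).trans hflat) (by
    simp only [map_add, map_smul, add_apply, smul_apply,
      smul_eq_mul, hs]
    have : g.form (proj p) vOne vOne ≠ 0 := h1.ne
    field_simp; ring)
  have hsum : (w + s • vOne) 0 + (w + s • vOne) 1 + (w + s • vOne) 2 = 0 := by rw [h0]; simp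
  have : w 0 + w 1 + w 2 + s * √3 = 0 := by
    rw [← sum_vOne, ← hsum]; simp; ring
  have h3 : (0 : ℝ) < √3 := by positivity
  nlinarith [mul_nonneg hs0 h3.le]

/-! ### Calibrating potentials -/

/-- The triangle wave on the circle that is the identity on `[-1/4, 1/4]`. -/
def saw (a : UnitAddCircle) : ℝ := ‖a + ((1 / 4 : ℝ) : UnitAddCircle)‖ - 1 / 4

/-- The `j`-th coordinate of a point of the torus relative to the line `l_i`. -/
def relCoord (i j : Fin 3) (p : T3) : UnitAddCircle := p j - (basePt i j : UnitAddCircle)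

/-- The function `∑_{j ≠ i} w_j x_j` near `l_i`. -/
def transverse (w : Fin 3 → ℝ) (i : Fin 3) (p : T3) : ℝ :=
  ∑ j ∈ Finset.univ.erase i, w j * saw (relCoord i j p)

/-- The truncation height, which vanishes away from `l_i`. -/
def height (w : Fin 3 → ℝ) (i : Fin 3) (p : T3) : ℝ :=
  (∑ j ∈ Finset.univ.erase i, w j) * (3 / 50) *
    max 0 (1 / 5 - ∑ j ∈ Finset.univ.erase i, ‖relCoord i j p‖)

/-- The function on the torus by which the linear form `∑ w_j x_j` is corrected. -/
def correction (w : Fin 3 → ℝ) (p : T3) : ℝ :=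
  ∑ i, max (-height w i p) (min (transverse w i p) (height w i p))

/-- The corrected linear form; near `l_i` it is `w_i x_i`, up to a constant. -/
def potential (w : Fin 3 → ℝ) (x : E3) : ℝ := ∑ j, w j * x j - correction w (proj x)

lemma continuous_saw : Continuous saw := by unfold saw; fun_prop

lemma continuous_relCoord (i j : Fin 3) : Continuous (relCoord i j) := by unfold relCoord; fun_prop

lemma continuous_correction (w : Fin 3 → ℝ) : Continuous (correction w) := by
  unfold correction height transverse
  have := continuous_saw
  have := continuous_relCoord
  fun_prop

lemma exists_correction_bound (w : Fin 3 → ℝ) : ∃ C, 0 ≤ C ∧ ∀ p, |correction w p| ≤ C := by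
  obtain ⟨C, hC⟩ := isCompact_univ.exists_bound_of_continuousOn (continuous_correction w).continuousOn
  refine ⟨|C|, abs_nonneg _, fun p => (hC p (mem_univ _)).trans (le_abs_self _)⟩

lemma continuous_proj : Continuous proj := by
  unfold proj
  refine continuous_pi fun i => ?_
  exact (AddCircle.continuous_mk' 1).comp (by fun_prop)

/-! ### Lipschitz regularity of the potentials -/

/-- Real functions that are Lipschitz for some constant. -/
def IsLip {X : Type*} [PseudoMetricSpace X] (f : X → ℝ) : Prop := ∃ K, LipschitzWith K f

lemma IsLip.add {X : Type*} [PseudoMetricSpace X] {f h : X → ℝ} (hf : IsLip f) (hh : IsLip h) :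
    IsLip fun x => f x + h x := by
  obtain ⟨K, hK⟩ := hf; obtain ⟨L, hL⟩ := hh; exact ⟨_, hK.add hL⟩

lemma IsLip.sub {X : Type*} [PseudoMetricSpace X] {f h : X → ℝ} (hf : IsLip f) (hh : IsLip h) :
    IsLip fun x => f x - h x := by
  obtain ⟨K, hK⟩ := hf; obtain ⟨L, hL⟩ := hh; exact ⟨_, hK.sub hL⟩

lemma IsLip.neg {X : Type*} [PseudoMetricSpace X] {f : X → ℝ} (hf : IsLip f) :
    IsLip fun x => -f x := by
  obtain ⟨K, hK⟩ := hf; exact ⟨_, hK.neg⟩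

lemma IsLip.max {X : Type*} [PseudoMetricSpace X] {f h : X → ℝ} (hf : IsLip f) (hh : IsLip h) :
    IsLip fun x => max (f x) (h x) := by
  obtain ⟨K, hK⟩ := hf; obtain ⟨L, hL⟩ := hh; exact ⟨_, hK.max hL⟩

lemma IsLip.min {X : Type*} [PseudoMetricSpace X] {f h : X → ℝ} (hf : IsLip f) (hh : IsLip h) :
    IsLip fun x => min (f x) (h x) := by
  obtain ⟨K, hK⟩ := hf; obtain ⟨L, hL⟩ := hh; exact ⟨_, hK.min hL⟩

lemma IsLip.const {X : Type*} [PseudoMetricSpace X] (c : ℝ) : IsLip fun _ : X => c :=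
  ⟨0, LipschitzWith.const c⟩

lemma IsLip.const_mul {X : Type*} [PseudoMetricSpace X] {f : X → ℝ} (hf : IsLip f) (c : ℝ) :
    IsLip fun x => c * f x := by
  obtain ⟨K, hK⟩ := hf
  exact ⟨_, (lipschitzWith_smul c).comp hK⟩

lemma IsLip.sum {X : Type*} [PseudoMetricSpace X] {s : Finset (Fin 3)} {f : Fin 3 → X → ℝ}
    (hf : ∀ i, IsLip (f i)) : IsLip fun x => ∑ i ∈ s, f i x := by
  induction s using Finset.induction_on with
  | empty => simpa using IsLip.const 0
  | insert a s ha ih => simpa [Finset.sum_insert ha] using (hf a).add ih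

lemma norm_coe_le_abs (y : ℝ) : ‖(y : UnitAddCircle)‖ ≤ |y| := by
  rw [UnitAddCircle.norm_eq]
  simpa using round_le y 0

lemma coe_int_eq_zero (n : ℤ) : ((n : ℝ) : UnitAddCircle) = 0 :=
  (AddCircle.coe_eq_zero_iff 1).2 ⟨n, by simp⟩

lemma isLip_norm_relCoord (i j : Fin 3) (a : UnitAddCircle) :
    IsLip fun x : E3 => ‖relCoord i j (proj x) + a‖ := by
  refine ⟨1, LipschitzWith.of_dist_le_mul fun x y => ?_⟩
  rw [NNReal.coe_one, one_mul, Real.dist_eq]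
  refine (abs_norm_sub_norm_le _ _).trans ?_
  have : relCoord i j (proj x) + a - (relCoord i j (proj y) + a) = ((x j - y j : ℝ) : UnitAddCircle) := by
    simp [relCoord, proj]
  rw [this]
  refine (norm_coe_le_abs _).trans ?_
  have := PiLp.norm_apply_le (x - y) j
  simpa [dist_eq_norm] using this

/-- The clamps create kinks, so the potentials are not smooth; the Lipschitz property still makes
them absolutely continuous along future pointing curves. -/
lemma isLip_potential (w : Fin 3 → ℝ) : IsLip (potential w) := by
  have hn : ∀ i j, IsLip fun x : E3 => ‖relCoord i j (proj x)‖ := fun i j => by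
    simpa using isLip_norm_relCoord i j 0
  have hs : ∀ i j, IsLip fun x : E3 => saw (relCoord i j (proj x)) := fun i j =>
    (isLip_norm_relCoord i j _).sub (IsLip.const _)
  have hh : ∀ i, IsLip fun x : E3 => height w i (proj x) := fun i =>
    ((IsLip.const _).max ((IsLip.const _).sub (IsLip.sum fun j => hn i j))).const_mul _
  have hx : ∀ j, IsLip fun x : E3 => x j := fun j =>
    ⟨1, LipschitzWith.of_dist_le_mul fun x y => by
      have := PiLp.norm_apply_le (x - y) j
      simpa [dist_eq_norm] using this⟩
  refine (IsLip.sum fun j => (hx j).const_mul (w j)).sub (IsLip.sum fun i => ?_)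
  exact (hh i).neg.max ((IsLip.sum fun j => (hs i j).const_mul (w j)).min (hh i))

lemma saw_coe {y : ℝ} {n : ℤ} (h : |y - n| ≤ 1 / 4) : saw (y : UnitAddCircle) = y - n := by
  have h1 : (y : UnitAddCircle) + ((1 / 4 : ℝ) : UnitAddCircle) = ((y - n + 1 / 4 : ℝ) : UnitAddCircle) := by
    simp [coe_int_eq_zero]
  obtain ⟨ha, hb⟩ := abs_le.1 h
  rw [saw, h1, (AddCircle.norm_coe_eq_abs_iff (1 : ℝ) one_ne_zero).2, abs_of_nonneg] <;>
    [ring; linarith; (rw [abs_le]; norm_num; constructor <;> linarith)]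

/-! ### The potentials near the lines and away from them -/

/-- `n` witnesses that the point `x` is `r`-close to the translate `l_i + n`. -/
def NearLine (i : Fin 3) (n : Fin 3 → ℤ) (r : ℝ) (x : E3) : Prop :=
  ∀ j, j ≠ i → |x j - basePt i j - n j| < r

lemma NearLine.eventually {i : Fin 3} {n : Fin 3 → ℤ} {r : ℝ} {x : E3} (h : NearLine i n r x) :
    ∀ᶠ y in 𝓝 x, NearLine i n r y := by
  unfold NearLine
  rw [eventually_all]
  intro j
  by_cases hj : j = i
  · simp [hj]
  · have hc : ContinuousAt (fun y : E3 => |y j - basePt i j - n j|) x := by fun_prop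
    filter_upwards [hc.eventually_lt continuousAt_const (h j hj)] with y hy _ using hy

lemma relCoord_proj (i j : Fin 3) (x : E3) :
    relCoord i j (proj x) = ((x j - basePt i j : ℝ) : UnitAddCircle) := by
  simp [relCoord, proj]

lemma norm_relCoord_le (i j : Fin 3) (x : E3) (n : ℤ) :
    ‖relCoord i j (proj x)‖ ≤ |x j - basePt i j - n| := by
  have : relCoord i j (proj x) = ((x j - basePt i j - n : ℝ) : UnitAddCircle) := by
    simp [relCoord, proj, coe_int_eq_zero]
  rw [this]; exact norm_coe_le_abs _

lemma exists_int_norm_relCoord (i j : Fin 3) (x : E3) :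
    ∃ n : ℤ, |x j - basePt i j - n| = ‖relCoord i j (proj x)‖ :=
  ⟨round (x j - basePt i j), by rw [relCoord_proj, UnitAddCircle.norm_eq]⟩

/-- The coordinate transverse to both lines separates them by `1/2`, the largest distance on the
circle. This keeps the supports of the heights disjoint. -/
lemma exists_third (i k : Fin 3) (h : k ≠ i) :
    ∃ j, j ≠ i ∧ j ≠ k ∧ |basePt i j - basePt k j| = 1 / 2 := by
  fin_cases i <;> fin_cases k <;> simp at h <;>
    first
    | exact ⟨0, by decide, by decide, by norm_num [basePt]⟩
    | exact ⟨1, by decide, by decide, by norm_num [basePt]⟩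
    | exact ⟨2, by decide, by decide, by simp [basePt]⟩

lemma norm_relCoord_add_ge (i k j : Fin 3) (h : |basePt i j - basePt k j| = 1 / 2) (p : T3) :
    1 / 2 ≤ ‖relCoord i j p‖ + ‖relCoord k j p‖ := by
  have h1 : relCoord k j p - relCoord i j p = ((basePt i j - basePt k j : ℝ) : UnitAddCircle) := by
    simp [relCoord]
  have h2 : ‖((basePt i j - basePt k j : ℝ) : UnitAddCircle)‖ = 1 / 2 := by
    rw [(AddCircle.norm_coe_eq_abs_iff (1 : ℝ) one_ne_zero).2 (by rw [h]; norm_num), h]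
  rw [← h2, ← h1, add_comm]
  exact norm_sub_le _ _

lemma height_eq_zero (w : Fin 3 → ℝ) {i j : Fin 3} (hj : j ≠ i) {p : T3}
    (h : 1 / 5 ≤ ‖relCoord i j p‖) : height w i p = 0 := by
  have : ‖relCoord i j p‖ ≤ ∑ j ∈ Finset.univ.erase i, ‖relCoord i j p‖ :=
    Finset.single_le_sum (f := fun j => ‖relCoord i j p‖) (fun _ _ => norm_nonneg _) (by simp [hj])
  rw [height, max_eq_left (by linarith), mul_zero]

lemma height_nonneg {w : Fin 3 → ℝ} (hw : ∀ i, 0 ≤ w i) (i : Fin 3) (p : T3) : 0 ≤ height w i p :=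
  mul_nonneg (mul_nonneg (Finset.sum_nonneg fun j _ => hw j) (by norm_num)) (le_max_left _ _)

/-- The right side is nondecreasing in `U + M` and in `U - M`, so it increases whenever `U` grows by
at least the change of `M`. -/
lemma sub_clamp (U M : ℝ) (hM : 0 ≤ M) :
    U - max (-M) (min U M) = min (U + M) (max 0 (U - M)) := by
  grind

/-- Up to distance `1/4` the sawtooth is linear, and by the offset `1/2` any other family is more
than `1/4` away in some transverse coordinate. Only the clamp of index `i` survives. -/
lemma potential_eq_of_nearLine {w : Fin 3 → ℝ} (hw : ∀ i, 0 ≤ w i) {i : Fin 3} {n : Fin 3 → ℤ}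
    {x : E3} (h : NearLine i n (1 / 4) x) :
    potential w x = w i * x i + ∑ j ∈ Finset.univ.erase i, w j * (basePt i j + n j) +
      min (∑ j ∈ Finset.univ.erase i, w j * (x j - basePt i j - n j) + height w i (proj x))
        (max 0 (∑ j ∈ Finset.univ.erase i, w j * (x j - basePt i j - n j) -
          height w i (proj x))) := by
  have hT : transverse w i (proj x) = ∑ j ∈ Finset.univ.erase i, w j * (x j - basePt i j - n j) := by
    refine Finset.sum_congr rfl fun j hj => ?_
    rw [relCoord_proj, saw_coe (h j (Finset.ne_of_mem_erase hj)).le]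
  have hc : correction w (proj x) = max (-height w i (proj x))
      (min (transverse w i (proj x)) (height w i (proj x))) := by
    refine Finset.sum_eq_single i (fun k _ hk => ?_) (by simp)
    obtain ⟨j, hji, hjk, hd⟩ := exists_third i k hk
    have h1 := norm_relCoord_add_ge i k j hd (proj x)
    have h2 := (norm_relCoord_le i j x (n j)).trans_lt (h j hji)
    rw [height_eq_zero w hjk (by linarith)]
    simp
  have hs := sub_clamp (transverse w i (proj x)) _ (height_nonneg hw i (proj x))
  rw [potential, hc, ← hT, ← hs, hT, ← Finset.add_sum_erase _ _ (Finset.mem_univ i)]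
  have : ∑ j ∈ Finset.univ.erase i, w j * x.ofLp j =
    ∑ j ∈ Finset.univ.erase i, w j * (basePt i j + n j) +
      ∑ j ∈ Finset.univ.erase i, w j * (x j - basePt i j - n j) := by
    rw [← Finset.sum_add_distrib]; exact Finset.sum_congr rfl fun j _ => by ring
  rw [this]; ring

lemma sum_erase_const (i : Fin 3) (c : ℝ) : ∑ _j ∈ Finset.univ.erase i, c = 2 * c := by
  rw [Finset.sum_const, Finset.card_erase_of_mem (Finset.mem_univ i)]; simp

/-- The clamp is inactive: with `W` the transverse weight, the transverse part is at most `W / 100`,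
and the height is at least `W (3/50)(1/5 - 2/100) = 27 W / 2500`. -/
lemma potential_eq_of_tube {w : Fin 3 → ℝ} (hw : ∀ i, 0 ≤ w i) {i : Fin 3} {n : Fin 3 → ℤ}
    {x : E3} (h : NearLine i n (1 / 100) x) :
    potential w x = w i * x i + ∑ j ∈ Finset.univ.erase i, w j * (basePt i j + n j) := by
  have h4 : NearLine i n (1 / 4) x := fun j hj => (h j hj).trans (by norm_num)
  rw [potential_eq_of_nearLine hw h4]
  set W := ∑ j ∈ Finset.univ.erase i, w j with hW
  have hW0 : 0 ≤ W := Finset.sum_nonneg fun j _ => hw j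
  have hU : |∑ j ∈ Finset.univ.erase i, w j * (x j - basePt i j - n j)| ≤ W * (1 / 100) := by
    refine (Finset.abs_sum_le_sum_abs _ _).trans ?_
    rw [hW, Finset.sum_mul]
    refine Finset.sum_le_sum fun j hj => ?_
    rw [abs_mul, abs_of_nonneg (hw j)]
    exact mul_le_mul_of_nonneg_left (h j (Finset.ne_of_mem_erase hj)).le (hw j)
  have hr : ∑ j ∈ Finset.univ.erase i, ‖relCoord i j (proj x)‖ ≤ 2 * (1 / 100) := by
    rw [← sum_erase_const i]
    exact Finset.sum_le_sum fun j hj =>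
      (norm_relCoord_le i j x (n j)).trans (h j (Finset.ne_of_mem_erase hj)).le
  have hH : W * (1 / 100) ≤ height w i (proj x) := by
    have hm := le_max_right 0 (1 / 5 - ∑ j ∈ Finset.univ.erase i, ‖relCoord i j (proj x)‖)
    rw [height, ← hW, mul_assoc]
    apply mul_le_mul_of_nonneg_left _ hW0
    linarith
  have := abs_le.1 (hU.trans hH)
  rw [max_eq_left (by linarith), min_eq_right (by linarith), add_zero]

lemma potential_eq_of_far {w : Fin 3 → ℝ} {x : E3}
    (h : ∀ i, ∃ j, j ≠ i ∧ 1 / 5 ≤ ‖relCoord i j (proj x)‖) :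
    potential w x = ∑ j, w j * x j := by
  rw [potential, sub_eq_self, correction]
  refine Finset.sum_eq_zero fun i _ => ?_
  obtain ⟨j, hj, h5⟩ := h i
  rw [height_eq_zero w hj h5]; simp

lemma abs_height_sub_le {w : Fin 3 → ℝ} (hw : ∀ i, 0 ≤ w i) (i : Fin 3) (x v : E3) :
    |height w i (proj (x + v)) - height w i (proj x)| ≤
      (∑ j ∈ Finset.univ.erase i, w j) * (3 / 50) * ∑ j ∈ Finset.univ.erase i, |v j| := by
  have hW0 : 0 ≤ ∑ j ∈ Finset.univ.erase i, w j := Finset.sum_nonneg fun j _ => hw j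
  rw [height, height, ← mul_sub, abs_mul, abs_of_nonneg (by positivity)]
  apply mul_le_mul_of_nonneg_left _ (by positivity)
  refine (abs_max_sub_max_le_max _ _ _ _).trans ?_
  rw [sub_self, abs_zero, max_eq_right (abs_nonneg _)]
  rw [sub_sub_sub_cancel_left, ← Finset.sum_sub_distrib]
  refine (Finset.abs_sum_le_sum_abs _ _).trans (Finset.sum_le_sum fun j _ => ?_)
  refine (abs_norm_sub_norm_le _ _).trans ?_
  have : relCoord i j (proj x) - relCoord i j (proj (x + v)) = ((-v j : ℝ) : UnitAddCircle) := by
    simp [relCoord, proj]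
  rw [this, ← abs_neg]; exact norm_coe_le_abs _

/-- Along directions close to `v₁` the potentials increase at least as fast as one of the
coordinates. -/
lemma potential_increment_of_nearLine {w : Fin 3 → ℝ} (hw : ∀ i, 0 ≤ w i) {i : Fin 3}
    {n : Fin 3 → ℤ} {x v : E3} {S : ℝ} (hS : 0 ≤ S) (hv : ∀ j, |v j - S| ≤ S / 50)
    (h : NearLine i n (1 / 4) x) (h' : NearLine i n (1 / 4) (x + v)) :
    w i * v i ≤ potential w (x + v) - potential w x := by
  rw [potential_eq_of_nearLine hw h, potential_eq_of_nearLine hw h']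
  set W := ∑ j ∈ Finset.univ.erase i, w j with hW
  have hW0 : 0 ≤ W := Finset.sum_nonneg fun j _ => hw j
  have hM := abs_height_sub_le hw i x v
  rw [← hW] at hM
  have hsum : ∑ j ∈ Finset.univ.erase i, |v j| ≤ 2 * (51 / 50 * S) := by
    rw [← sum_erase_const i]
    refine Finset.sum_le_sum fun j _ => ?_
    have := abs_le.1 (hv j)
    rw [abs_le]; constructor <;> linarith
  have hU : W * (49 / 50 * S) ≤ ∑ j ∈ Finset.univ.erase i, w j * v j := by
    rw [hW, Finset.sum_mul]
    refine Finset.sum_le_sum fun j _ => mul_le_mul_of_nonneg_left ?_ (hw j)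
    have := abs_le.1 (hv j)
    linarith
  have hUd : ∑ j ∈ Finset.univ.erase i, w j * ((x + v) j - basePt i j - n j) =
      ∑ j ∈ Finset.univ.erase i, w j * (x j - basePt i j - n j) +
        ∑ j ∈ Finset.univ.erase i, w j * v j := by
    rw [← Finset.sum_add_distrib]
    exact Finset.sum_congr rfl fun j _ => by simp only [PiLp.add_apply]; ring
  -- The transverse part gains at least `(49/50) W S`, while the height changes by at most `(3/50) ·
  -- 2 · (51/50) W S`; hence the small slope `3/50` of the height.
  have hle : |height w i (proj (x + v)) - height w i (proj x)| ≤
      ∑ j ∈ Finset.univ.erase i, w j * v j := by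
    refine hM.trans (le_trans ?_ hU)
    calc W * (3 / 50) * ∑ j ∈ Finset.univ.erase i, |v j| ≤ W * (3 / 50) * (2 * (51 / 50 * S)) := by
          gcongr
      _ ≤ W * (49 / 50 * S) := by nlinarith [mul_nonneg hW0 hS]
  rw [hUd]
  have hab := abs_le.1 hle
  set U := ∑ j ∈ Finset.univ.erase i, w j * (x j - basePt i j - n j)
  set D := ∑ j ∈ Finset.univ.erase i, w j * v j
  set M := height w i (proj x)
  set M' := height w i (proj (x + v))
  have hmono : min (U + M) (max 0 (U - M)) ≤ min (U + D + M') (max 0 (U + D - M')) := by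
    apply min_le_min
    · linarith
    · apply max_le_max le_rfl; linarith
  simp only [PiLp.add_apply]
  linarith

/-- Near a line of `L_i` the clamped part is monotone along `v`. Far from all lines the potential is
locally the linear form, whose increments along `v` are sums of nonnegative terms, so every single
term is a lower bound. -/
lemma eventually_potential_ge_of_thin {w : Fin 3 → ℝ} (hw : ∀ i, 0 ≤ w i) {x v : E3} {S : ℝ}
    (hS : 0 ≤ S) (hv : ∀ j, |v j - S| ≤ S / 50) (i : Fin 3)
    (hx : (∃ n, NearLine i n (1 / 4) x) ∨ ∀ k n, ¬ NearLine k n (1 / 4) x) :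
    ∀ᶠ h in 𝓝[>] (0 : ℝ), h * (w i * v i) ≤ potential w (x + h • v) - potential w x := by
  have htend : Tendsto (fun h : ℝ => x + h • v) (𝓝[>] 0) (𝓝 x) := by
    have : ContinuousAt (fun h : ℝ => x + h • v) 0 := by fun_prop
    simpa using this.tendsto.mono_left (nhdsWithin_le_nhds (s := Ioi 0))
  rcases hx with ⟨n, hn⟩ | hx
  · filter_upwards [htend.eventually hn.eventually, self_mem_nhdsWithin] with h hh hpos
    have hpos' : 0 < h := hpos
    have := potential_increment_of_nearLine hw (S := h * S) (v := h • v) (by positivity)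
      (fun j => by
        simp only [PiLp.smul_apply, smul_eq_mul]
        rw [← mul_sub, abs_mul, abs_of_pos hpos', mul_div_assoc]
        exact mul_le_mul_of_nonneg_left (hv j) hpos'.le) hn hh
    simp only [PiLp.smul_apply, smul_eq_mul] at this
    linarith
  · have hfar : ∀ k, ∃ j, j ≠ k ∧ 1 / 4 ≤ ‖relCoord k j (proj x)‖ := by
      intro k
      by_contra! hcon
      choose n hn using fun j => exists_int_norm_relCoord k j x
      exact hx k n fun j hj => by rw [hn]; exact hcon j hj
    -- The gap between `1/4` and the cutoff radius `1/5` of the heights makes the far condition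
    -- stable under small moves.
    have hev : ∀ᶠ y in 𝓝 x, ∀ k, ∃ j, j ≠ k ∧ 1 / 5 ≤ ‖relCoord k j (proj y)‖ := by
      rw [eventually_all]
      intro k
      obtain ⟨j, hj, h4⟩ := hfar k
      have hc : ContinuousAt (fun y : E3 => ‖relCoord k j (proj y)‖) x :=
        ((continuous_relCoord k j).comp continuous_proj).norm.continuousAt
      filter_upwards [continuousAt_const.eventually_lt hc (show (1 / 5 : ℝ) < _ by linarith)]
        with y hy using ⟨j, hj, hy.le⟩
    filter_upwards [htend.eventually hev, self_mem_nhdsWithin] with h hh hpos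
    have hpos' : 0 < h := hpos
    rw [potential_eq_of_far hh, potential_eq_of_far hev.self_of_nhds, ← Finset.sum_sub_distrib]
    have h1 : ∀ j, w j * (x + h • v) j - w j * x j = h * (w j * v j) := fun j => by
      simp; ring
    simp only [h1]
    refine Finset.single_le_sum (f := fun j => h * (w j * v j)) (fun j _ => ?_) (Finset.mem_univ i)
    have := abs_le.1 (hv j)
    exact mul_nonneg hpos'.le (mul_nonneg (hw j) (by linarith))

/-! ### The local calibration estimate -/

lemma exists_nearLine_of_mem_thickening {i : Fin 3} {ε : ℝ} {x : E3}
    (h : x ∈ Metric.thickening ε (lineFamily i)) : ∃ n, NearLine i n ε x := by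
  obtain ⟨y, ⟨t, k, rfl⟩, hd⟩ := Metric.mem_thickening_iff.1 h
  refine ⟨k, fun j hj => lt_of_le_of_lt ?_ hd⟩
  have := PiLp.norm_apply_le (x - (line i t + WithLp.toLp 2 fun j => (k j : ℝ))) j
  rw [dist_eq_norm]
  refine le_trans (le_of_eq ?_) this
  simp [line, stdE, hj, sub_sub, Real.norm_eq_abs]

/-- The fundamental local estimate. -/
lemma IsHedlundMetric.exists_index {lam : Fin 3 → ℝ} {ε : ℝ} {g : LorentzMetric}
    (hg : IsHedlundMetric lam ε g) (hlam : ∀ i, 0 < lam i) (hε : 0 < ε) (hε' : ε < 1 / 100)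
    (hsmall : ∀ i, 3 * ε ^ 2 < (1 - 2 * ε ^ 2) * lam i ^ 2) {x v : E3}
    (hv : FutureCausal g (proj x) v) :
    ∃ i, 0 < v i ∧ √(-g.form (proj x) v v) ≤ lam i * v i ∧
      (√(-g.form (proj x) v v) = lam i * v i → x ∈ lineFamily i ∧ ∀ j, j ≠ i → v j = 0) ∧
      ∀ w : Fin 3 → ℝ, (∀ i, 0 ≤ w i) →
        ∀ᶠ h in 𝓝[>] (0 : ℝ), h * (w i * v i) ≤ potential w (x + h • v) - potential w x := by
  by_cases hx : x ∈ Metric.thickening ε (⋃ i, lineFamily i)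
  · rw [Metric.thickening_iUnion, mem_iUnion] at hx
    obtain ⟨i, hi⟩ := hx
    have hvi := hg.coord_pos hε (hlam i) hi hv
    have hle := hg.tube_le hi hv.2.1
    have hge := tubeForm_ge lam i v
    have hlv : 0 ≤ lam i * v i := (mul_pos (hlam i) hvi).le
    refine ⟨i, hvi, Real.sqrt_le_iff.2 ⟨hlv, by linarith⟩, fun heq => ?_, fun w hw => ?_⟩
    · rw [Real.sqrt_eq_iff_mul_self_eq (by linarith [hv.2.1]) hlv] at heq
      refine ⟨by_contra fun hmem => ?_, fun j hj => coord_eq_zero_of_tubeForm_eq (hlam i) ?_ hj⟩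
      · have := (hg.upper_on i x hi).2 hmem v hv.1 hv.2.1
        simp only [LorentzMetric.lift] at this
        nlinarith
      · nlinarith
    · obtain ⟨n, hn⟩ := exists_nearLine_of_mem_thickening hi
      have hn' : NearLine i n (1 / 100) x := fun j hj => (hn j hj).trans hε'
      have htend : Tendsto (fun h : ℝ => x + h • v) (𝓝[>] 0) (𝓝 x) := by
        have : ContinuousAt (fun h : ℝ => x + h • v) 0 := by fun_prop
        simpa using this.tendsto.mono_left (nhdsWithin_le_nhds (s := Ioi 0))
      filter_upwards [htend.eventually hn'.eventually] with h hh
      rw [potential_eq_of_tube hw hh, potential_eq_of_tube hw hn']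
      simp only [PiLp.add_apply, PiLp.smul_apply, smul_eq_mul]
      linarith
  · have hS := hg.sum_coord_pos hε hx hv
    have hfl : flatForm (2 * ε) v ≤ g.form (proj x) v v := hg.upper_off x hx v hv.2.1
    have hthin := abs_sub_third_le_of_flatForm hε hε' (hfl.trans hv.2.1) hS
    have hpos : ∀ j, 0 < v j := fun j => by have := abs_le.1 (hthin j); linarith
    -- The length bound holds strictly for every index here, so the choice is dictated by the
    -- potential: the line nearby if there is one, otherwise any index.
    obtain ⟨i, hi⟩ : ∃ i, (∃ n, NearLine i n (1 / 4) x) ∨ ∀ k n, ¬ NearLine k n (1 / 4) x := by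
      by_cases h : ∃ i n, NearLine i n (1 / 4) x
      · obtain ⟨i, hi⟩ := h; exact ⟨i, Or.inl hi⟩
      · exact ⟨0, Or.inr fun k n hk => h ⟨k, n, hk⟩⟩
    have hlt : √(-g.form (proj x) v v) < lam i * v i := by
      rw [Real.sqrt_lt' (mul_pos (hlam i) (hpos i))]
      have := neg_flatForm_lt_sq (hsmall i) hS i
      linarith
    refine ⟨i, hpos i, hlt.le, fun h => absurd h hlt.ne, fun w hw => ?_⟩
    refine eventually_potential_ge_of_thin hw (S := (v 0 + v 1 + v 2) / 3) (by positivity)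
      (fun j => ?_) i hi
    have := hthin j
    linarith

/-! ### Potentials along future pointing curves -/

/-- The potentials calibrate the metric: the conclusion of the local estimate for Hedlund
metrics. -/
def Calibrated (lam : Fin 3 → ℝ) (g : LorentzMetric) : Prop :=
  ∀ x v : E3, FutureCausal g (proj x) v →
    ∃ i, 0 < v i ∧ √(-g.form (proj x) v v) ≤ lam i * v i ∧
      (√(-g.form (proj x) v v) = lam i * v i → x ∈ lineFamily i ∧ ∀ j, j ≠ i → v j = 0) ∧
      ∀ w : Fin 3 → ℝ, (∀ i, 0 ≤ w i) →
        ∀ᶠ h in 𝓝[>] (0 : ℝ), h * (w i * v i) ≤ potential w (x + h • v) - potential w x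

/-- `V` may fail to be differentiable at `γ t`. Being Lipschitz, it changes only by `o(h)` when `γ
(t + h)` is replaced by the point `γ t + h γ'(t)` of the tangent line. -/
lemma le_deriv_comp_of_eventually {V : E3 → ℝ} (hV : IsLip V) {γ : ℝ → E3} {t c : ℝ}
    (hγ : DifferentiableAt ℝ γ t) (hVγ : DifferentiableAt ℝ (fun s => V (γ s)) t)
    (h : ∀ᶠ h in 𝓝[>] (0 : ℝ), h * c ≤ V (γ t + h • deriv γ t) - V (γ t)) :
    c ≤ deriv (fun s => V (γ s)) t := by
  obtain ⟨K, hK⟩ := hV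
  have hle : 𝓝[>] (0 : ℝ) ≤ 𝓝[≠] 0 := nhdsWithin_mono _ fun x hx => ne_of_gt hx
  have h1 := (hasDerivAt_iff_tendsto_slope_zero.1 hγ.hasDerivAt).mono_left hle
  have h2 := (hasDerivAt_iff_tendsto_slope_zero.1 hVγ.hasDerivAt).mono_left hle
  have h3 : Tendsto (fun h : ℝ => c - K * ‖h⁻¹ • (γ (t + h) - γ t) - deriv γ t‖) (𝓝[>] 0) (𝓝 c) := by
    have := ((h1.sub_const (deriv γ t)).norm.const_mul (K : ℝ)).const_sub c
    simpa using this
  refine le_of_tendsto_of_tendsto h3 h2 ?_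
  filter_upwards [h, self_mem_nhdsWithin] with s hs hpos
  have hpos' : 0 < s := hpos
  have hd := hK.dist_le_mul (γ (t + s)) (γ t + s • deriv γ t)
  have he : γ (t + s) - (γ t + s • deriv γ t) = s • (s⁻¹ • (γ (t + s) - γ t) - deriv γ t) := by
    rw [smul_sub, smul_smul, mul_inv_cancel₀ hpos'.ne', one_smul]; abel
  rw [dist_eq_norm (γ (t + s)), he, norm_smul, Real.norm_eq_abs, abs_of_pos hpos',
    Real.dist_eq] at hd
  have hd' := (abs_le.1 hd).1
  rw [smul_eq_mul, le_inv_mul_iff₀ hpos']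
  nlinarith

lemma Calibrated.deriv_ge (hcal : Calibrated lam g) {γ : ℝ → E3} {t : ℝ}
    (hγ : DifferentiableAt ℝ γ t) (hf : FutureCausal g (proj (γ t)) (deriv γ t)) :
    ∃ i, 0 < deriv γ t i ∧ √(-g.form (proj (γ t)) (deriv γ t) (deriv γ t)) ≤ lam i * deriv γ t i ∧
      (√(-g.form (proj (γ t)) (deriv γ t) (deriv γ t)) = lam i * deriv γ t i →
        γ t ∈ lineFamily i ∧ ∀ j, j ≠ i → deriv γ t j = 0) ∧
      ∀ w : Fin 3 → ℝ, (∀ i, 0 ≤ w i) → DifferentiableAt ℝ (fun s => potential w (γ s)) t →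
        w i * deriv γ t i ≤ deriv (fun s => potential w (γ s)) t := by
  obtain ⟨i, h0, h1, h2, h3⟩ := hcal _ _ hf
  exact ⟨i, h0, h1, h2, fun w hw hd => le_deriv_comp_of_eventually (isLip_potential w) hγ hd (h3 w hw)⟩

lemma IsFuturePointing.absolutelyContinuous_potential {γ : ℝ → E3} {a b : ℝ}
    (h : IsFuturePointing g γ a b) (w : Fin 3 → ℝ) :
    AbsolutelyContinuousOnInterval (fun s => potential w (γ s)) a b := by
  obtain ⟨K, hK⟩ := h.2.1
  obtain ⟨L, hL⟩ := isLip_potential w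
  refine LipschitzOnWith.absolutelyContinuousOnInterval (K := L * K) ?_
  rw [uIcc_of_le h.1.le]
  exact hL.comp_lipschitzOnWith hK

lemma IsFuturePointing.ae_differentiableAt_potential {γ : ℝ → E3} {a b : ℝ}
    (h : IsFuturePointing g γ a b) (w : Fin 3 → ℝ) :
    ∀ᵐ t ∂(volume.restrict (Icc a b)), DifferentiableAt ℝ (fun s => potential w (γ s)) t := by
  rw [ae_restrict_iff' measurableSet_Icc]
  have := (h.absolutelyContinuous_potential w).ae_differentiableAt
  rwa [uIcc_of_le h.1.le] at this

lemma Calibrated.potential_mono (hcal : Calibrated lam g) {w : Fin 3 → ℝ} (hw : ∀ i, 0 ≤ w i)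
    {γ : ℝ → E3} {a b : ℝ} (h : IsFuturePointing g γ a b) :
    potential w (γ a) ≤ potential w (γ b) := by
  rw [← sub_nonneg, ← (h.absolutelyContinuous_potential w).integral_deriv_eq_sub]
  apply intervalIntegral.integral_nonneg_of_ae_restrict h.1.le
  filter_upwards [h.2.2, h.ae_differentiableAt_potential w] with t ht hd
  obtain ⟨i, h0, -, -, h3⟩ := hcal.deriv_ge ht.1 ht.2
  exact (mul_nonneg (hw i) h0.le).trans (h3 w hw hd)

lemma Calibrated.ae_le_deriv (hcal : Calibrated lam g) (hlam : ∀ i, 0 < lam i)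
    {γ : ℝ → E3} {a b : ℝ} (h : IsFuturePointing g γ a b) :
    ∀ᵐ t ∂(volume.restrict (Icc a b)), √(-g.form (proj (γ t)) (deriv γ t) (deriv γ t)) ≤
      deriv (fun s => potential lam (γ s)) t := by
  filter_upwards [h.2.2, h.ae_differentiableAt_potential lam] with t ht hd
  obtain ⟨i, -, h1, -, h3⟩ := hcal.deriv_ge ht.1 ht.2
  exact h1.trans (h3 lam (fun i => (hlam i).le) hd)

lemma lorentzLength_eq {γ : ℝ → E3} {a b : ℝ} (h : IsFuturePointing g γ a b) :
    lorentzLength g γ a b = ∫ t in a..b, √(-g.form (proj (γ t)) (deriv γ t) (deriv γ t)) := by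
  rw [lorentzLength, intervalIntegral.integral_of_le h.1.le, intervalIntegral.integral_of_le h.1.le,
    ← integral_Icc_eq_integral_Ioc, ← integral_Icc_eq_integral_Ioc]
  refine integral_congr_ae ?_
  filter_upwards [h.2.2] with t ht
  rw [LorentzMetric.lift, abs_of_nonpos ht.2.2.1]

lemma Calibrated.lorentzLength_le (hcal : Calibrated lam g) (hlam : ∀ i, 0 < lam i)
    {γ : ℝ → E3} {a b : ℝ} (h : IsFuturePointing g γ a b) :
    lorentzLength g γ a b ≤ potential lam (γ b) - potential lam (γ a) := by
  have hac := h.absolutelyContinuous_potential lam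
  rw [lorentzLength_eq h, ← hac.integral_deriv_eq_sub, intervalIntegral.integral_of_le h.1.le,
    intervalIntegral.integral_of_le h.1.le, ← integral_Icc_eq_integral_Ioc,
    ← integral_Icc_eq_integral_Ioc]
  -- Only the dominating function has to be integrable, and it is the derivative of an absolutely
  -- continuous function.
  refine integral_mono_of_nonneg (Eventually.of_forall fun t => Real.sqrt_nonneg _) ?_
    (hcal.ae_le_deriv hlam h)
  exact (intervalIntegrable_iff_integrableOn_Icc_of_le h.1.le).1 hac.intervalIntegrable_deriv

/-- Curves whose length equals the increment of the potential run along the lines `L_i`. -/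
lemma Calibrated.ae_mem_of_length_eq (hcal : Calibrated lam g) (hlam : ∀ i, 0 < lam i)
    {γ : ℝ → E3} {a b : ℝ} (h : IsFuturePointing g γ a b)
    (hint : IntervalIntegrable (fun t => √(-g.form (proj (γ t)) (deriv γ t) (deriv γ t))) volume a b)
    (heq : ∫ t in a..b, √(-g.form (proj (γ t)) (deriv γ t) (deriv γ t)) =
      potential lam (γ b) - potential lam (γ a)) :
    ∀ᵐ t ∂(volume.restrict (Icc a b)),
      ∃ i, γ t ∈ lineFamily i ∧ 0 < deriv γ t i ∧ ∀ j, j ≠ i → deriv γ t j = 0 := by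
  have hac := h.absolutelyContinuous_potential lam
  have hz : ∫ t in Icc a b, (deriv (fun s => potential lam (γ s)) t -
      √(-g.form (proj (γ t)) (deriv γ t) (deriv γ t))) = 0 := by
    rw [integral_Icc_eq_integral_Ioc, ← intervalIntegral.integral_of_le h.1.le,
      intervalIntegral.integral_sub hac.intervalIntegrable_deriv hint, heq,
      hac.integral_deriv_eq_sub, sub_self]
  rw [integral_eq_zero_iff_of_nonneg_ae] at hz
  · filter_upwards [h.2.2, h.ae_differentiableAt_potential lam, hz] with t ht hd hz
    obtain ⟨i, h0, h1, h2, h3⟩ := hcal.deriv_ge ht.1 ht.2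
    have := h3 lam (fun i => (hlam i).le) hd
    simp only [Pi.zero_apply] at hz
    obtain ⟨h4, h5⟩ := h2 (by linarith)
    exact ⟨i, h4, h0, h5⟩
  · filter_upwards [hcal.ae_le_deriv hlam h] with t ht using sub_nonneg.2 ht
  · exact (intervalIntegrable_iff_integrableOn_Icc_of_le h.1.le).1
      (hac.intervalIntegrable_deriv.sub hint)

lemma Calibrated.exists_lorentzLength_bound (hcal : Calibrated lam g) (hlam : ∀ i, 0 < lam i) :
    ∃ C, 0 ≤ C ∧ ∀ (γ : ℝ → E3) (a b : ℝ), IsFuturePointing g γ a b →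
      lorentzLength g γ a b ≤ ∑ i, lam i * (γ b - γ a) i + C := by
  obtain ⟨C, hC0, hC⟩ := exists_correction_bound lam
  refine ⟨C + C, by positivity, fun γ a b h => (hcal.lorentzLength_le hlam h).trans ?_⟩
  have ha := abs_le.1 (hC (proj (γ a)))
  have hb := abs_le.1 (hC (proj (γ b)))
  simp only [potential, PiLp.sub_apply, mul_sub, Finset.sum_sub_distrib]
  linarith

lemma potential_single (j : Fin 3) (x : E3) :
    potential (Pi.single j 1) x = x j - correction (Pi.single j 1) (proj x) := by
  simp [potential, Pi.single_apply]

lemma single_nonneg (j i : Fin 3) : (0 : ℝ) ≤ (Pi.single j 1 : Fin 3 → ℝ) i := by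
  rw [Pi.single_apply]; split_ifs <;> norm_num

/-- The potential of the `j`-th coordinate form is nondecreasing along future pointing curves and
differs from `x_j` by a bounded function. -/
lemma Calibrated.exists_displacement_bound (hcal : Calibrated lam g) :
    ∃ C, 0 ≤ C ∧ ∀ (γ : ℝ → E3) (a b : ℝ), IsFuturePointing g γ a b →
      ∀ j, -C ≤ (γ b - γ a) j := by
  choose C hC0 hC using fun j : Fin 3 => exists_correction_bound (Pi.single j 1)
  refine ⟨∑ j, (C j + C j), Finset.sum_nonneg fun j _ => add_nonneg (hC0 j) (hC0 j),
    fun γ a b h j => ?_⟩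
  have h1 := hcal.potential_mono (single_nonneg j) h
  rw [potential_single, potential_single] at h1
  have ha := abs_le.1 (hC j (proj (γ a)))
  have hb := abs_le.1 (hC j (proj (γ b)))
  have : C j + C j ≤ ∑ j, (C j + C j) :=
    Finset.single_le_sum (f := fun j => C j + C j) (fun j _ => add_nonneg (hC0 j) (hC0 j))
      (Finset.mem_univ j)
  simp only [PiLp.sub_apply]
  linarith

/-! ### Polygonal future pointing curves -/

/-- There is a future pointing curve from `x` to `y` of Lorentzian length at least `ℓ` and
Euclidean length `R`. -/
def Reach (g : LorentzMetric) (x y : E3) (ℓ R : ℝ) : Prop :=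
  ∃ (γ : ℝ → E3) (a b : ℝ), IsFuturePointing g γ a b ∧ γ a = x ∧ γ b = y ∧
    IntervalIntegrable (fun t => √|g.lift (γ t) (deriv γ t) (deriv γ t)|) volume a b ∧
    IntervalIntegrable (fun t => ‖deriv γ t‖) volume a b ∧
    ℓ ≤ lorentzLength g γ a b ∧ riemLength γ a b = R

lemma LorentzMetric.continuous_lift (g : LorentzMetric) : Continuous g.lift := g.smooth.continuous

lemma hasDerivAt_segment (x w : E3) (b t : ℝ) :
    HasDerivAt (fun t : ℝ => x + (t - b) • w) w t := by
  simpa using (((hasDerivAt_id t).sub_const b).smul_const w).const_add x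

lemma deriv_segment (x w : E3) (b t : ℝ) : deriv (fun t : ℝ => x + (t - b) • w) t = w :=
  (hasDerivAt_segment x w b t).deriv

lemma lipschitzWith_segment (x w : E3) (b : ℝ) :
    LipschitzWith ‖w‖₊ (fun t : ℝ => x + (t - b) • w) := by
  refine LipschitzWith.of_dist_le_mul fun s t => ?_
  have : x + (s - b) • w - (x + (t - b) • w) = (s - t) • w := by
    rw [sub_smul, sub_smul, sub_smul]; abel
  rw [dist_eq_norm, this, norm_smul, mul_comm, Real.dist_eq]; rfl

lemma intervalIntegrable_segment (g : LorentzMetric) (x w : E3) (b c d : ℝ) :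
    IntervalIntegrable (fun t => √|g.lift (x + (t - b) • w) w w|) volume c d := by
  apply Continuous.intervalIntegrable
  have := g.continuous_lift
  fun_prop

lemma le_integral_segment {x w : E3} {b c : ℝ}
    (hc : ∀ s ∈ Icc (0 : ℝ) 1, c ≤ √|g.lift (x + s • w) w w|) :
    c ≤ ∫ t in b..(b + 1), √|g.lift (x + (t - b) • w) w w| := by
  have := intervalIntegral.integral_mono_on (a := b) (b := b + 1) (μ := volume)
    (f := fun _ => c) (by linarith) intervalIntegrable_const
    (intervalIntegrable_segment g x w b b (b + 1))
    (fun t ht => hc (t - b) ⟨by linarith [ht.1], by linarith [ht.2]⟩)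
  simpa using this

lemma Reach.segment {x w : E3} {c : ℝ}
    (hw : ∀ s ∈ Icc (0 : ℝ) 1, FutureCausal g (proj (x + s • w)) w)
    (hc : ∀ s ∈ Icc (0 : ℝ) 1, c ≤ √|g.lift (x + s • w) w w|) : Reach g x (x + w) c ‖w‖ := by
  refine ⟨fun t => x + (t - 0) • w, 0, 0 + 1,
    ⟨by norm_num, ⟨_, (lipschitzWith_segment x w 0).lipschitzOnWith⟩, ?_⟩, by simp, by simp,
    ?_, ?_, ?_, ?_⟩
  · filter_upwards [ae_restrict_mem measurableSet_Icc] with t ht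
    refine ⟨(hasDerivAt_segment x w 0 t).differentiableAt, ?_⟩
    rw [deriv_segment]
    exact hw (t - 0) (by simpa using ht)
  · simp only [deriv_segment]; exact intervalIntegrable_segment g x w 0 _ _
  · simp only [deriv_segment]; exact intervalIntegrable_const
  · simp only [lorentzLength, deriv_segment]; exact le_integral_segment hc
  · simp only [riemLength, deriv_segment]; simp

lemma Reach.mono {x y : E3} {ℓ ℓ' R : ℝ} (h : Reach g x y ℓ R) (hℓ : ℓ' ≤ ℓ) :
    Reach g x y ℓ' R := by
  obtain ⟨γ, a, b, h1, h2, h3, h4, h5, h6, h7⟩ := h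
  exact ⟨γ, a, b, h1, h2, h3, h4, h5, hℓ.trans h6, h7⟩

/-- The segment is traversed in unit time after `b`. The junction is a null set, so the derivative
conditions pass to the concatenation, and the integrability recorded in `Reach` makes both lengths
additive. -/
lemma Reach.append {x y w : E3} {ℓ R c : ℝ} (h : Reach g x y ℓ R)
    (hw : ∀ s ∈ Icc (0 : ℝ) 1, FutureCausal g (proj (y + s • w)) w)
    (hc : ∀ s ∈ Icc (0 : ℝ) 1, c ≤ √|g.lift (y + s • w) w w|) :
    Reach g x (y + w) (ℓ + c) (R + ‖w‖) := by
  obtain ⟨γ, a, b, ⟨hab, ⟨K, hK⟩, hae⟩, rfl, rfl, hi1, hi2, hl, hR⟩ := h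
  set γ' : ℝ → E3 := fun t => if t ≤ b then γ t else γ b + (t - b) • w with hγ'
  have hleft : ∀ t, t < b → γ' =ᶠ[𝓝 t] γ := fun t ht => by
    filter_upwards [Iio_mem_nhds ht] with s hs
    simp [hγ', (show s ≤ b from le_of_lt hs)]
  have hright : ∀ t, b < t → γ' =ᶠ[𝓝 t] fun t => γ b + (t - b) • w := fun t ht => by
    filter_upwards [Ioi_mem_nhds ht] with s hs
    simp [hγ', not_le.2 (show b < s from hs)]
  have hle : ∀ t, t ≤ b → γ' t = γ t := fun t ht => by simp [hγ', ht]
  have hge : ∀ t, b ≤ t → γ' t = γ b + (t - b) • w := fun t ht => by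
    rcases ht.eq_or_lt with rfl | ht
    · simp [hγ']
    · simp [hγ', not_le.2 ht]
  have hne : ∀ᵐ t : ℝ, t ≠ b := by simp [ae_iff]
  have e1 : ∀ᵐ t : ℝ, t ∈ uIoc a b → γ' t = γ t ∧ deriv γ' t = deriv γ t := by
    filter_upwards [hne] with t ht hmem
    rw [uIoc_of_le hab.le] at hmem
    have hlt := lt_of_le_of_ne hmem.2 ht
    exact ⟨(hleft t hlt).eq_of_nhds, (hleft t hlt).deriv_eq⟩
  have e2 : ∀ᵐ t : ℝ, t ∈ uIoc b (b + 1) → γ' t = γ b + (t - b) • w ∧ deriv γ' t = w := by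
    refine Eventually.of_forall fun t hmem => ?_
    rw [uIoc_of_le (by linarith)] at hmem
    exact ⟨(hright t hmem.1).eq_of_nhds, by rw [(hright t hmem.1).deriv_eq, deriv_segment]⟩
  have eL1 : ∀ᵐ t : ℝ, t ∈ uIoc a b → √|g.lift (γ t) (deriv γ t) (deriv γ t)| =
      √|g.lift (γ' t) (deriv γ' t) (deriv γ' t)| := by
    filter_upwards [e1] with t ht hm; rw [(ht hm).1, (ht hm).2]
  have eL2 : ∀ᵐ t : ℝ, t ∈ uIoc b (b + 1) → √|g.lift (γ b + (t - b) • w) w w| =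
      √|g.lift (γ' t) (deriv γ' t) (deriv γ' t)| := by
    filter_upwards [e2] with t ht hm; rw [(ht hm).1, (ht hm).2]
  have eR1 : ∀ᵐ t : ℝ, t ∈ uIoc a b → ‖deriv γ t‖ = ‖deriv γ' t‖ := by
    filter_upwards [e1] with t ht hm; rw [(ht hm).2]
  have eR2 : ∀ᵐ t : ℝ, t ∈ uIoc b (b + 1) → ‖w‖ = ‖deriv γ' t‖ := by
    filter_upwards [e2] with t ht hm; rw [(ht hm).2]
  have iL1 := hi1.congr_ae ((ae_restrict_iff' measurableSet_uIoc).2 eL1)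
  have iL2 := (intervalIntegrable_segment g (γ b) w b b (b + 1)).congr_ae
    ((ae_restrict_iff' measurableSet_uIoc).2 eL2)
  have iR1 := hi2.congr_ae ((ae_restrict_iff' measurableSet_uIoc).2 eR1)
  have iR2 := (intervalIntegrable_const (μ := volume) (a := b) (b := b + 1) (c := ‖w‖)).congr_ae
    ((ae_restrict_iff' measurableSet_uIoc).2 eR2)
  refine ⟨γ', a, b + 1, ⟨by linarith, ⟨max K ‖w‖₊, ?_⟩, ?_⟩, hle a hab.le, ?_, iL1.trans iL2,
    iR1.trans iR2, ?_, ?_⟩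
  · have hwlog : ∀ s ∈ Icc a (b + 1), ∀ t ∈ Icc a (b + 1), s ≤ t →
        dist (γ' s) (γ' t) ≤ (max K ‖w‖₊ : NNReal) * dist s t := by
      intro s hs t ht hst
      have hKle : (K : ℝ) ≤ (max K ‖w‖₊ : NNReal) := NNReal.coe_le_coe.2 (le_max_left _ _)
      have hwle : (‖w‖₊ : ℝ) ≤ (max K ‖w‖₊ : NNReal) := NNReal.coe_le_coe.2 (le_max_right _ _)
      have h1 : ∀ s' t', s' ∈ Icc a b → t' ∈ Icc a b →
          dist (γ s') (γ t') ≤ (max K ‖w‖₊ : NNReal) * dist s' t' := fun s' t' hs' ht' =>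
        (hK.dist_le_mul _ hs' _ ht').trans (mul_le_mul_of_nonneg_right hKle dist_nonneg)
      have h2 : ∀ s' t' : ℝ, dist (γ b + (s' - b) • w) (γ b + (t' - b) • w) ≤
          (max K ‖w‖₊ : NNReal) * dist s' t' := fun s' t' =>
        ((lipschitzWith_segment (γ b) w b).dist_le_mul s' t').trans
          (mul_le_mul_of_nonneg_right hwle dist_nonneg)
      rcases le_total t b with htb | hbt
      · rw [hle s (hst.trans htb), hle t htb]
        exact h1 s t ⟨hs.1, hst.trans htb⟩ ⟨ht.1, htb⟩
      rcases le_total s b with hsb | hbs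
      · rw [hle s hsb, hge t hbt]
        have h3 := h1 s b ⟨hs.1, hsb⟩ ⟨hab.le, le_rfl⟩
        have h4 := h2 b t
        rw [sub_self, zero_smul, add_zero] at h4
        refine (dist_triangle _ (γ b) _).trans ((add_le_add h3 h4).trans ?_)
        rw [← mul_add, Real.dist_eq, Real.dist_eq, Real.dist_eq, abs_of_nonpos (by linarith),
          abs_of_nonpos (by linarith), abs_of_nonpos (by linarith)]
        apply le_of_eq; ring
      · rw [hge s hbs, hge t hbt]; exact h2 s t
    refine LipschitzOnWith.of_dist_le_mul fun s hs t ht => ?_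
    rcases le_total s t with hst | hst
    · exact hwlog s hs t ht hst
    · rw [dist_comm, dist_comm s]; exact hwlog t ht s hs hst
  · rw [ae_restrict_iff' measurableSet_Icc] at hae ⊢
    filter_upwards [hae, hne] with t ht hn hmem
    rcases lt_or_gt_of_ne hn with hlt | hgt
    · obtain ⟨h1, h2⟩ := ht ⟨hmem.1, hlt.le⟩
      refine ⟨h1.congr_of_eventuallyEq (hleft t hlt), ?_⟩
      rw [(hleft t hlt).deriv_eq, hle t hlt.le]; exact h2
    · refine ⟨(hasDerivAt_segment (γ b) w b t).differentiableAt.congr_of_eventuallyEq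
        (hright t hgt), ?_⟩
      rw [(hright t hgt).deriv_eq, hge t hgt.le, deriv_segment]
      exact hw (t - b) ⟨by linarith, by linarith [hmem.2]⟩
  · rw [hge _ (by linarith)]; simp
  · rw [lorentzLength, ← intervalIntegral.integral_add_adjacent_intervals iL1 iL2,
      ← intervalIntegral.integral_congr_ae eL1, ← intervalIntegral.integral_congr_ae eL2]
    exact add_le_add hl (le_integral_segment hc)
  · rw [riemLength, ← intervalIntegral.integral_add_adjacent_intervals iR1 iR2,
      ← intervalIntegral.integral_congr_ae eR1, ← intervalIntegral.integral_congr_ae eR2, ← hR]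
    simp [riemLength]

lemma FutureCausal.smul {p : T3} {v : E3} (h : FutureCausal g p v) {c : ℝ} (hc : 0 < c) :
    FutureCausal g p (c • v) := by
  refine ⟨smul_ne_zero hc.ne' h.1, ?_, ?_⟩ <;>
    simp only [map_smul, smul_apply, smul_eq_mul]
  · exact mul_nonpos_of_nonneg_of_nonpos hc.le (mul_nonpos_of_nonneg_of_nonpos hc.le h.2.1)
  · exact mul_neg_of_pos_of_neg hc h.2.2

lemma mem_thickening_of_mem_lineFamily (hε : 0 < ε) {i : Fin 3} {x : E3} (hx : x ∈ lineFamily i) :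
    x ∈ Metric.thickening ε (lineFamily i) := Metric.self_subset_thickening hε _ hx

lemma IsHedlundMetric.form_eq (hg : IsHedlundMetric lam ε g) (hε : 0 < ε) {i : Fin 3} {x : E3}
    (hx : x ∈ lineFamily i) (v : E3) : g.form (proj x) v v = tubeForm lam i v :=
  (hg.upper_on i x (mem_thickening_of_mem_lineFamily hε hx)).1 hx v

lemma stdE_apply (i j : Fin 3) : stdE i j = if j = i then 1 else 0 := by
  simp [stdE]

lemma tubeForm_stdE (lam : Fin 3 → ℝ) (i : Fin 3) : tubeForm lam i (stdE i) = -lam i ^ 2 := by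
  have : ∑ j ∈ Finset.univ.erase i, 1 / 3 * (stdE i j) ^ 2 = 0 :=
    Finset.sum_eq_zero fun j hj => by simp [stdE_apply, Finset.ne_of_mem_erase hj]
  rw [tubeForm, this, stdE_apply]; simp

lemma IsHedlundMetric.futureCausal_stdE (hg : IsHedlundMetric lam ε g) (hε : 0 < ε) {i : Fin 3}
    (hlam : 0 < lam i) {x : E3} (hx : x ∈ lineFamily i) : FutureCausal g (proj x) (stdE i) := by
  have hp : 0 < lam i ^ 2 := by positivity
  refine ⟨fun h => ?_, ?_, ?_⟩
  · have := stdE_apply i i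
    rw [h] at this; simp at this
  · rw [hg.form_eq hε hx, tubeForm_stdE]; linarith
  -- Condition 3 only gives the quadratic form on `L_i`; the mixed term with `v₁` is obtained by
  -- polarization.
  · have h := form_add_smul g (proj x) (stdE i) vOne 1
    have h3 : (0 : ℝ) < 1 / √3 := by positivity
    rw [hg.form_eq hε hx, hg.form_eq hε hx, hg.form_eq hε hx, tubeForm_stdE] at h
    have e1 : ∑ j ∈ Finset.univ.erase i, 1 / 3 * ((stdE i + (1 : ℝ) • vOne) j) ^ 2 =
        ∑ j ∈ Finset.univ.erase i, 1 / 3 * (vOne j) ^ 2 :=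
      Finset.sum_congr rfl fun j hj => by simp [stdE_apply, Finset.ne_of_mem_erase hj]
    rw [tubeForm, tubeForm, e1] at h
    simp only [PiLp.add_apply, PiLp.smul_apply, stdE_apply, vOne_apply, if_true, smul_eq_mul] at h
    nlinarith [mul_pos hp h3]

lemma add_smul_mem_lineFamily {i : Fin 3} {x : E3} (hx : x ∈ lineFamily i) (s : ℝ) :
    x + s • stdE i ∈ lineFamily i := by
  obtain ⟨t, k, rfl⟩ := hx
  exact ⟨t + s, k, by simp only [line, add_smul]; abel⟩

lemma basePt_add_mem_lineFamily (i : Fin 3) (k : Fin 3 → ℤ) :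
    basePt i + WithLp.toLp 2 (fun j => (k j : ℝ)) ∈ lineFamily i :=
  ⟨0, k, by simp [line]⟩

lemma norm_stdE (i : Fin 3) : ‖stdE i‖ = 1 := by simp [stdE]

lemma Reach.line (hg : IsHedlundMetric lam ε g) (hε : 0 < ε) {i : Fin 3} (hlam : 0 < lam i)
    {x y : E3} {ℓ R m : ℝ} (h : Reach g x y ℓ R) (hy : y ∈ lineFamily i) (hm : 0 < m) :
    Reach g x (y + m • stdE i) (ℓ + lam i * m) (R + m) := by
  have hmem : ∀ s : ℝ, y + s • m • stdE i ∈ lineFamily i := fun s => by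
    rw [smul_smul]; exact add_smul_mem_lineFamily hy _
  have := h.append (w := m • stdE i) (c := lam i * m)
    (fun s _ => (hg.futureCausal_stdE hε hlam (hmem s)).smul hm) (fun s _ => by
      apply le_of_eq
      rw [LorentzMetric.lift]
      simp only [map_smul, smul_apply, smul_eq_mul]
      rw [hg.form_eq hε (hmem s), tubeForm_stdE, show m * (m * -lam i ^ 2) = -(lam i * m) ^ 2 by ring,
        abs_neg, abs_of_nonneg (sq_nonneg _), Real.sqrt_sq (by positivity)])
  rwa [norm_smul, norm_stdE, mul_one, Real.norm_eq_abs, abs_of_pos hm] at this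

lemma Reach.thin (hg : IsHedlundMetric lam ε g) (hε : 0 < ε)
    {x y z : E3} {ℓ R : ℝ} (h : Reach g x y ℓ R)
    (hz : flatForm ε (z - y) ≤ 0 ∧ 0 < (z - y) 0 + (z - y) 1 + (z - y) 2) :
    Reach g x z ℓ (R + ‖z - y‖) := by
  have := h.append (w := z - y) (c := 0)
    (fun s _ => hg.futureCausal_of_flatForm hε _ hz.1 hz.2) (fun s _ => Real.sqrt_nonneg _)
  simpa using this

lemma Reach.thin_segment (hg : IsHedlundMetric lam ε g) (hε : 0 < ε) {x z : E3}
    (hz : flatForm ε (z - x) ≤ 0 ∧ 0 < (z - x) 0 + (z - x) 1 + (z - x) 2) :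
    Reach g x z 0 ‖z - x‖ := by
  have := Reach.segment (g := g) (x := x) (w := z - x) (c := 0)
    (fun s _ => hg.futureCausal_of_flatForm hε _ hz.1 hz.2) (fun s _ => Real.sqrt_nonneg _)
  simpa using this

/-- The coordinate sum is at least `12 / ε`, so the negative term of `g_ε` is at most `-144 / 12 =
-12`, and the part orthogonal to the diagonal contributes at most `3 · 2² = 12`. -/
lemma flatForm_nonpos_of_near_diagonal (hε : 0 < ε) {w : E3} {N : ℝ} (hN : 3 + 4 / ε ≤ N)
    (hw : ∀ j, |w j - N| ≤ 2) : flatForm ε w ≤ 0 ∧ 0 < w 0 + w 1 + w 2 := by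
  have h0 := abs_le.1 (hw 0)
  have h1 := abs_le.1 (hw 1)
  have h2 := abs_le.1 (hw 2)
  have hε4 : 0 < 4 / ε := by positivity
  have hS : 3 * (4 / ε) ≤ w 0 + w 1 + w 2 := by linarith
  refine ⟨?_, by linarith⟩
  rw [flatForm_eq_coords]
  have hS' : 12 ≤ ε * (w 0 + w 1 + w 2) := by
    have := mul_le_mul_of_nonneg_left hS hε.le
    have h12 : ε * (3 * (4 / ε)) = 12 := by field_simp; norm_num
    linarith
  have hsq : 144 ≤ ε ^ 2 * (w 0 + w 1 + w 2) ^ 2 := by nlinarith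
  have hQ : w 0 ^ 2 + w 1 ^ 2 + w 2 ^ 2 - (w 0 + w 1 + w 2) ^ 2 / 3 ≤
      (w 0 - N) ^ 2 + (w 1 - N) ^ 2 + (w 2 - N) ^ 2 := by
    nlinarith [sq_nonneg (w 0 - N + (w 1 - N) + (w 2 - N))]
  have q : ∀ j, (w j - N) ^ 2 ≤ 4 := fun j => by
    have := sq_le_sq' (abs_le.1 (hw j)).1 (abs_le.1 (hw j)).2
    linarith
  nlinarith [q 0, q 1, q 2]

lemma norm_le_of_near_diagonal {w : E3} {N : ℝ} (hN : 0 ≤ N) (hw : ∀ j, |w j - N| ≤ 2) :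
    ‖w‖ ≤ 3 * (N + 2) := by
  have q : ∀ j, w j ^ 2 ≤ (N + 2) ^ 2 := fun j => by
    have := abs_le.1 (hw j)
    apply sq_le_sq' <;> linarith
  apply le_of_sq_le_sq _ (by positivity)
  rw [norm_sq_eq_coords]
  nlinarith [q 0, q 1, q 2]

lemma basePt_mem (i j : Fin 3) : 0 ≤ basePt i j ∧ basePt i j ≤ 1 / 2 := by
  fin_cases i <;> fin_cases j <;> simp [basePt]

/-- Points that are far apart in all three directions are joined by long curves. -/
lemma IsHedlundMetric.exists_reach (hg : IsHedlundMetric lam ε g) (hlam : ∀ i, 0 < lam i)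
    (hε : 0 < ε) :
    ∃ C, 0 ≤ C ∧ ∀ x y : E3, (∀ j, C ≤ (y - x) j) →
      ∃ R, Reach g x y (∑ j, lam j * (y - x) j - C) R ∧ |R - ∑ j, (y - x) j| ≤ C := by
  obtain ⟨N, hN⟩ := exists_nat_ge (3 + 4 / ε)
  have hN0 : (0 : ℝ) ≤ N := by positivity
  have hlamS : 0 ≤ ∑ j, lam j := Finset.sum_nonneg fun j _ => (hlam j).le
  -- Four diagonal connections and rounding shorten each run by at most `4 N + 1`. The terms account
  -- for the Lorentzian length lost, the Euclidean length of the connections, and the Euclidean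
  -- length lost in the three runs.
  refine ⟨(4 * N + 1) * (∑ j, lam j) + 12 * (N + 2) + 3 * (4 * N + 1), by positivity,
    fun x y hxy => ?_⟩
  set h := y - x with hh
  have hh' : ∀ j, (4 * N + 1 : ℝ) ≤ h j := fun j => by
    have := hxy j
    have h1 : 0 ≤ (4 * (N : ℝ) + 1) * (∑ j, lam j) := by positivity
    linarith
  set m : Fin 3 → ℤ := fun j => ⌊h j⌋ - 4 * N with hm
  have hm1 : ∀ j, 0 < (m j : ℝ) := fun j => by
    have : (4 * N + 1 : ℤ) ≤ ⌊h j⌋ := Int.le_floor.2 (by push_cast; exact hh' j)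
    have h2 : (0 : ℤ) < m j := by simp only [hm]; omega
    exact_mod_cast h2
  have hmlo : ∀ j, h j - (4 * N + 1) ≤ m j := fun j => by
    have := (Int.sub_one_lt_floor (h j)).le
    simp only [hm]; push_cast; linarith
  have hmhi : ∀ j, (m j : ℝ) ≤ h j - 4 * N := fun j => by
    have := Int.floor_le (h j)
    simp only [hm]; push_cast; linarith
  set k : Fin 3 → ℤ := fun j => ⌊x j⌋ with hk
  have hklo : ∀ j, x j - 1 ≤ k j := fun j => (Int.sub_one_lt_floor (x j)).le
  have hkhi : ∀ j, (k j : ℝ) ≤ x j := fun j => Int.floor_le (x j)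
  -- Entry points into lines of `L_1`, `L_2`, `L_3`. Each lies about `N (1,1,1)` beyond the start or
  -- the end of the preceding run; the tolerance `2` absorbs the floors and the base points.
  set p₀ : E3 := basePt 0 + WithLp.toLp 2 (fun j => ((k j + N : ℤ) : ℝ)) with hp₀
  set p₁ : E3 := basePt 1 + WithLp.toLp 2
    (fun j => ((k j + 2 * N + (if j = 0 then m 0 else 0) : ℤ) : ℝ)) with hp₁
  set p₂ : E3 := basePt 2 + WithLp.toLp 2
    (fun j => ((k j + 3 * N + (if j = 0 then m 0 else 0) + (if j = 1 then m 1 else 0) : ℤ) : ℝ))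
    with hp₂
  have b := basePt_mem
  have d₀ : ∀ j, |(p₀ - x) j - N| ≤ 2 := fun j => by
    simp only [hp₀, PiLp.sub_apply, PiLp.add_apply]
    push_cast
    rw [abs_le]; constructor <;> linarith [hklo j, hkhi j, (b 0 j).1, (b 0 j).2]
  have d₁ : ∀ j, |(p₁ - (p₀ + (m 0 : ℝ) • stdE 0)) j - N| ≤ 2 := fun j => by
    simp only [hp₀, hp₁, PiLp.sub_apply, PiLp.add_apply, PiLp.smul_apply, stdE_apply, smul_eq_mul]
    push_cast
    rw [abs_le]; split_ifs <;> constructor <;> linarith [(b 0 j).1, (b 0 j).2, (b 1 j).1, (b 1 j).2]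
  have d₂ : ∀ j, |(p₂ - (p₁ + (m 1 : ℝ) • stdE 1)) j - N| ≤ 2 := fun j => by
    simp only [hp₁, hp₂, PiLp.sub_apply, PiLp.add_apply, PiLp.smul_apply, stdE_apply, smul_eq_mul]
    push_cast
    rw [abs_le]; split_ifs <;> constructor <;> linarith [(b 1 j).1, (b 1 j).2, (b 2 j).1, (b 2 j).2]
  have d₃ : ∀ j, |(y - (p₂ + (m 2 : ℝ) • stdE 2)) j - N| ≤ 2 := fun j => by
    have hy : y = x + h := by rw [hh]; abel
    have q : (y - (p₂ + (m 2 : ℝ) • stdE 2)) j = x j + h j - (basePt 2 j + (k j + 3 * N + m j)) := by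
      simp only [hp₂, hy, PiLp.sub_apply, PiLp.add_apply, PiLp.smul_apply, stdE_apply, smul_eq_mul]
      fin_cases j <;> simp; ring
    rw [q, abs_le]
    constructor <;> linarith [hklo j, hkhi j, hmlo j, hmhi j, (b 2 j).1, (b 2 j).2]
  have t := fun {w : E3} (hw : ∀ j, |w j - N| ≤ 2) => flatForm_nonpos_of_near_diagonal hε hN hw
  have n := fun {w : E3} (hw : ∀ j, |w j - N| ≤ 2) => norm_le_of_near_diagonal hN0 hw
  have r := ((((((Reach.thin_segment hg hε (t d₀)).line hg hε (hlam 0)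
    (basePt_add_mem_lineFamily 0 _) (hm1 0)).thin hg hε (t d₁)).line hg hε (hlam 1)
    (basePt_add_mem_lineFamily 1 _) (hm1 1)).thin hg hε (t d₂)).line hg hε (hlam 2)
    (basePt_add_mem_lineFamily 2 _) (hm1 2)).thin hg hε (t d₃)
  have hlm : ∑ j, lam j * h j - (4 * N + 1) * ∑ j, lam j ≤ ∑ j, lam j * m j := by
    rw [Finset.mul_sum, ← Finset.sum_sub_distrib]
    refine Finset.sum_le_sum fun j _ => ?_
    have := mul_le_mul_of_nonneg_left (hmlo j) (hlam j).le
    linarith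
  have hpos : 0 ≤ (4 * (N : ℝ) + 1) * ∑ j, lam j := by positivity
  refine ⟨_, r.mono ?_, ?_⟩
  · rw [Fin.sum_univ_three (fun j => lam j * (m j : ℝ))] at hlm
    linarith
  · rw [Fin.sum_univ_three, abs_le]
    have := n d₀
    have := n d₁
    have := n d₂
    have := n d₃
    constructor
    · linarith [hmlo 0, hmlo 1, hmlo 2, norm_nonneg (p₀ - x),
        norm_nonneg (p₁ - (p₀ + (m 0 : ℝ) • stdE 0)), norm_nonneg (p₂ - (p₁ + (m 1 : ℝ) • stdE 1)),
        norm_nonneg (y - (p₂ + (m 2 : ℝ) • stdE 2))]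
    · linarith [hmhi 0, hmhi 1, hmhi 2]

/-! ### The stable time cone -/

/-- The closed positive octant. -/
def octant : Set E3 := {h | ∀ j, 0 ≤ h j}

lemma stdE_mem_octant (i : Fin 3) : stdE i ∈ octant := fun j => by
  rw [stdE_apply]; split_ifs <;> norm_num

lemma hull_eq_octant : (PointedCone.hull ℝ {stdE 0, stdE 1, stdE 2} : Set E3) = octant := by
  ext h
  rw [SetLike.mem_coe]
  constructor
  · intro hh
    induction hh using Submodule.span_induction with
    | mem x hx =>
      rcases hx with rfl | rfl | rfl <;> exact stdE_mem_octant _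
    | zero => intro j; simp
    | add x y _ _ hx hy => intro j; exact add_nonneg (hx j) (hy j)
    | smul a x _ hx => intro j; exact mul_nonneg a.2 (hx j)
  · intro hh
    have : h = (⟨h 0, hh 0⟩ : {c : ℝ // 0 ≤ c}) • stdE 0 + (⟨h 1, hh 1⟩ : {c : ℝ // 0 ≤ c}) • stdE 1 +
        (⟨h 2, hh 2⟩ : {c : ℝ // 0 ≤ c}) • stdE 2 := by
      change h = h 0 • stdE 0 + h 1 • stdE 1 + h 2 • stdE 2
      ext j
      fin_cases j <;> simp [stdE_apply]
    rw [this]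
    refine add_mem (add_mem ?_ ?_) ?_ <;>
      exact Submodule.smul_mem _ _ (Submodule.subset_span (by simp))

lemma isClosed_octant : IsClosed octant := by
  simp only [octant, ofPred_forall]
  exact isClosed_iInter fun j => isClosed_le continuous_const (by fun_prop)

lemma convex_octant : Convex ℝ octant := by
  rw [← hull_eq_octant]; exact (PointedCone.hull ℝ {stdE 0, stdE 1, stdE 2}).convex

lemma pos_of_mem_interior_octant {h : E3} (hh : h ∈ interior octant) (j : Fin 3) : 0 < h j := by
  by_contra! hle
  have hc : Tendsto (fun s : ℝ => h + s • stdE j) (𝓝[<] 0) (𝓝 h) := by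
    have : ContinuousAt (fun s : ℝ => h + s • stdE j) 0 := by fun_prop
    simpa using this.tendsto.mono_left (nhdsWithin_le_nhds (s := Iio 0))
  obtain ⟨s, hs, hs0⟩ := ((hc.eventually (mem_interior_iff_mem_nhds.1 hh)).and
    self_mem_nhdsWithin).exists
  have := hs j
  simp only [PiLp.add_apply, PiLp.smul_apply, stdE_apply, if_true, smul_eq_mul, mul_one] at this
  have hs0' : s < 0 := hs0
  linarith

lemma mem_interior_octant {h : E3} (hh : ∀ j, 0 < h j) : h ∈ interior octant := by
  refine mem_interior.2 ⟨{h | ∀ j, 0 < h j}, fun x hx j => (hx j).le, ?_, hh⟩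
  simp only [ofPred_forall]
  exact isOpen_iInter_of_finite fun j => isOpen_lt continuous_const (by fun_prop)

/-- Lowering the `j`-th coordinate to zero leads to a frontier point. -/
lemma infDist_frontier_octant_le {h : E3} (hh : h ∈ octant) (j : Fin 3) :
    Metric.infDist h (frontier octant) ≤ h j := by
  have hm : h - h j • stdE j ∈ frontier octant := by
    rw [isClosed_octant.frontier_eq]
    refine ⟨fun k => ?_, fun hi => ?_⟩
    · simp only [PiLp.sub_apply, PiLp.smul_apply, stdE_apply, smul_eq_mul]
      split_ifs with hk
      · simp [hk]
      · simpa using hh k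
    · have := pos_of_mem_interior_octant hi j
      simp [stdE_apply] at this
  refine (Metric.infDist_le_dist_of_mem hm).trans ?_
  rw [dist_eq_norm, sub_sub_cancel, norm_smul, norm_stdE, mul_one, Real.norm_eq_abs,
    abs_of_nonneg (hh j)]

lemma le_infDist_frontier_octant {h : E3} {c : ℝ} (hh : ∀ j, c ≤ h j) :
    c ≤ Metric.infDist h (frontier octant) := by
  have hne : (frontier octant).Nonempty := ⟨0, by
    rw [isClosed_octant.frontier_eq]
    exact ⟨fun j => by simp, fun hi => by simpa using pos_of_mem_interior_octant hi 0⟩⟩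
  rw [Metric.le_infDist hne]
  intro q hq
  rw [isClosed_octant.frontier_eq] at hq
  have : ∃ j, q j ≤ 0 := by
    by_contra! hcon
    exact hq.2 (mem_interior_octant hcon)
  obtain ⟨j, hj⟩ := this
  have h1 := PiLp.norm_apply_le (h - q) j
  rw [dist_eq_norm]
  have h2 := (le_abs_self _).trans h1
  simp only [PiLp.sub_apply] at h2
  linarith [hh j]

lemma sum_coord_nonneg {h : E3} (hh : h ∈ octant) : 0 ≤ ∑ j, h j := Finset.sum_nonneg fun j _ => hh j

lemma abs_coord_le_norm (h : E3) (j : Fin 3) : |h j| ≤ ‖h‖ := PiLp.norm_apply_le h j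

lemma norm_le_sum_coord {h : E3} (hh : h ∈ octant) : ‖h‖ ≤ ∑ j, h j := by
  apply le_of_sq_le_sq _ (sum_coord_nonneg hh)
  rw [norm_sq_eq_coords, Fin.sum_univ_three]
  nlinarith [mul_nonneg (hh 0) (hh 1), mul_nonneg (hh 0) (hh 2), mul_nonneg (hh 1) (hh 2)]

/-- The constant lower bound on displacements disappears after division by lengths tending to
infinity. -/
lemma Calibrated.stableTimeConeOne_subset (hcal : Calibrated lam g) :
    stableTimeConeOne g ⊆ octant := by
  rintro h ⟨γ, a, b, hγ, hR, hcl⟩ j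
  obtain ⟨C, hC0, hC⟩ := hcal.exists_displacement_bound
  have hcl' : MapClusterPt (h j) atTop (fun n =>
      ((riemLength (γ n) (a n) (b n))⁻¹ • (γ n (b n) - γ n (a n))) j) :=
    MapClusterPt.continuousAt_comp (f := fun x : E3 => x j) (by fun_prop) hcl
  by_contra! hneg
  have hz : Tendsto (fun n => (riemLength (γ n) (a n) (b n))⁻¹ * -C) atTop (𝓝 0) := by
    simpa using hR.inv_tendsto_atTop.mul_const (-C)
  have hfr := hcl'.frequently (Iio_mem_nhds (show h j < h j / 2 by linarith))
  have hev := hz.eventually (Ioi_mem_nhds (show h j / 2 < 0 by linarith))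
  obtain ⟨n, h1, h2, h3⟩ := (hfr.and_eventually (hev.and (hR.eventually_gt_atTop 0))).exists
  have h4 := mul_le_mul_of_nonneg_left (hC _ _ _ (hγ n) j) (inv_pos.2 h3).le
  simp only [PiLp.smul_apply, smul_eq_mul] at h1
  have h2' : h j / 2 < (riemLength (γ n) (a n) (b n))⁻¹ * -C := h2
  linarith

/-- The normalization is by the coordinate sum, not the Euclidean norm: the curves run parallel to
the axes, so the displacement `n h` costs Euclidean length `n` up to a constant. -/
lemma IsHedlundMetric.mem_stableTimeConeOne (hg : IsHedlundMetric lam ε g)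
    (hlam : ∀ i, 0 < lam i) (hε : 0 < ε) {h : E3} (hh : h ∈ octant) (hs : ∑ j, h j = 1) :
    h ∈ stableTimeConeOne g := by
  obtain ⟨C, hC0, hC⟩ := hg.exists_reach hlam hε
  -- A fixed diagonal shift makes the curves available even if some coordinate of `h` is zero.
  set c : E3 := C • (stdE 0 + stdE 1 + stdE 2) with hc
  have hcj : ∀ j, c j = C := fun j => by fin_cases j <;> simp [hc, stdE_apply]
  have key : ∀ n : ℕ, ∃ (γ : ℝ → E3) (a b : ℝ), IsFuturePointing g γ a b ∧
      γ b - γ a = (n : ℝ) • h + c ∧ |riemLength γ a b - n| ≤ 4 * C := by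
    intro n
    obtain ⟨R, ⟨γ, a, b, h1, h2, h3, -, -, -, h7⟩, hR⟩ := hC 0 ((n : ℝ) • h + c) fun j => by
      simp only [sub_zero, PiLp.add_apply, PiLp.smul_apply, smul_eq_mul, hcj]
      have := mul_nonneg (Nat.cast_nonneg (α := ℝ) n) (hh j)
      linarith
    refine ⟨γ, a, b, h1, by rw [h2, h3, sub_zero], ?_⟩
    have : ∑ j, ((n : ℝ) • h + c - 0) j = n + 3 * C := by
      simp only [sub_zero, PiLp.add_apply, PiLp.smul_apply, smul_eq_mul, hcj,
        Finset.sum_add_distrib, ← Finset.mul_sum, hs]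
      simp
    rw [this] at hR
    rw [h7]
    obtain ⟨h8, h9⟩ := abs_le.1 hR
    rw [abs_le]; constructor <;> linarith
  choose γ a b h1 h2 h3 using key
  have hlim : Tendsto (fun n : ℕ => riemLength (γ n) (a n) (b n)) atTop atTop := by
    refine tendsto_atTop_mono (fun n => ?_) (tendsto_atTop_add_const_right _ (-(4 * C))
      tendsto_natCast_atTop_atTop)
    have := (abs_le.1 (h3 n)).1
    linarith
  refine ⟨γ, a, b, h1, hlim, Tendsto.mapClusterPt ?_⟩
  have hinv : Tendsto (fun n : ℕ => (riemLength (γ n) (a n) (b n))⁻¹) atTop (𝓝 0) :=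
    hlim.inv_tendsto_atTop
  have hone : Tendsto (fun n : ℕ => (riemLength (γ n) (a n) (b n))⁻¹ * n) atTop (𝓝 1) := by
    rw [tendsto_iff_dist_tendsto_zero]
    have hb : Tendsto (fun n : ℕ => (riemLength (γ n) (a n) (b n))⁻¹ * (4 * C)) atTop (𝓝 0) := by
      simpa using hinv.mul_const (4 * C)
    refine squeeze_zero' (Eventually.of_forall fun _ => dist_nonneg) ?_ hb
    filter_upwards [hlim.eventually_gt_atTop 0] with n hn
    have : (riemLength (γ n) (a n) (b n))⁻¹ * n - 1 =
        (riemLength (γ n) (a n) (b n))⁻¹ * (n - riemLength (γ n) (a n) (b n)) := by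
      field_simp
    rw [Real.dist_eq, this, abs_mul, abs_of_pos (inv_pos.2 hn), abs_sub_comm]
    exact mul_le_mul_of_nonneg_left (h3 n) (inv_pos.2 hn).le
  have : Tendsto (fun n : ℕ => ((riemLength (γ n) (a n) (b n))⁻¹ * n) • h +
      (riemLength (γ n) (a n) (b n))⁻¹ • c) atTop (𝓝 h) := by
    simpa using (hone.smul_const h).add (hinv.smul_const c)
  refine this.congr fun n => ?_
  rw [h2, smul_add, ← smul_smul]

lemma IsHedlundMetric.stableTimeCone_eq (hg : IsHedlundMetric lam ε g) (hcal : Calibrated lam g)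
    (hlam : ∀ i, 0 < lam i) (hε : 0 < ε) : stableTimeCone g = octant := by
  ext h
  constructor
  · rintro ⟨c, hc, k, hk, rfl⟩ j
    exact mul_nonneg hc (hcal.stableTimeConeOne_subset hk j)
  · intro hh
    rcases (sum_coord_nonneg hh).eq_or_lt with h0 | hpos
    · refine ⟨0, le_rfl, stdE 0, hg.mem_stableTimeConeOne hlam hε (stdE_mem_octant 0) ?_, ?_⟩
      · simp [stdE_apply]
      · have := norm_le_sum_coord hh
        rw [← h0] at this
        simpa using this
    · refine ⟨∑ j, h j, hpos.le, (∑ j, h j)⁻¹ • h, hg.mem_stableTimeConeOne hlam hε ?_ ?_, ?_⟩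
      · exact fun j => mul_nonneg (inv_pos.2 hpos).le (hh j)
      · simp only [PiLp.smul_apply, smul_eq_mul, ← Finset.mul_sum]
        exact inv_mul_cancel₀ hpos.ne'
      · rw [smul_smul, mul_inv_cancel₀ hpos.ne', one_smul]

/-! ### The stable time separation -/

lemma Reach.le_timeSep {x y : E3} {ℓ R : ℝ} (h : Reach g x y ℓ R) :
    ENNReal.ofReal ℓ ≤ timeSep g x y := by
  obtain ⟨γ, a, b, h1, h2, h3, -, -, h6, -⟩ := h
  refine (ENNReal.ofReal_le_ofReal h6).trans ?_
  exact le_iSup_of_le γ (le_iSup_of_le a (le_iSup_of_le b (le_iSup_of_le ⟨h1, h2, h3⟩ le_rfl)))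

lemma Calibrated.exists_timeSep_le (hcal : Calibrated lam g) (hlam : ∀ i, 0 < lam i) :
    ∃ C, 0 ≤ C ∧ ∀ x y : E3, timeSep g x y ≤ ENNReal.ofReal (∑ i, lam i * (y - x) i + C) := by
  obtain ⟨C, hC0, hC⟩ := hcal.exists_lorentzLength_bound hlam
  refine ⟨C, hC0, fun x y => ?_⟩
  refine iSup_le fun γ => iSup_le fun a => iSup_le fun b => iSup_le fun h => ?_
  obtain ⟨h, rfl, rfl⟩ := h
  exact ENNReal.ofReal_le_ofReal (hC γ a b h)

lemma linear_nonneg (hlam : ∀ i, 0 < lam i) {h : E3} (hh : h ∈ octant) :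
    0 ≤ ∑ i, lam i * h i := Finset.sum_nonneg fun j _ => mul_nonneg (hlam j).le (hh j)

/-- The potential bounds the time separation above, the polygonal curves below. If the latter are
unavailable, some coordinate is below `C₂`; then `y - x` is within `C₂` of the frontier, so its norm
is at most `C₂ / δ` and the linear form is bounded. -/
lemma IsHedlundMetric.timeSep_close (hg : IsHedlundMetric lam ε g) (hcal : Calibrated lam g)
    (hlam : ∀ i, 0 < lam i) (hε : 0 < ε) {δ : ℝ} (hδ : 0 < δ) :
    ∃ C : ℝ, ∀ x y : E3, y - x ∈ innerCone octant δ →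
      timeSep g x y ≠ ⊤ ∧ |∑ i, lam i * (y - x) i - (timeSep g x y).toReal| ≤ C := by
  obtain ⟨C₁, hC₁0, hC₁⟩ := hcal.exists_timeSep_le hlam
  obtain ⟨C₂, hC₂0, hC₂⟩ := hg.exists_reach hlam hε
  have hL : 0 ≤ ∑ i, lam i := Finset.sum_nonneg fun j _ => (hlam j).le
  refine ⟨C₁ + C₂ + (∑ i, lam i) * (C₂ / δ), fun x y hxy => ?_⟩
  have htop : timeSep g x y ≠ ⊤ := ne_top_of_le_ne_top ENNReal.ofReal_ne_top (hC₁ x y)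
  refine ⟨htop, ?_⟩
  obtain ⟨hoct, hin⟩ := hxy
  have hpos : 0 ≤ (∑ i, lam i) * (C₂ / δ) := by positivity
  have hlin := linear_nonneg hlam hoct
  have hup : (timeSep g x y).toReal ≤ ∑ i, lam i * (y - x) i + C₁ := by
    have := ENNReal.toReal_mono ENNReal.ofReal_ne_top (hC₁ x y)
    rwa [ENNReal.toReal_ofReal (by linarith)] at this
  rw [abs_le]
  refine ⟨by linarith, ?_⟩
  by_cases hbig : ∀ j, C₂ ≤ (y - x) j
  · obtain ⟨R, hR, -⟩ := hC₂ x y hbig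
    have h1 := (ENNReal.ofReal_le_iff_le_toReal htop).1 hR.le_timeSep
    linarith
  · push Not at hbig
    obtain ⟨j, hj⟩ := hbig
    have hn : ‖y - x‖ ≤ C₂ / δ := by
      rw [le_div_iff₀ hδ, mul_comm]
      exact (hin.trans (infDist_frontier_octant_le hoct j)).trans hj.le
    have h2 : ∑ i, lam i * (y - x) i ≤ (∑ i, lam i) * (C₂ / δ) := by
      rw [Finset.sum_mul]
      exact Finset.sum_le_sum fun i _ => mul_le_mul_of_nonneg_left
        (((le_abs_self _).trans (abs_coord_le_norm _ i)).trans hn) (hlam i).le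
    have : 0 ≤ (timeSep g x y).toReal := ENNReal.toReal_nonneg
    linarith

lemma continuous_linear (lam : Fin 3 → ℝ) : Continuous fun h : E3 => ∑ i, lam i * h i := by
  fun_prop

lemma IsHedlundMetric.isStableTimeSeparation_of_eq (hg : IsHedlundMetric lam ε g)
    (hcal : Calibrated lam g) (hlam : ∀ i, 0 < lam i) (hε : 0 < ε) {l : E3 → ℝ}
    (hl : ∀ h ∈ octant, l h = ∑ i, lam i * h i) : IsStableTimeSeparation g l := by
  have hT := hg.stableTimeCone_eq hcal hlam hε
  constructor
  · rw [hT]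
    refine ⟨convex_octant, fun x hx y hy a b ha hb hab => ?_⟩
    rw [hl x hx, hl y hy, hl _ (convex_octant hx hy ha hb hab)]
    simp only [Fin.sum_univ_three, PiLp.add_apply, PiLp.smul_apply, smul_eq_mul]
    apply le_of_eq; ring
  · intro δ hδ
    rw [hT]
    obtain ⟨C, hC⟩ := hg.timeSep_close hcal hlam hε hδ
    refine ⟨C, fun x y hxy => ?_⟩
    rw [hl _ hxy.1]
    exact hC x y hxy
  · intro c hc h hh
    rw [hT] at hh
    rw [hl h hh, hl (c • h) (fun j => mul_nonneg hc (hh j)), Finset.mul_sum]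
    exact Finset.sum_congr rfl fun j _ => by simp; ring
  · intro h hh h' hh'
    rw [hT] at hh hh'
    rw [hl h hh, hl h' hh', hl (h' + h) (fun j => add_nonneg (hh' j) (hh j)),
      ← Finset.sum_add_distrib]
    exact (Finset.sum_congr rfl fun j _ => by simp; ring).le
  · intro h _ hh
    rw [hT] at hh ⊢
    have hne : (𝓝[octant] h).NeBot := mem_closure_iff_nhdsWithin_neBot.1 (subset_closure hh)
    have ht : Tendsto (fun h' => (l h' : EReal)) (𝓝[octant] h) (𝓝 (l h : EReal)) := by
      refine (continuous_coe_real_ereal.tendsto _).comp ?_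
      rw [hl h hh]
      refine (((continuous_linear lam).tendsto h).mono_left nhdsWithin_le_nhds).congr' ?_
      filter_upwards [self_mem_nhdsWithin] with k hk using (hl k hk).symm
    exact ht.limsup_eq.symm

/-- In the interior, two homogeneous functions at bounded distance along a ray agree. At a boundary
point `h`, with `k = (1,1,1)`, superadditivity for `h + k` gives the upper bound, and the limsup
along `h + s k` gives the lower one. -/
lemma IsHedlundMetric.eq_of_isStableTimeSeparation (hg : IsHedlundMetric lam ε g)
    (hcal : Calibrated lam g) (hlam : ∀ i, 0 < lam i) (hε : 0 < ε) {l : E3 → ℝ}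
    (hl : IsStableTimeSeparation g l) : ∀ h ∈ octant, l h = ∑ i, lam i * h i := by
  have hT := hg.stableTimeCone_eq hcal hlam hε
  have hint : ∀ h : E3, (∀ j, 0 < h j) → l h = ∑ i, lam i * h i := by
    intro h hpos
    have hoct : h ∈ octant := fun j => (hpos j).le
    obtain ⟨c, hc0, hc⟩ : ∃ c > 0, ∀ j, c ≤ h j :=
      ⟨min (h 0) (min (h 1) (h 2)), lt_min (hpos 0) (lt_min (hpos 1) (hpos 2)), fun j => by
        fin_cases j <;> simp⟩
    have hn : 0 < ‖h‖ := lt_of_lt_of_le hc0 ((hc 0).trans ((le_abs_self _).trans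
      (abs_coord_le_norm h 0)))
    -- With this aperture the whole ray through `h` lies in the inner cone.
    obtain ⟨C₁, hC₁⟩ := hl.close (c / ‖h‖) (by positivity)
    obtain ⟨C₂, hC₂⟩ := hg.timeSep_close hcal hlam hε (δ := c / ‖h‖) (by positivity)
    rw [hT] at hC₁
    have key : ∀ n : ℕ, n * |l h - ∑ i, lam i * h i| ≤ C₁ + C₂ := by
      intro n
      have hn0 : (0 : ℝ) ≤ n := Nat.cast_nonneg n
      have hmem : (n : ℝ) • h - 0 ∈ innerCone octant (c / ‖h‖) := by
        rw [sub_zero]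
        refine ⟨fun j => mul_nonneg hn0 (hoct j), ?_⟩
        rw [norm_smul, Real.norm_eq_abs, abs_of_nonneg hn0]
        refine le_trans (le_of_eq ?_) (le_infDist_frontier_octant (c := n * c) fun j =>
          mul_le_mul_of_nonneg_left (hc j) hn0)
        field_simp
      have h1 := (hC₁ 0 ((n : ℝ) • h) hmem).2
      have h2 := (hC₂ 0 ((n : ℝ) • h) hmem).2
      have h3 : ∑ i, lam i * ((n : ℝ) • h) i = n * ∑ i, lam i * h i := by
        rw [Finset.mul_sum]; exact Finset.sum_congr rfl fun j _ => by simp; ring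
      rw [sub_zero] at h1 h2
      rw [hl.homogeneous n hn0 h (by rw [hT]; exact hoct)] at h1
      rw [h3] at h2
      rw [← abs_of_nonneg hn0, ← abs_mul, mul_sub]
      rw [abs_le] at h1 h2 ⊢
      constructor <;> linarith [h1.1, h1.2, h2.1, h2.2]
    by_contra hne
    have hpos' : 0 < |l h - ∑ i, lam i * h i| := abs_pos.2 (sub_ne_zero.2 hne)
    obtain ⟨n, hn⟩ := exists_nat_gt ((C₁ + C₂) / |l h - ∑ i, lam i * h i|)
    rw [div_lt_iff₀ hpos'] at hn
    exact absurd (key n) (not_le.2 hn)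
  intro h hh
  by_cases hfr : ∀ j, 0 < h j
  · exact hint h hfr
  set k : E3 := stdE 0 + stdE 1 + stdE 2 with hk
  have hkj : ∀ j, k j = 1 := fun j => by fin_cases j <;> simp [hk, stdE_apply]
  have hkoct : k ∈ octant := fun j => by rw [hkj]; norm_num
  have hks : ∀ s : ℝ, 0 < s → ∀ j, 0 < (h + s • k) j := fun s hs j => by
    simp only [PiLp.add_apply, PiLp.smul_apply, smul_eq_mul, hkj]
    have := hh j; linarith
  apply le_antisymm
  · have h1 := hl.superadditive k (by rw [hT]; exact hkoct) h (by rw [hT]; exact hh)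
    have h2 := hint (h + (1 : ℝ) • k) (hks 1 one_pos)
    rw [one_smul] at h2
    rw [h2, hint k fun j => by rw [hkj]; norm_num] at h1
    simp only [PiLp.add_apply, mul_add, Finset.sum_add_distrib] at h1
    linarith
  · have hmemfr : h ∈ frontier octant := by
      rw [isClosed_octant.frontier_eq]
      exact ⟨hh, fun hi => hfr (pos_of_mem_interior_octant hi)⟩
    have h1 := hl.boundary h (by rw [hT]; exact hmemfr) (by rw [hT]; exact hh)
    rw [hT] at h1
    have hc : Tendsto (fun s : ℝ => h + s • k) (𝓝[>] 0) (𝓝 h) := by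
      have : ContinuousAt (fun s : ℝ => h + s • k) 0 := by fun_prop
      simpa using this.tendsto.mono_left (nhdsWithin_le_nhds (s := Ioi 0))
    have hc' : Tendsto (fun s : ℝ => h + s • k) (𝓝[>] 0) (𝓝[octant] h) := by
      refine tendsto_nhdsWithin_iff.2 ⟨hc, ?_⟩
      filter_upwards [self_mem_nhdsWithin] with s hs j using (hks s hs j).le
    have hlim : Tendsto (fun s : ℝ => (l (h + s • k) : EReal)) (𝓝[>] 0)
        (𝓝 ((∑ i, lam i * h i : ℝ) : EReal)) := by
      refine (continuous_coe_real_ereal.tendsto _).comp ?_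
      refine (((continuous_linear lam).tendsto h).comp hc).congr' ?_
      filter_upwards [self_mem_nhdsWithin] with s hs using (hint _ (hks s hs)).symm
    have h2 : limsup (fun s : ℝ => (l (h + s • k) : EReal)) (𝓝[>] 0) ≤
        limsup (fun h' => (l h' : EReal)) (𝓝[octant] h) := by
      have : limsup (fun s : ℝ => (l (h + s • k) : EReal)) (𝓝[>] 0) =
        limsup (fun h' => (l h' : EReal)) (map (fun s : ℝ => h + s • k) (𝓝[>] 0)) := rfl
      rw [this]
      exact limsup_le_limsup_of_le hc'
    rw [hlim.limsup_eq, ← h1] at h2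
    exact_mod_cast h2

/-! ### The lines `l_i` are geodesics -/

lemma hasDerivAt_line (i : Fin 3) (t : ℝ) : HasDerivAt (line i) (stdE i) t := by
  have : HasDerivAt (fun t : ℝ => basePt i + t • stdE i) ((1 : ℝ) • stdE i) t :=
    ((hasDerivAt_id t).smul_const (stdE i)).const_add (basePt i)
  rwa [one_smul] at this

lemma deriv_line (i : Fin 3) : deriv (line i) = fun _ => stdE i :=
  funext fun t => (hasDerivAt_line i t).deriv

lemma line_mem_lineFamily (i : Fin 3) (t : ℝ) : line i t ∈ lineFamily i :=
  ⟨t, 0, by ext j; simp⟩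

lemma LorentzMetric.differentiable_lift (g : LorentzMetric) : Differentiable ℝ g.lift :=
  g.smooth.differentiable (by simp)

/-- Polarization of the prescribed quadratic form `g_i`, which does not depend on the point of
`L_i`. -/
lemma IsHedlundMetric.lift_eq_of_mem (hg : IsHedlundMetric lam ε g) (hε : 0 < ε) {i : Fin 3}
    {x y : E3} (hx : x ∈ lineFamily i) (hy : y ∈ lineFamily i) : g.lift x = g.lift y := by
  ext a b
  have h1 := form_add_smul g (proj x) a b 1
  have h2 := form_add_smul g (proj y) a b 1
  simp only [hg.form_eq hε hx] at h1
  simp only [hg.form_eq hε hy] at h2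
  simp only [LorentzMetric.lift]
  linarith

lemma IsHedlundMetric.fderiv_lift_stdE (hg : IsHedlundMetric lam ε g) (hε : 0 < ε) (i : Fin 3)
    (t : ℝ) : fderiv ℝ g.lift (line i t) (stdE i) = 0 := by
  have h1 := HasFDerivAt.comp_hasDerivAt (E := E3 →L[ℝ] E3 →L[ℝ] ℝ) (F := E3) t
    (g.differentiable_lift (line i t)).hasFDerivAt (hasDerivAt_line i t)
  have h2 : g.lift ∘ line i = fun _ => g.lift (line i t) := funext fun s =>
    hg.lift_eq_of_mem hε (line_mem_lineFamily i s) (line_mem_lineFamily i t)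
  rw [h2] at h1
  exact h1.unique (hasDerivAt_const (F := E3 →L[ℝ] E3 →L[ℝ] ℝ) t (g.lift (line i t)))

lemma IsHedlundMetric.neg_sq_le_lift_stdE (hg : IsHedlundMetric lam ε g) {i : Fin 3} {x : E3}
    (hx : x ∈ Metric.thickening ε (lineFamily i)) :
    -lam i ^ 2 ≤ g.lift x (stdE i) (stdE i) := by
  by_cases h : g.lift x (stdE i) (stdE i) ≤ 0
  · have := hg.tube_le hx h
    rwa [tubeForm_stdE] at this
  · nlinarith [sq_nonneg (lam i)]

/-- In the open tube `ḡ(e_i, e_i) ≥ -λ_i²`, with equality on `L_i`, so the line consists of local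
minima. -/
lemma IsHedlundMetric.fderiv_lift_apply_stdE (hg : IsHedlundMetric lam ε g) (hε : 0 < ε)
    (i : Fin 3) (t : ℝ) (w : E3) : fderiv ℝ g.lift (line i t) w (stdE i) (stdE i) = 0 := by
  set x := line i t with hx
  have hxm := line_mem_lineFamily i t
  have hs : HasDerivAt (fun s : ℝ => x + s • w) w 0 := by
    simpa using ((hasDerivAt_id (0 : ℝ)).smul_const w).const_add x
  have h1 : HasDerivAt (fun s : ℝ => g.lift (x + s • w)) (fderiv ℝ g.lift x w) 0 := by
    have h0 : HasFDerivAt g.lift (fderiv ℝ g.lift x) (x + (0 : ℝ) • w) := by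
      simpa using (g.differentiable_lift x).hasFDerivAt
    exact HasFDerivAt.comp_hasDerivAt (E := E3 →L[ℝ] E3 →L[ℝ] ℝ) (F := E3) (0 : ℝ) h0 hs
  have h2 : HasDerivAt (fun s : ℝ => g.lift (x + s • w) (stdE i) (stdE i))
      (fderiv ℝ g.lift x w (stdE i) (stdE i)) 0 := by
    simpa using (h1.clm_apply (hasDerivAt_const 0 (stdE i))).clm_apply (hasDerivAt_const 0 (stdE i))
  refine IsLocalMin.hasDerivAt_eq_zero ?_ h2
  have hev : ∀ᶠ s in 𝓝 (0 : ℝ), x + s • w ∈ Metric.thickening ε (lineFamily i) := by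
    have hc : ContinuousAt (fun s : ℝ => x + s • w) 0 := hs.continuousAt
    refine hc.eventually (Metric.isOpen_thickening.mem_nhds ?_)
    simpa using mem_thickening_of_mem_lineFamily hε hxm
  filter_upwards [hev] with s hs
  have h3 : g.lift x (stdE i) (stdE i) = -lam i ^ 2 := by
    rw [LorentzMetric.lift, hg.form_eq hε hxm, tubeForm_stdE]
  simpa [h3] using hg.neg_sq_le_lift_stdE hs

lemma IsHedlundMetric.covAccel_line (hg : IsHedlundMetric lam ε g) (hε : 0 < ε) (i : Fin 3) (t : ℝ)
    (w : E3) : covAccel g (line i t) (stdE i) 0 w = 0 := by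
  rw [covAccel, hg.fderiv_lift_stdE hε, hg.fderiv_lift_apply_stdE hε]
  simp

lemma IsHedlundMetric.isGeodesic_line (hg : IsHedlundMetric lam ε g) (hε : 0 < ε) (i : Fin 3) :
    IsGeodesic g (line i) := by
  constructor
  · unfold line; fun_prop
  · intro t w
    rw [deriv_line, deriv_const]
    exact hg.covAccel_line hε i t w

lemma proj_add_int (x : E3) (k : Fin 3 → ℤ) :
    proj (x + WithLp.toLp 2 fun j => (k j : ℝ)) = proj x := by
  ext j; simp [proj]

lemma exists_int_of_proj_eq {x y : E3} (h : proj x = proj y) :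
    ∃ k : Fin 3 → ℤ, x = y + WithLp.toLp 2 fun j => (k j : ℝ) := by
  have : ∀ j, ∃ n : ℤ, x j - y j = n := fun j => by
    have hj := congrFun h j
    simp only [proj] at hj
    rw [← sub_eq_zero, ← AddCircle.coe_sub, AddCircle.coe_eq_zero_iff] at hj
    obtain ⟨n, hn⟩ := hj
    exact ⟨n, by simpa using hn.symm⟩
  choose k hk using this
  refine ⟨k, ?_⟩
  ext j
  simp [← hk j]

lemma line_add (i : Fin 3) (s t : ℝ) : line i (s + t) = line i s + t • stdE i := by
  simp only [line, add_smul]; abel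

lemma periodic_tangentLine (i : Fin 3) : Function.Periodic (tangentLine i) 1 := fun t => by
  have h : line i (t + 1) = line i t + WithLp.toLp 2 fun j => (((if j = i then 1 else 0 : ℤ)) : ℝ) := by
    rw [line_add, one_smul]; congr 1
    ext j; simp [stdE_apply]
  simp only [tangentLine]
  rw [h, proj_add_int]

/-! ### Global flows of bounded Lipschitz vector fields -/

section ODE

variable {E : Type*} [NormedAddCommGroup E] [NormedSpace ℝ E]

/-- Since `‖f‖ ≤ L`, Picard–Lindelöf applies on `[-(n+1), n+1]` in the ball of radius `L (n+1)`, for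
every `n`; uniqueness glues the solutions. -/
lemma exists_global_solution [CompleteSpace E] {f : E → E} {K L : NNReal} (hf : LipschitzWith K f)
    (hL : ∀ x, ‖f x‖ ≤ L) (x : E) :
    ∃ α : ℝ → E, α 0 = x ∧ ∀ t, HasDerivAt α (f (α t)) t := by
  have hloc : ∀ n : ℕ, ∃ α : ℝ → E, α 0 = x ∧
      ∀ t ∈ Ioo (-(n + 1 : ℝ)) (n + 1), HasDerivAt α (f (α t)) t := by
    intro n
    have hn : (0 : ℝ) ≤ n := Nat.cast_nonneg n
    have hpl : IsPicardLindelof (fun _ => f) (tmin := -(n + 1 : ℝ)) (tmax := n + 1)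
        ⟨0, by constructor <;> linarith⟩ x (L * (n + 1)) 0 L K :=
      { lipschitzOnWith := fun _ _ => hf.lipschitzOnWith
        continuousOn := fun _ _ => continuousOn_const
        norm_le := fun _ _ y _ => hL y
        mul_max_le := by simp }
    obtain ⟨α, h0, hα⟩ := hpl.exists_eq_forall_mem_Icc_hasDerivWithinAt₀
    exact ⟨α, h0, fun t ht =>
      (hα t (Ioo_subset_Icc_self ht)).hasDerivAt (Icc_mem_nhds ht.1 ht.2)⟩
  choose α h0 hα using hloc
  have heq : ∀ n m : ℕ, n ≤ m → ∀ t ∈ Ioo (-(n + 1 : ℝ)) (n + 1), α n t = α m t := by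
    intro n m hnm
    have hnm' : (n : ℝ) ≤ m := Nat.cast_le.2 hnm
    have hn : (0 : ℝ) ≤ n := Nat.cast_nonneg n
    refine ODE_solution_unique_of_mem_Ioo (v := fun _ => f) (s := fun _ => univ) (K := K)
      (t₀ := 0) (fun _ _ => hf.lipschitzOnWith) ⟨by linarith, by linarith⟩
      (fun t ht => ⟨hα n t ht, trivial⟩) (fun t ht => ⟨hα m t ⟨?_, ?_⟩, trivial⟩) (by rw [h0, h0])
    · linarith [ht.1]
    · linarith [ht.2]
  -- The half-length `n + 1` rather than `n` keeps `t` strictly inside the interval of index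
  -- `⌈|t|⌉₊`.
  refine ⟨fun t => α ⌈|t|⌉₊ t, by simp [h0], fun t => ?_⟩
  have hmem : ∀ s : ℝ, s ∈ Ioo (-((⌈|s|⌉₊ : ℝ) + 1)) (⌈|s|⌉₊ + 1) := fun s => by
    have h1 := Nat.le_ceil |s|
    have h2 := neg_abs_le s
    have h3 := le_abs_self s
    constructor <;> linarith
  set N := ⌈|t|⌉₊ + 1 with hN
  have hev : (fun s => α ⌈|s|⌉₊ s) =ᶠ[𝓝 t] α N := by
    filter_upwards [Ioo_mem_nhds (show t - 1 < t by linarith) (show t < t + 1 by linarith)] with s hs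
    refine heq _ _ ?_ s (hmem s)
    rw [hN, Nat.ceil_le]
    push_cast
    have h1 := Nat.le_ceil |t|
    have h2 : |s| ≤ |t| + 1 := by
      have := abs_sub_abs_le_abs_sub s t
      have h3 : |s - t| ≤ 1 := abs_le.2 ⟨by linarith [hs.1], by linarith [hs.2]⟩
      linarith
    linarith
  change HasDerivAt _ (f (α ⌈|t|⌉₊ t)) t
  rw [heq _ _ (Nat.le_succ _) t (hmem t)]
  refine (hα N t ?_).congr_of_eventuallyEq hev
  have := hmem t
  rw [hN]; push_cast
  exact ⟨by linarith [this.1], by linarith [this.2]⟩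

/-- Grönwall's inequality for nonnegative times; negative times follow by reversing the field. -/
lemma continuous_of_solutions {f : E → E} {K : NNReal} (hf : LipschitzWith K f) {φ : E → ℝ → E}
    (h0 : ∀ x, φ x 0 = x) (hφ : ∀ x t, HasDerivAt (φ x) (f (φ x t)) t) (t : ℝ) :
    Continuous fun x => φ x t := by
  have key : ∀ (f : E → E) (φ : E → ℝ → E), LipschitzWith K f → (∀ x, φ x 0 = x) →
      (∀ x t, HasDerivAt (φ x) (f (φ x t)) t) → ∀ t, 0 ≤ t → Continuous fun x => φ x t := by
    intro f φ hf h0 hφ t ht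
    refine LipschitzWith.continuous (K := Real.toNNReal (Real.exp (K * t)))
      (LipschitzWith.of_dist_le_mul fun x y => ?_)
    have := dist_le_of_trajectories_ODE (v := fun _ => f) (a := 0) (b := t) (fun _ => hf)
      (fun s _ => (hφ x s).continuousAt.continuousWithinAt) (fun s _ => (hφ x s).hasDerivWithinAt)
      (fun s _ => (hφ y s).continuousAt.continuousWithinAt) (fun s _ => (hφ y s).hasDerivWithinAt)
      (le_refl _) t ⟨ht, le_rfl⟩
    rw [h0, h0, sub_zero] at this
    rw [Real.coe_toNNReal _ (Real.exp_pos _).le, mul_comm]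
    exact this
  rcases le_total 0 t with ht | ht
  · exact key f φ hf h0 hφ t ht
  · have h := key (fun x => -f x) (fun x s => φ x (-s)) hf.neg (by simpa using h0)
      (fun x s => ?_) (-t) (by linarith)
    · simpa using h
    · have := (hφ x (-s)).scomp s (hasDerivAt_neg s)
      rwa [neg_one_smul] at this

end ODE

/-! ### The pregeodesic vector field -/

/-- The covector `w ↦ (D_v ḡ)(v, w) - (D_w ḡ)(v, v) / 2`. -/
def forceCov (g : LorentzMetric) (x v : E3) : E3 →L[ℝ] ℝ :=
  fderiv ℝ g.lift x v v - (1 / 2 : ℝ) • ((fderiv ℝ g.lift x).flip v).flip v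

/-- The second derivative of geodesics. -/
def accel (g : LorentzMetric) (x v : E3) : E3 := -(g.lift x).inverse (forceCov g x v)

/-- The second derivative of pregeodesics that are parametrized by arclength. -/
def spray (g : LorentzMetric) (x v : E3) : E3 := accel g x v - inner ℝ (accel g x v) v • v

/-- A smooth cutoff function, equal to `1` on the ball of radius `2`. -/
def cutoff : ContDiffBump (0 : E3) := ⟨2, 3, by norm_num, by norm_num⟩

/-- The pregeodesic vector field, cut off outside a neighbourhood of the unit tangent bundle. -/
def field (g : LorentzMetric) (z : E3 × E3) : E3 × E3 :=
  (cutoff z.2 • z.2, cutoff z.2 • spray g z.1 z.2)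

lemma covAccel_eq (g : LorentzMetric) (x v a w : E3) :
    covAccel g x v a w = g.lift x a w + forceCov g x v w := by
  simp [covAccel, forceCov]; ring

lemma LorentzMetric.exists_equiv (g : LorentzMetric) (x : E3) :
    ∃ e : E3 ≃L[ℝ] (E3 →L[ℝ] ℝ), (e : E3 →L[ℝ] (E3 →L[ℝ] ℝ)) = g.lift x := by
  have hinj : Function.Injective (g.lift x) := by
    refine (injective_iff_map_eq_zero _).2 fun a ha => g.nondegenerate (p := proj x) fun w => ?_
    change g.lift x a w = 0
    rw [ha]; rfl
  have hsurj : Function.Surjective (g.lift x) :=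
    (LinearMap.injective_iff_surjective_of_finrank_eq_finrank (f := (g.lift x).toLinearMap)
      (InnerProductSpace.toDual ℝ E3).toLinearEquiv.finrank_eq).1 hinj
  exact ⟨ContinuousLinearEquiv.ofBijective (g.lift x) (LinearMap.ker_eq_bot.2 hinj)
    (LinearMap.range_eq_top.2 hsurj), by ext; rfl⟩

lemma lift_accel (g : LorentzMetric) (x v : E3) : g.lift x (accel g x v) = -forceCov g x v := by
  obtain ⟨e, he⟩ := g.exists_equiv x
  rw [accel, ← he, ContinuousLinearMap.inverse_equiv]
  simp

lemma covAccel_accel_add (g : LorentzMetric) (x v : E3) (c : ℝ) (w : E3) :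
    covAccel g x v (accel g x v + c • v) w = c * g.lift x v w := by
  rw [covAccel_eq, map_add, lift_accel, map_smul]
  simp

lemma accel_eq_zero {x v : E3} (h : ∀ w, covAccel g x v 0 w = 0) : accel g x v = 0 := by
  refine g.nondegenerate (p := proj x) fun w => ?_
  change g.lift x (accel g x v) w = 0
  have := h w
  rw [covAccel_eq] at this
  rw [lift_accel]
  simpa using this

set_option maxSynthPendingDepth 3 in
lemma contDiff_accel (g : LorentzMetric) : ContDiff ℝ ∞ fun z : E3 × E3 => accel g z.1 z.2 := by
  have hF : ContDiff ℝ ∞ (fderiv ℝ g.lift) := g.smooth.fderiv_right (by simp)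
  have hF1 : ContDiff ℝ ∞ fun z : E3 × E3 => fderiv ℝ g.lift z.1 := hF.comp contDiff_fst
  have hflip : ContDiff ℝ ∞ fun z : E3 × E3 => (fderiv ℝ g.lift z.1).flip :=
    (ContinuousLinearMap.flipₗᵢ ℝ E3 E3 (E3 →L[ℝ] ℝ)).toContinuousLinearEquiv.contDiff.comp hF1
  have hflip2 : ContDiff ℝ ∞ fun z : E3 × E3 => ((fderiv ℝ g.lift z.1).flip z.2).flip :=
    (ContinuousLinearMap.flipₗᵢ ℝ E3 E3 ℝ).toContinuousLinearEquiv.contDiff.comp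
      (hflip.clm_apply contDiff_snd)
  have hcov : ContDiff ℝ ∞ fun z : E3 × E3 => forceCov g z.1 z.2 :=
    ((hF1.clm_apply contDiff_snd).clm_apply contDiff_snd).sub
      ((hflip2.clm_apply contDiff_snd).const_smul (1 / 2 : ℝ))
  have hinv : ContDiff ℝ ∞ fun x : E3 => (g.lift x).inverse := by
    rw [contDiff_iff_contDiffAt]
    intro x
    obtain ⟨e, he⟩ := g.exists_equiv x
    have h1 := contDiffAt_map_inverse (n := ∞) e
    rw [he] at h1
    exact h1.comp x g.smooth.contDiffAt
  exact ((hinv.comp contDiff_fst).clm_apply hcov).neg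

lemma contDiff_field (g : LorentzMetric) : ContDiff ℝ ∞ (field g) := by
  have hc : ContDiff ℝ ∞ fun z : E3 × E3 => cutoff z.2 := cutoff.contDiff.comp contDiff_snd
  have ha := contDiff_accel g
  unfold field spray
  exact (hc.smul contDiff_snd).prodMk
    (hc.smul (ha.sub ((ha.inner ℝ contDiff_snd).smul contDiff_snd)))

/-- The integer vector `k` in `ℝ³`. -/
def intVec (k : Fin 3 → ℤ) : E3 := WithLp.toLp 2 fun j => (k j : ℝ)

lemma lift_add_intVec (g : LorentzMetric) (x : E3) (k : Fin 3 → ℤ) :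
    g.lift (x + intVec k) = g.lift x := by
  rw [LorentzMetric.lift, intVec, proj_add_int]; rfl

lemma accel_add_intVec (g : LorentzMetric) (x v : E3) (k : Fin 3 → ℤ) :
    accel g (x + intVec k) v = accel g x v := by
  have hfd : fderiv ℝ g.lift (x + intVec k) = fderiv ℝ g.lift x := by
    rw [← fderiv_comp_add_right (𝕜 := ℝ) (f := g.lift)]
    congr 1
    exact funext fun y => lift_add_intVec g y k
  rw [accel, accel, forceCov, forceCov, hfd, lift_add_intVec]

lemma field_add_intVec (g : LorentzMetric) (z : E3 × E3) (k : Fin 3 → ℤ) :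
    field g (z + (intVec k, 0)) = field g z := by
  simp [field, spray, accel_add_intVec]

lemma cutoff_eq_zero {v : E3} (h : 3 < ‖v‖) : cutoff v = 0 :=
  cutoff.zero_of_le_dist (by rw [dist_zero_right]; exact h.le)

lemma cutoff_eq_one {v : E3} (h : ‖v‖ = 1) : cutoff v = 1 :=
  cutoff.one_of_mem_closedBall (by
    rw [mem_closedBall_zero_iff, h]; change (1 : ℝ) ≤ 2; norm_num)

/-- Base points can be moved into the unit cube and large velocities contribute nothing, so all
values are controlled on a compact ball. -/
lemma exists_bound_of_periodic {F : Type*} [NormedAddCommGroup F] {f : E3 × E3 → F}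
    (hf : Continuous f) (hper : ∀ z k, f (z + (intVec k, 0)) = f z)
    (hsupp : ∀ z : E3 × E3, 3 < ‖z.2‖ → f z = 0) : ∃ C : NNReal, ∀ z, ‖f z‖ ≤ C := by
  obtain ⟨C, hC⟩ := (isCompact_closedBall (0 : E3 × E3) 3).exists_bound_of_continuousOn
    hf.continuousOn
  refine ⟨C.toNNReal, fun z => ?_⟩
  refine le_trans ?_ (Real.le_coe_toNNReal C)
  have hC0 : 0 ≤ C := (norm_nonneg _).trans (hC 0 (by simp))
  rcases lt_or_ge 3 ‖z.2‖ with h | h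
  · rw [hsupp z h, norm_zero]; exact hC0
  · rw [← hper z fun j => -⌊z.1 j⌋]
    apply hC
    rw [mem_closedBall_zero_iff, Prod.norm_def]
    refine max_le ?_ (by simpa using h)
    have hfr : ∀ j, (z + (intVec fun j => -⌊z.1 j⌋, 0)).1 j = Int.fract (z.1 j) := fun j => by
      simp [intVec, Int.fract, sub_eq_add_neg]
    have hoct : (z + (intVec fun j => -⌊z.1 j⌋, 0)).1 ∈ octant := fun j => by
      rw [hfr]; exact Int.fract_nonneg _
    refine (norm_le_sum_coord hoct).trans ?_
    simp only [hfr, Fin.sum_univ_three]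
    linarith [(Int.fract_lt_one (z.1 0)).le, (Int.fract_lt_one (z.1 1)).le,
      (Int.fract_lt_one (z.1 2)).le]

lemma exists_field_bound (g : LorentzMetric) : ∃ L : NNReal, ∀ z, ‖field g z‖ ≤ L :=
  exists_bound_of_periodic (contDiff_field g).continuous (field_add_intVec g)
    fun z hz => by simp [field, cutoff_eq_zero hz]

lemma exists_field_lipschitz (g : LorentzMetric) : ∃ K : NNReal, LipschitzWith K (field g) := by
  obtain ⟨K, hK⟩ := exists_bound_of_periodic (f := fderiv ℝ (field g))
    ((contDiff_field g).continuous_fderiv (by simp)) (fun z k => by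
      rw [← fderiv_comp_add_right (𝕜 := ℝ) (f := field g)]
      congr 1
      exact funext fun y => field_add_intVec g y k) (fun z hz => by
      have : field g =ᶠ[𝓝 z] fun _ => 0 := by
        have ho : IsOpen {z : E3 × E3 | 3 < ‖z.2‖} := isOpen_lt continuous_const (by fun_prop)
        filter_upwards [ho.mem_nhds hz] with y hy
        simp [field, cutoff_eq_zero hy]
      rw [this.fderiv_eq]; simp)
  exact ⟨K, lipschitzWith_of_nnnorm_fderiv_le ((contDiff_field g).differentiable (by simp)) hK⟩

lemma hasDerivAt_fst {α : ℝ → E3 × E3} {α' : E3 × E3} {t : ℝ} (h : HasDerivAt α α' t) :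
    HasDerivAt (fun t => (α t).1) α'.1 t :=
  (ContinuousLinearMap.fst ℝ E3 E3).hasFDerivAt.comp_hasDerivAt t h

lemma hasDerivAt_snd {α : ℝ → E3 × E3} {α' : E3 × E3} {t : ℝ} (h : HasDerivAt α α' t) :
    HasDerivAt (fun t => (α t).2) α'.2 t :=
  (ContinuousLinearMap.snd ℝ E3 E3).hasFDerivAt.comp_hasDerivAt t h

/-- Integral curves of the pregeodesic field that start at a unit vector stay in the unit tangent
bundle. -/
lemma norm_snd_eq_one {α : ℝ → E3 × E3} (hα : ∀ t, HasDerivAt α (field g (α t)) t)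
    (h0 : ‖(α 0).2‖ = 1) (t : ℝ) : ‖(α t).2‖ = 1 := by
  obtain ⟨C, hC⟩ := exists_bound_of_periodic
    (f := fun z : E3 × E3 => cutoff z.2 * inner ℝ (accel g z.1 z.2) z.2)
    ((cutoff.continuous.comp continuous_snd).mul
      ((contDiff_accel g).continuous.inner continuous_snd))
    (fun z k => by simp [accel_add_intVec]) (fun z hz => by simp [cutoff_eq_zero hz])
  have hv : ∀ t, HasDerivAt (fun t => (α t).2) (cutoff (α t).2 • spray g (α t).1 (α t).2) t :=
    fun t => hasDerivAt_snd (hα t)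
  set q : ℝ → ℝ := fun t => cutoff (α t).2 * inner ℝ (accel g (α t).1 (α t).2) (α t).2 with hq
  -- A linear homogeneous equation with bounded coefficient; zero initial value forces the zero
  -- solution.
  have hu : ∀ t, HasDerivAt (fun t => ‖(α t).2‖ ^ 2 - 1) (-2 * q t * (‖(α t).2‖ ^ 2 - 1)) t := by
    intro t
    have h := (hv t).norm_sq.sub_const 1
    have he : -2 * q t * (‖(α t).2‖ ^ 2 - 1) =
        2 * inner ℝ (α t).2 (cutoff (α t).2 • spray g (α t).1 (α t).2) := by
      simp only [hq, spray, inner_smul_right, inner_sub_right, real_inner_self_eq_norm_sq]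
      rw [real_inner_comm (accel g (α t).1 (α t).2)]
      ring
    rw [he]; exact h
  have hz := ODE_solution_unique_univ (v := fun t u => -2 * q t * u) (s := fun _ => univ)
    (K := 2 * C) (f := fun t => ‖(α t).2‖ ^ 2 - 1) (g := fun _ => 0) (t₀ := 0)
    (fun t => (LipschitzWith.of_dist_le_mul fun a b => by
      rw [Real.dist_eq, Real.dist_eq, ← mul_sub, abs_mul]
      refine mul_le_mul_of_nonneg_right ?_ (abs_nonneg _)
      rw [abs_mul]
      have := hC (α t)
      rw [Real.norm_eq_abs] at this
      push_cast
      rw [abs_neg, abs_two]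
      exact mul_le_mul_of_nonneg_left this (by norm_num)).lipschitzOnWith)
    (fun t => ⟨hu t, trivial⟩) (fun t => ⟨by simpa using hasDerivAt_const t (0 : ℝ), trivial⟩)
    (by simp [h0])
  have h1 := congrFun hz t
  have h2 : ‖(α t).2‖ ^ 2 = 1 := sub_eq_zero.1 h1
  exact (pow_eq_one_iff_of_nonneg (norm_nonneg _) two_ne_zero).1 h2

lemma isUnitPregeodesic_of_solution {α : ℝ → E3 × E3} (hα : ∀ t, HasDerivAt α (field g (α t)) t)
    (h0 : ‖(α 0).2‖ = 1) :
    IsUnitPregeodesic g (fun t => (α t).1) ∧ ∀ t, deriv (fun t => (α t).1) t = (α t).2 := by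
  have hn := norm_snd_eq_one hα h0
  have hx : ∀ t, HasDerivAt (fun t => (α t).1) (α t).2 t := fun t => by
    have := hasDerivAt_fst (hα t)
    simpa [field, cutoff_eq_one (hn t)] using this
  have hv : ∀ t, HasDerivAt (fun t => (α t).2) (spray g (α t).1 (α t).2) t := fun t => by
    have := hasDerivAt_snd (hα t)
    simpa [field, cutoff_eq_one (hn t)] using this
  have hdx : deriv (fun t => (α t).1) = fun t => (α t).2 := funext fun t => (hx t).deriv
  have hdv : deriv (fun t => (α t).2) = fun t => spray g (α t).1 (α t).2 :=
    funext fun t => (hv t).deriv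
  have hcont : Continuous α := continuous_iff_continuousAt.2 fun t => (hα t).continuousAt
  have ha : Continuous fun t => accel g (α t).1 (α t).2 := (contDiff_accel g).continuous.comp hcont
  have hv2 : Continuous fun t => (α t).2 := continuous_snd.comp hcont
  refine ⟨⟨?_, fun t => by rw [hdx]; exact hn t, fun t => ?_⟩, fun t => by rw [hdx]⟩
  · rw [show (2 : WithTop ℕ∞) = 1 + 1 by norm_num, contDiff_succ_iff_deriv]
    refine ⟨fun t => (hx t).differentiableAt, by simp, ?_⟩
    rw [hdx, contDiff_one_iff_deriv]
    refine ⟨fun t => (hv t).differentiableAt, ?_⟩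
    rw [hdv]
    simp only [spray]
    fun_prop
  · rw [hdx, hdv]
    refine ⟨-inner ℝ (accel g (α t).1 (α t).2) (α t).2, fun w => ?_⟩
    rw [← covAccel_accel_add, neg_smul, ← sub_eq_add_neg]
    rfl

/-! ### The pregeodesic flow -/

/-- A measurable section of the covering map. -/
def fundamentalLift (p : T3) : E3 :=
  WithLp.toLp 2 fun j => (AddCircle.measurableEquivIoc 1 0 (p j) : ℝ)

lemma proj_fundamentalLift (p : T3) : proj (fundamentalLift p) = p := by
  ext j
  exact (AddCircle.equivIoc 1 0).symm_apply_apply (p j)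

lemma measurable_fundamentalLift : Measurable fundamentalLift := by
  unfold fundamentalLift
  refine (WithLp.measurable_toLp 2 _).comp (measurable_pi_lambda _ fun j => ?_)
  exact measurable_subtype_coe.comp
    ((AddCircle.measurableEquivIoc 1 0).measurable.comp (measurable_pi_apply j))

lemma mem_range_tangentLine_iff {i : Fin 3} {x : E3} {v : Metric.sphere (0 : E3) 1} :
    (proj x, v) ∈ range (tangentLine i) ↔
      ∃ s k, x = line i s + intVec k ∧ (v : E3) = stdE i := by
  constructor
  · rintro ⟨s, hs⟩
    simp only [tangentLine, Prod.mk.injEq] at hs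
    obtain ⟨k, hk⟩ := exists_int_of_proj_eq hs.1.symm
    exact ⟨s, k, hk, by rw [← hs.2]; rfl⟩
  · rintro ⟨s, k, rfl, hv⟩
    refine ⟨s, Prod.ext ?_ (Subtype.ext hv.symm)⟩
    simp only [tangentLine, intVec, proj_add_int]

lemma IsHedlundMetric.hasDerivAt_line_lift (hg : IsHedlundMetric lam ε g) (hε : 0 < ε) (i : Fin 3)
    (s : ℝ) (k : Fin 3 → ℤ) (t : ℝ) :
    HasDerivAt (fun t => (line i (s + t) + intVec k, stdE i))
      (field g (line i (s + t) + intVec k, stdE i)) t := by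
  have ha : accel g (line i (s + t) + intVec k) (stdE i) = 0 := by
    rw [accel_add_intVec]; exact accel_eq_zero fun w => hg.covAccel_line hε i _ w
  have hf : field g (line i (s + t) + intVec k, stdE i) = (stdE i, 0) := by
    simp [field, spray, ha, cutoff_eq_one (norm_stdE i)]
  rw [hf]
  have h1 : HasDerivAt (fun t => line i (s + t) + intVec k) (stdE i) t := by
    have := ((hasDerivAt_line i (s + t)).scomp t ((hasDerivAt_id t).const_add s)).add_const (intVec k)
    rwa [one_smul] at this
  exact h1.prodMk (hasDerivAt_const t (stdE i))

/-- The pregeodesic flow exists; it is measurable, and the tangent curves of the lines `l_i` are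
invariant under it. -/
lemma IsHedlundMetric.exists_flow (hg : IsHedlundMetric lam ε g) (hε : 0 < ε) :
    ∃ Φ : ℝ → UT → UT, IsPregeodesicFlow g Φ ∧ (∀ t, Measurable (Φ t)) ∧
      (∀ i t s, Φ t (tangentLine i s) = tangentLine i (s + t)) ∧
      ∀ i t z, Φ t z ∈ range (tangentLine i) → z ∈ range (tangentLine i) := by
  obtain ⟨K, hK⟩ := exists_field_lipschitz g
  obtain ⟨L, hL⟩ := exists_field_bound g
  choose φ h0 hφ using exists_global_solution hK hL
  -- One lifted curve per initial vector is enough, so a measurable choice of lift suffices and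
  -- continuity on the torus is not needed.
  set ι : UT → E3 × E3 := fun z => (fundamentalLift z.1, (z.2 : E3)) with hι
  have hn0 : ∀ z : UT, ‖(φ (ι z) 0).2‖ = 1 := fun z => by
    rw [h0]; exact mem_sphere_zero_iff_norm.1 z.2.2
  have hn : ∀ z t, ‖(φ (ι z) t).2‖ = 1 := fun z t => norm_snd_eq_one (hφ (ι z)) (hn0 z) t
  have huniq : ∀ (z : UT) (i : Fin 3) (s : ℝ) (k : Fin 3 → ℤ) (t₀ : ℝ),
      φ (ι z) t₀ = (line i (s + t₀) + intVec k, stdE i) →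
      φ (ι z) = fun t => (line i (s + t) + intVec k, stdE i) := fun z i s k t₀ h =>
    ODE_solution_unique_univ (v := fun _ => field g) (s := fun _ => univ) (K := K) (t₀ := t₀)
      (fun _ => hK.lipschitzOnWith) (fun t => ⟨hφ _ t, trivial⟩)
      (fun t => ⟨hg.hasDerivAt_line_lift hε i s k t, trivial⟩) h
  refine ⟨fun t z => (proj (φ (ι z) t).1, ⟨(φ (ι z) t).2, mem_sphere_zero_iff_norm.2 (hn z t)⟩),
    fun z => ⟨?_, ?_⟩, fun t => ?_, fun i t s => ?_, fun i t z hz => ?_⟩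
  · refine Prod.ext ?_ (Subtype.ext ?_)
    · simp only [h0, hι, proj_fundamentalLift]
    · simp only [h0, hι]
  · obtain ⟨h1, h2⟩ := isUnitPregeodesic_of_solution (hφ (ι z)) (hn0 z)
    exact ⟨_, h1, fun t => ⟨rfl, (h2 t).symm⟩⟩
  · have hιm : Measurable ι := (measurable_fundamentalLift.comp measurable_fst).prodMk
      (measurable_subtype_coe.comp measurable_snd)
    have hm : Measurable fun z => φ (ι z) t :=
      (continuous_of_solutions hK h0 hφ t).measurable.comp hιm
    exact (continuous_proj.measurable.comp (measurable_fst.comp hm)).prodMk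
      ((measurable_snd.comp hm).subtype_mk)
  · obtain ⟨k, hk⟩ := exists_int_of_proj_eq (proj_fundamentalLift (proj (line i s)))
    have h1 := huniq (tangentLine i s) i s k 0 (by
      rw [h0, add_zero]; exact Prod.ext hk rfl)
    refine Prod.ext ?_ (Subtype.ext ?_)
    · simp only [h1]
      simp only [tangentLine, intVec, proj_add_int]
    · simp only [h1]; rfl
  -- Uniqueness is applied at time `t` and read off at time `0`, without a group law for `Φ`.
  · obtain ⟨s, k, hk, hv⟩ := mem_range_tangentLine_iff.1 hz
    have h1 := huniq z i (s - t) k t (by rw [sub_add_cancel]; exact Prod.ext hk hv)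
    have h2 := congrFun h1 0
    rw [h0] at h2
    have hz' : z = (proj (fundamentalLift z.1), z.2) := by rw [proj_fundamentalLift]
    rw [hz', mem_range_tangentLine_iff]
    exact ⟨s - t + 0, k, congrArg Prod.fst h2, congrArg Prod.snd h2⟩

/-! ### The measures on the tangent curves of the lines -/

lemma continuous_tangentLine (i : Fin 3) : Continuous (tangentLine i) := by
  have : Continuous (line i) := by unfold line; fun_prop
  exact (continuous_proj.comp this).prodMk continuous_const

lemma range_tangentLine_eq (i : Fin 3) :
    range (tangentLine i) = tangentLine i '' Icc (0 : ℝ) 1 := by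
  have := (periodic_tangentLine i).image_Icc one_pos 0
  rw [zero_add] at this
  exact this.symm

lemma isClosed_range_tangentLine (i : Fin 3) : IsClosed (range (tangentLine i)) := by
  rw [range_tangentLine_eq]
  exact (isCompact_Icc.image (continuous_tangentLine i)).isClosed

instance isProbabilityMeasure_lineMeasure (i : Fin 3) : IsProbabilityMeasure (lineMeasure i) := by
  have : IsProbabilityMeasure (volume.restrict (Icc (0 : ℝ) 1)) := ⟨by simp⟩
  exact Measure.isProbabilityMeasure_map (continuous_tangentLine i).measurable.aemeasurable

lemma lineMeasure_compl_range (i : Fin 3) : lineMeasure i (range (tangentLine i))ᶜ = 0 := by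
  rw [lineMeasure, Measure.map_apply (continuous_tangentLine i).measurable
    (isClosed_range_tangentLine i).measurableSet.compl]
  simp [preimage_compl]

lemma support_lineMeasure (i : Fin 3) : (lineMeasure i).support = range (tangentLine i) := by
  apply Subset.antisymm
  · exact Measure.support_subset_of_isClosed (isClosed_range_tangentLine i)
      (lineMeasure_compl_range i)
  · rintro _ ⟨s, rfl⟩
    have hs : tangentLine i s = tangentLine i (Int.fract s) := by
      have := (periodic_tangentLine i).sub_int_mul_eq ⌊s⌋ (x := s)
      rw [mul_one] at this
      exact this.symm
    rw [hs, Measure.mem_support_iff_forall]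
    intro U hU
    obtain ⟨O, hOU, hO, hmem⟩ := mem_nhds_iff.1 hU
    refine lt_of_lt_of_le ?_ (measure_mono hOU)
    rw [lineMeasure, Measure.map_apply (continuous_tangentLine i).measurable hO.measurableSet,
      Measure.restrict_apply ((continuous_tangentLine i).measurable hO.measurableSet)]
    set r := Int.fract s
    obtain ⟨δ, hδ, hball⟩ := Metric.isOpen_iff.1 (hO.preimage (continuous_tangentLine i)) r hmem
    have hr0 : 0 ≤ r := Int.fract_nonneg s
    have hr1 : r < 1 := Int.fract_lt_one s
    -- Because `r < 1`, there is an interval of positive length to the right of `r` inside `[0, 1]`.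
    have hsub : Ioo r (min (r + δ) 1) ⊆ tangentLine i ⁻¹' O ∩ Icc (0 : ℝ) 1 := by
      intro t ht
      have h1 := lt_min_iff.1 ht.2
      refine ⟨hball ?_, by linarith [ht.1], h1.2.le⟩
      rw [Metric.mem_ball, Real.dist_eq, abs_lt]
      constructor <;> linarith [ht.1, h1.1]
    refine lt_of_lt_of_le ?_ (measure_mono hsub)
    rw [Real.volume_Ioo, ENNReal.ofReal_pos, sub_pos, lt_min_iff]
    exact ⟨by linarith, hr1⟩

lemma stdE_injective : Function.Injective stdE := fun i j h => by
  have h1 := stdE_apply i i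
  rw [h, stdE_apply] at h1
  by_contra hne
  simp [hne] at h1

lemma lineMeasure_injective : Function.Injective lineMeasure := fun i j h => by
  have h1 : tangentLine i 0 ∈ range (tangentLine j) := by
    rw [← support_lineMeasure, ← h, support_lineMeasure]; exact mem_range_self 0
  obtain ⟨s, hs⟩ := h1
  have h2 := congrArg (fun z : UT => (z.2 : E3)) hs
  exact (stdE_injective h2).symm

lemma integral_lineMeasure (i : Fin 3) {f : UT → ℝ} (hf : Measurable f) :
    ∫ z, f z ∂lineMeasure i = ∫ t in (0 : ℝ)..1, f (tangentLine i t) := by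
  rw [lineMeasure, integral_map (continuous_tangentLine i).measurable.aemeasurable
    hf.aestronglyMeasurable, intervalIntegral.integral_of_le zero_le_one,
    integral_Icc_eq_integral_Ioc]

lemma integral_tangentLine_add (i : Fin 3) (f : UT → ℝ) (s : ℝ) :
    ∫ t in (0 : ℝ)..1, f (tangentLine i (s + t)) = ∫ t in (0 : ℝ)..1, f (tangentLine i t) := by
  have hper : Function.Periodic (fun t => f (tangentLine i t)) 1 := fun t => by
    simp only [periodic_tangentLine i t]
  rw [intervalIntegral.integral_comp_add_left (fun t => f (tangentLine i t)) s]
  have := hper.intervalIntegral_add_eq s 0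
  rw [zero_add] at this
  rw [add_zero]
  exact this

/-! ### Measurability of the metric on the unit tangent bundle -/

/-- Regularity of the metric is given on the cover; it is transported to the torus by the measurable
section. -/
lemma measurable_form_apply (g : LorentzMetric) {v w : UT → E3} (hv : Measurable v)
    (hw : Measurable w) : Measurable fun z : UT => g.form z.1 (v z) (w z) := by
  have hc : Continuous fun x : E3 × E3 × E3 => g.lift x.1 x.2.1 x.2.2 := by
    have := g.continuous_lift
    fun_prop
  have hm : Measurable fun z : UT => (fundamentalLift z.1, v z, w z) :=
    (measurable_fundamentalLift.comp measurable_fst).prodMk (hv.prodMk hw)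
  have he : (fun z : UT => g.form z.1 (v z) (w z)) =
      (fun x : E3 × E3 × E3 => g.lift x.1 x.2.1 x.2.2) ∘
        fun z : UT => (fundamentalLift z.1, v z, w z) := funext fun z => by
    simp [LorentzMetric.lift, proj_fundamentalLift]
  rw [he]
  exact hc.measurable.comp hm

lemma measurable_coe_snd : Measurable fun z : UT => (z.2 : E3) :=
  measurable_subtype_coe.comp measurable_snd

lemma measurableSet_futureCausal (g : LorentzMetric) :
    MeasurableSet {z : UT | FutureCausal g z.1 (z.2 : E3)} := by
  refine MeasurableSet.inter ?_ (MeasurableSet.inter ?_ ?_)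
  · exact measurable_coe_snd (measurableSet_singleton (0 : E3)).compl
  · exact measurableSet_le (measurable_form_apply g measurable_coe_snd measurable_coe_snd)
      measurable_const
  · exact measurableSet_lt (measurable_form_apply g measurable_coe_snd measurable_const)
      measurable_const

/-- The Lorentzian length of a unit vector. -/
def vecLength (g : LorentzMetric) (z : UT) : ℝ := √(-(g.form z.1 (z.2 : E3) (z.2 : E3)))

lemma measurable_vecLength (g : LorentzMetric) : Measurable (vecLength g) :=
  (measurable_form_apply g measurable_coe_snd measurable_coe_snd).neg.sqrt

lemma exists_vecLength_bound (g : LorentzMetric) : ∃ C, ∀ z, |vecLength g z| ≤ C := by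
  have hc : Continuous fun z : E3 × E3 => √(-(g.lift z.1 z.2 z.2)) := by
    have := g.continuous_lift
    fun_prop
  obtain ⟨C, hC⟩ := (isCompact_closedBall (0 : E3 × E3) 3).exists_bound_of_continuousOn
    hc.continuousOn
  refine ⟨C, fun z => ?_⟩
  have hz : vecLength g z = √(-(g.lift (fundamentalLift z.1) z.2 z.2)) := by
    rw [vecLength, LorentzMetric.lift, proj_fundamentalLift]
  rw [hz]
  refine hC (fundamentalLift z.1, z.2) ?_
  rw [mem_closedBall_zero_iff, Prod.norm_def]
  have hI : ∀ j, fundamentalLift z.1 j ∈ Ioc (0 : ℝ) (0 + 1) := fun j =>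
    (AddCircle.measurableEquivIoc 1 0 (z.1 j)).2
  refine max_le ((norm_le_sum_coord fun j => (hI j).1.le).trans ?_) ?_
  · rw [Fin.sum_univ_three]; linarith [(hI 0).2, (hI 1).2, (hI 2).2]
  · simp only [mem_sphere_zero_iff_norm.1 z.2.2]; norm_num

variable {Φ : ℝ → UT → UT}

/-! ### Averages along the pregeodesic flow -/

lemma IsPregeodesicFlow.continuous_orbit (hΦ : IsPregeodesicFlow g Φ) (z : UT) :
    Continuous fun t => Φ t z := by
  obtain ⟨-, γ, hγ, h⟩ := hΦ z
  refine Continuous.prodMk ?_ (Continuous.subtype_mk ?_ fun t => (Φ t z).2.2)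
  · simp only [(h _).1]; exact continuous_proj.comp hγ.1.continuous
  · simp only [(h _).2]; exact hγ.1.continuous_deriv (by norm_num)

lemma IsPregeodesicFlow.measurable_uncurry (hΦ : IsPregeodesicFlow g Φ)
    (hm : ∀ t, Measurable (Φ t)) : Measurable (Function.uncurry Φ) :=
  measurable_uncurry_of_continuous_of_measurable hΦ.continuous_orbit hm

/-- The average of a function over a piece of orbit of length one. -/
def orbitAverage (Φ : ℝ → UT → UT) (f : UT → ℝ) (z : UT) : ℝ := ∫ t in Icc (0 : ℝ) 1, f (Φ t z)

/-- Fubini and invariance; this turns space averages into quantities to which the estimates for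
curves apply. -/
lemma IsPregeodesicFlow.orbitAverage_integral (hΦ : IsPregeodesicFlow g Φ) {μ : Measure UT}
    [IsProbabilityMeasure μ] (hμ : ∀ t, MeasurePreserving (Φ t) μ μ) {f : UT → ℝ}
    (hf : Measurable f) {C : ℝ} (hC : ∀ z, |f z| ≤ C) :
    Integrable (orbitAverage Φ f) μ ∧ ∫ z, orbitAverage Φ f z ∂μ = ∫ z, f z ∂μ := by
  have hu := hΦ.measurable_uncurry fun t => (hμ t).measurable
  have hint : Integrable (fun p : UT × ℝ => f (Φ p.2 p.1)) (μ.prod (volume.restrict (Icc (0 : ℝ) 1))) :=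
    Integrable.of_bound (hf.comp (hu.comp measurable_swap)).aestronglyMeasurable C
      (Eventually.of_forall fun p => hC _)
  refine ⟨hint.integral_prod_left, ?_⟩
  unfold orbitAverage
  rw [integral_integral_swap hint]
  have h1 : ∀ t, ∫ z, f (Φ t z) ∂μ = ∫ z, f z ∂μ := fun t => by
    conv_rhs => rw [← (hμ t).map_eq]
    rw [integral_map (hμ t).measurable.aemeasurable hf.aestronglyMeasurable]
  simp [h1]

/-- The pairing of a unit vector with `∑ w_j dx_j`. -/
def linearPart (w : Fin 3 → ℝ) (z : UT) : ℝ := ∑ j, w j * (z.2 : E3) j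

lemma continuous_linearPart (w : Fin 3 → ℝ) : Continuous (linearPart w) := by
  unfold linearPart; fun_prop

lemma exists_linearPart_bound (w : Fin 3 → ℝ) : ∃ C, ∀ z, |linearPart w z| ≤ C := by
  obtain ⟨C, hC⟩ := isCompact_univ.exists_bound_of_continuousOn (continuous_linearPart w).continuousOn
  exact ⟨C, fun z => hC z (mem_univ _)⟩

lemma integral_linearPart (w : Fin 3 → ℝ) (μ : Measure UT) [IsProbabilityMeasure μ] :
    ∫ z, linearPart w z ∂μ = ∑ j, w j * rotationClass μ j := by
  unfold linearPart
  rw [integral_finsetSum]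
  · exact Finset.sum_congr rfl fun j _ => integral_const_mul _ _
  · intro j _
    refine Integrable.const_mul (Integrable.of_bound ?_ 1 (Eventually.of_forall fun z => ?_)) _
    · exact (Continuous.measurable (by fun_prop)).aestronglyMeasurable
    · refine (PiLp.norm_apply_le (z.2 : E3) j).trans (mem_sphere_zero_iff_norm.1 z.2.2).le

lemma potential_increment {γ : ℝ → E3} {z : UT} (hγ : IsUnitPregeodesic g γ)
    (h : ∀ t, (Φ t z).1 = proj (γ t) ∧ ((Φ t z).2 : E3) = deriv γ t) (w : Fin 3 → ℝ) :
    potential w (γ 1) - potential w (γ 0) =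
      orbitAverage Φ (linearPart w) z - (correction w (Φ 1 z).1 - correction w (Φ 0 z).1) := by
  have hd : ∀ t, HasDerivAt (fun t => ∑ j, w j * γ t j) (linearPart w (Φ t z)) t := by
    intro t
    have h1 : HasDerivAt γ (deriv γ t) t := (hγ.1.differentiable (by norm_num) t).hasDerivAt
    simp only [linearPart, (h t).2]
    refine HasDerivAt.fun_sum fun j _ => HasDerivAt.const_mul _ ?_
    exact (EuclideanSpace.proj j : E3 →L[ℝ] ℝ).hasFDerivAt.comp_hasDerivAt t h1
  have hc : Continuous fun t => linearPart w (Φ t z) := by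
    have : Continuous (deriv γ) := hγ.1.continuous_deriv (by norm_num)
    simp only [linearPart, (h _).2]
    fun_prop
  have h2 := intervalIntegral.integral_eq_sub_of_hasDerivAt (a := 0) (b := 1) (fun t _ => hd t)
    (hc.intervalIntegrable 0 1)
  rw [intervalIntegral.integral_of_le zero_le_one, ← integral_Icc_eq_integral_Ioc] at h2
  rw [orbitAverage, h2, (h 1).1, (h 0).1, potential, potential]
  ring

lemma isFuturePointing_of_ae {γ : ℝ → E3} {z : UT} (hγ : IsUnitPregeodesic g γ)
    (h : ∀ t, (Φ t z).1 = proj (γ t) ∧ ((Φ t z).2 : E3) = deriv γ t)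
    (hf : ∀ᵐ t ∂(volume.restrict (Icc (0 : ℝ) 1)), FutureCausal g (Φ t z).1 ((Φ t z).2 : E3)) :
    IsFuturePointing g γ 0 1 := by
  have hd : Differentiable ℝ γ := hγ.1.differentiable (by norm_num)
  refine ⟨one_pos, ⟨1, ?_⟩, ?_⟩
  · refine (lipschitzWith_of_nnnorm_deriv_le hd fun t => ?_).lipschitzOnWith
    rw [← NNReal.coe_le_coe]; simp [hγ.2.1 t]
  · filter_upwards [hf] with t ht
    rw [(h t).1, (h t).2] at ht
    exact ⟨hd t, ht⟩

/-- Invariance gives the property at each fixed time for almost every `z`; Fubini exchanges the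
quantifiers. -/
lemma ae_orbit_futureCausal (hΦ : IsPregeodesicFlow g Φ) {μ : Measure UT}
    [IsProbabilityMeasure μ] (hμ : ∀ t, MeasurePreserving (Φ t) μ μ)
    (hfut : ∀ᵐ z ∂μ, FutureCausal g z.1 (z.2 : E3)) :
    ∀ᵐ z ∂μ, ∀ᵐ t ∂(volume.restrict (Icc (0 : ℝ) 1)),
      FutureCausal g (Φ t z).1 ((Φ t z).2 : E3) := by
  have hu := hΦ.measurable_uncurry fun t => (hμ t).measurable
  rw [Measure.ae_ae_comm]
  · exact Eventually.of_forall fun t => (hμ t).quasiMeasurePreserving.ae hfut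
  · exact (hu.comp measurable_swap) (measurableSet_futureCausal g)

/-! ### Maximal ergodic measures -/

lemma integral_correction_sub {μ : Measure UT} [IsProbabilityMeasure μ]
    (hμ : ∀ t, MeasurePreserving (Φ t) μ μ) (w : Fin 3 → ℝ) :
    Integrable (fun z => correction w (Φ 1 z).1 - correction w (Φ 0 z).1) μ ∧
      ∫ z, (correction w (Φ 1 z).1 - correction w (Φ 0 z).1) ∂μ = 0 := by
  obtain ⟨C, -, hC⟩ := exists_correction_bound w
  have hm : Measurable fun z : UT => correction w z.1 :=
    (continuous_correction w).measurable.comp measurable_fst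
  have hi : ∀ t, Integrable (fun z => correction w (Φ t z).1) μ := fun t =>
    Integrable.of_bound (hm.comp (hμ t).measurable).aestronglyMeasurable C
      (Eventually.of_forall fun z => hC _)
  have he : ∀ t, ∫ z, correction w (Φ t z).1 ∂μ = ∫ z, correction w z.1 ∂μ := fun t => by
    conv_rhs => rw [← (hμ t).map_eq]
    rw [integral_map (hμ t).measurable.aemeasurable hm.aestronglyMeasurable]
  exact ⟨(hi 1).sub (hi 0), by rw [integral_sub (hi 1) (hi 0), he, he, sub_self]⟩

/-- The mean increment of the `j`-th potential over unit time is nonnegative and equals the `j`-th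
coordinate of the rotation class. Only on the octant is `l` determined. -/
lemma Calibrated.rotationClass_mem_octant (hcal : Calibrated lam g)
    (hΦ : IsPregeodesicFlow g Φ) {μ : Measure UT} [IsProbabilityMeasure μ]
    (hμ : ∀ t, MeasurePreserving (Φ t) μ μ) (hfut : ∀ᵐ z ∂μ, FutureCausal g z.1 (z.2 : E3)) :
    rotationClass μ ∈ octant := by
  intro j
  obtain ⟨C, hC⟩ := exists_linearPart_bound (Pi.single j 1)
  obtain ⟨hi, he⟩ := hΦ.orbitAverage_integral hμ
    (continuous_linearPart (Pi.single j 1)).measurable hC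
  obtain ⟨hi', he'⟩ := integral_correction_sub hμ (Pi.single j 1)
  have h1 : 0 ≤ ∫ z, (orbitAverage Φ (linearPart (Pi.single j 1)) z -
      (correction (Pi.single j 1) (Φ 1 z).1 - correction (Pi.single j 1) (Φ 0 z).1)) ∂μ := by
    refine integral_nonneg_of_ae ?_
    filter_upwards [ae_orbit_futureCausal hΦ hμ hfut] with z hz
    obtain ⟨-, γ, hγ, h⟩ := hΦ z
    have := hcal.potential_mono (single_nonneg j) (isFuturePointing_of_ae hγ h hz)
    rw [← potential_increment hγ h]
    exact sub_nonneg.2 this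
  rw [integral_sub hi hi', he, he', integral_linearPart] at h1
  simpa [Pi.single_apply] using h1

lemma mem_range_of_mem_lineFamily {i : Fin 3} {x : E3} {v : Metric.sphere (0 : E3) 1}
    (hx : x ∈ lineFamily i) (hi : 0 < (v : E3) i) (hj : ∀ j, j ≠ i → (v : E3) j = 0) :
    (proj x, v) ∈ range (tangentLine i) := by
  obtain ⟨t, k, rfl⟩ := hx
  refine mem_range_tangentLine_iff.2 ⟨t, k, rfl, ?_⟩
  have hv : (v : E3) = (v : E3) i • stdE i := by
    ext j
    by_cases h : j = i
    · simp [h, stdE_apply]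
    · simp [h, stdE_apply, hj j h]
  have hn := mem_sphere_zero_iff_norm.1 v.2
  rw [hv, norm_smul, norm_stdE, mul_one, Real.norm_eq_abs, abs_of_pos hi] at hn
  rw [hv, hn, one_smul]

/-- A maximal measure is carried by the tangent curves of the lines. -/
lemma Calibrated.ae_mem_range (hcal : Calibrated lam g) (hlam : ∀ i, 0 < lam i)
    (hΦ : IsPregeodesicFlow g Φ)
    (hback : ∀ i t z, Φ t z ∈ range (tangentLine i) → z ∈ range (tangentLine i))
    {μ : Measure UT} [IsProbabilityMeasure μ]
    (hμ : ∀ t, MeasurePreserving (Φ t) μ μ) (hfut : ∀ᵐ z ∂μ, FutureCausal g z.1 (z.2 : E3))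
    (hmax : averageLength g μ = ∑ i, lam i * rotationClass μ i) :
    ∀ᵐ z ∂μ, ∃ i, z ∈ range (tangentLine i) := by
  obtain ⟨C, hC⟩ := exists_linearPart_bound lam
  obtain ⟨hi, he⟩ := hΦ.orbitAverage_integral hμ (continuous_linearPart lam).measurable hC
  obtain ⟨hi', he'⟩ := integral_correction_sub hμ lam
  obtain ⟨D, hD⟩ := exists_vecLength_bound g
  obtain ⟨hi'', he''⟩ := hΦ.orbitAverage_integral hμ (measurable_vecLength g) hD
  have hlen : ∀ z γ, (∀ t, (Φ t z).1 = proj (γ t) ∧ ((Φ t z).2 : E3) = deriv γ t) →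
      ∀ t, vecLength g (Φ t z) = √(-g.form (proj (γ t)) (deriv γ t) (deriv γ t)) := by
    intro z γ h t
    rw [vecLength, (h t).1, (h t).2]
  have hcomp : ∀ z γ, (∀ t, (Φ t z).1 = proj (γ t) ∧ ((Φ t z).2 : E3) = deriv γ t) →
      orbitAverage Φ (vecLength g) z =
        ∫ t in (0 : ℝ)..1, √(-g.form (proj (γ t)) (deriv γ t) (deriv γ t)) := by
    intro z γ h
    rw [orbitAverage, intervalIntegral.integral_of_le zero_le_one, ← integral_Icc_eq_integral_Ioc]
    simp only [hlen z γ h]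
  -- The excess of the potential increment over the length is nonnegative; maximality makes its
  -- integral zero.
  have hnn : 0 ≤ᵐ[μ] fun z => orbitAverage Φ (linearPart lam) z -
      (correction lam (Φ 1 z).1 - correction lam (Φ 0 z).1) - orbitAverage Φ (vecLength g) z := by
    filter_upwards [ae_orbit_futureCausal hΦ hμ hfut] with z hz
    obtain ⟨-, γ, hγ, h⟩ := hΦ z
    have hfp := isFuturePointing_of_ae hγ h hz
    have := hcal.lorentzLength_le hlam hfp
    rw [lorentzLength_eq hfp, ← hcomp z γ h, potential_increment hγ h] at this
    exact sub_nonneg.2 this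
  have hzero := (integral_eq_zero_iff_of_nonneg_ae hnn ((hi.sub hi').sub hi'')).1 (by
    have h1 : ∫ z, (orbitAverage Φ (linearPart lam) z -
        (correction lam (Φ 1 z).1 - correction lam (Φ 0 z).1)) ∂μ = averageLength g μ := by
      rw [integral_sub hi hi', he, he', integral_linearPart, ← hmax, sub_zero]
    refine (integral_sub (hi.sub hi') hi'').trans ?_
    rw [he'']
    exact sub_eq_zero.2 h1)
  filter_upwards [ae_orbit_futureCausal hΦ hμ hfut, hzero] with z hz h0
  have hcont := hΦ.continuous_orbit z
  obtain ⟨-, γ, hγ, h⟩ := hΦ z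
  have hfp := isFuturePointing_of_ae hγ h hz
  have hc : Continuous fun t => √(-g.form (proj (γ t)) (deriv γ t) (deriv γ t)) := by
    have h1 : Continuous (deriv γ) := hγ.1.continuous_deriv (by norm_num)
    have h2 := g.continuous_lift.comp hγ.1.continuous
    exact ((h2.clm_apply h1).clm_apply h1).neg.sqrt
  have hae := hcal.ae_mem_of_length_eq hlam hfp (hc.intervalIntegrable 0 1) (by
    rw [← hcomp z γ h, potential_increment hγ h]
    simp only [Pi.zero_apply] at h0
    linarith)
  have hne : (ae (volume.restrict (Icc (0 : ℝ) 1))).NeBot := by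
    rw [ae_neBot, Ne, Measure.restrict_eq_zero]; simp
  -- A single time tangent to a line suffices, since `hback` carries this back to `z`.
  obtain ⟨t, i, h1, h2, h3⟩ := hae.exists
  refine ⟨i, hback i t z ?_⟩
  have hz' : Φ t z = (proj (γ t), (Φ t z).2) := Prod.ext (h t).1 rfl
  rw [hz']
  rw [← (h t).2] at h2
  refine mem_range_of_mem_lineFamily h1 h2 fun j hj => ?_
  rw [(h t).2]; exact h3 j hj

/-- From any starting point of the closed orbit, the average of an indicator over one period is the
measure given by `lineMeasure`; integrating this constant gives `μ`. -/
lemma eq_lineMeasure (hΦ : IsPregeodesicFlow g Φ)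
    (hline : ∀ i t s, Φ t (tangentLine i s) = tangentLine i (s + t)) {μ : Measure UT}
    [IsProbabilityMeasure μ] (hμ : ∀ t, MeasurePreserving (Φ t) μ μ) {i : Fin 3}
    (hi : ∀ᵐ z ∂μ, z ∈ range (tangentLine i)) : μ = lineMeasure i := by
  have hreal : ∀ A, MeasurableSet A → μ.real A = (lineMeasure i).real A := by
    intro A hA
    have hf : Measurable (A.indicator (1 : UT → ℝ)) := measurable_one.indicator hA
    obtain ⟨-, h2⟩ := hΦ.orbitAverage_integral hμ hf (C := 1) (fun z => by
      by_cases hz : z ∈ A <;> simp [hz])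
    rw [← integral_indicator_one hA, ← integral_indicator_one hA, integral_lineMeasure i hf, ← h2]
    have h3 : orbitAverage Φ (A.indicator 1) =ᵐ[μ]
        fun _ => ∫ t in (0 : ℝ)..1, A.indicator (1 : UT → ℝ) (tangentLine i t) := by
      filter_upwards [hi] with z hz
      obtain ⟨s, rfl⟩ := hz
      rw [orbitAverage, integral_Icc_eq_integral_Ioc, ← intervalIntegral.integral_of_le zero_le_one]
      simp only [hline]
      exact integral_tangentLine_add i _ s
    rw [integral_congr_ae h3]
    simp
  ext A hA
  rw [← ENNReal.toReal_eq_toReal_iff' (measure_ne_top _ _) (measure_ne_top _ _)]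
  exact hreal A hA

lemma rotationClass_lineMeasure (i : Fin 3) : rotationClass (lineMeasure i) = stdE i := by
  ext j
  have hm : Measurable fun z : UT => (z.2 : E3) j := Continuous.measurable (by fun_prop)
  change ∫ z, (z.2 : E3) j ∂lineMeasure i = stdE i j
  rw [integral_lineMeasure i hm]
  simp [tangentLine, stdS]

lemma IsHedlundMetric.isMaximalErgodic_lineMeasure (hg : IsHedlundMetric lam ε g) (hε : 0 < ε)
    (hlam : ∀ i, 0 < lam i) (hm : ∀ t, Measurable (Φ t))
    (hline : ∀ i t s, Φ t (tangentLine i s) = tangentLine i (s + t)) {l : E3 → ℝ}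
    (hl : ∀ h ∈ octant, l h = ∑ i, lam i * h i) (i : Fin 3) :
    IsMaximalErgodic g Φ l (lineMeasure i) := by
  have htm := (continuous_tangentLine i).measurable
  refine ⟨inferInstance, fun t => ⟨hm t, ?_⟩, fun A hA hinv => ?_, ?_, ?_⟩
  · have := Measure.isProbabilityMeasure_map (μ := lineMeasure i) (hm t).aemeasurable
    ext A hA
    rw [← ENNReal.toReal_eq_toReal_iff' (measure_ne_top _ _) (measure_ne_top _ _)]
    change (Measure.map (Φ t) (lineMeasure i)).real A = (lineMeasure i).real A
    have hf : Measurable (A.indicator (1 : UT → ℝ)) := measurable_one.indicator hA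
    rw [← integral_indicator_one hA, ← integral_indicator_one hA,
      integral_map (hm t).aemeasurable hf.aestronglyMeasurable,
      integral_lineMeasure i (f := fun z => A.indicator 1 (Φ t z)) (hf.comp (hm t)),
      integral_lineMeasure i hf]
    simp only [hline]
    rw [← integral_tangentLine_add i _ t]
    simp only [add_comm]
  -- An invariant set contains the whole closed orbit or misses it.
  · have hall : ∀ s, tangentLine i s ∈ A ↔ tangentLine i 0 ∈ A := fun s => by
      have h1 := hinv s
      have h2 : Φ s (tangentLine i 0) = tangentLine i s := by rw [hline, zero_add]
      rw [← h2]
      change tangentLine i 0 ∈ Φ s ⁻¹' A ↔ _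
      rw [h1]
    by_cases h0 : tangentLine i 0 ∈ A
    · right
      refine measure_mono_null ?_ (lineMeasure_compl_range i)
      rintro z hz ⟨s, rfl⟩
      exact hz ((hall s).2 h0)
    · left
      refine measure_mono_null ?_ (lineMeasure_compl_range i)
      rintro z hz ⟨s, rfl⟩
      exact h0 ((hall s).1 hz)
  · rw [lineMeasure, ae_map_iff htm.aemeasurable (measurableSet_futureCausal g)]
    exact Eventually.of_forall fun s =>
      hg.futureCausal_stdE hε (hlam i) (line_mem_lineFamily i s)
  · rw [rotationClass_lineMeasure, hl _ (stdE_mem_octant i)]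
    change ∫ z, vecLength g z ∂lineMeasure i = _
    rw [integral_lineMeasure i (measurable_vecLength g)]
    have : ∀ t, vecLength g (tangentLine i t) = lam i := fun t => by
      change √(-(g.form (proj (line i t)) (stdE i) (stdE i))) = lam i
      rw [hg.form_eq hε (line_mem_lineFamily i t), tubeForm_stdE, neg_neg,
        Real.sqrt_sq (hlam i).le]
    simp [this, stdE_apply]

/-- The three invariant tangent curves carry `μ`, so they cannot all be null; by ergodicity one of
them has full measure. -/
lemma IsMaximalErgodic.mem_range_lineMeasure (hcal : Calibrated lam g) (hlam : ∀ i, 0 < lam i)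
    (hΦ : IsPregeodesicFlow g Φ)
    (hline : ∀ i t s, Φ t (tangentLine i s) = tangentLine i (s + t))
    (hback : ∀ i t z, Φ t z ∈ range (tangentLine i) → z ∈ range (tangentLine i))
    {l : E3 → ℝ} (hl : ∀ h ∈ octant, l h = ∑ i, lam i * h i) {μ : Measure UT}
    (hμ : IsMaximalErgodic g Φ l μ) : μ ∈ range lineMeasure := by
  have := hμ.prob
  have hmax := hμ.maximal
  rw [hl _ (hcal.rotationClass_mem_octant hΦ hμ.invariant hμ.future)] at hmax
  have hae := hcal.ae_mem_range hlam hΦ hback hμ.invariant hμ.future hmax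
  have hinv : ∀ i t, Φ t ⁻¹' range (tangentLine i) = range (tangentLine i) := by
    intro i t
    refine Subset.antisymm (hback i t) ?_
    rintro _ ⟨s, rfl⟩
    exact ⟨s + t, (hline i t s).symm⟩
  have hex : ∃ i, μ (range (tangentLine i))ᶜ = 0 := by
    by_contra! hcon
    have h0 : ∀ i, μ (range (tangentLine i)) = 0 := fun i =>
      (hμ.ergodic _ (isClosed_range_tangentLine i).measurableSet (hinv i)).resolve_right (hcon i)
    have h1 : ∀ᵐ z ∂μ, ∀ i, z ∉ range (tangentLine i) :=
      ae_all_iff.2 fun i => measure_eq_zero_iff_ae_notMem.1 (h0 i)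
    obtain ⟨z, ⟨i, hi⟩, hz⟩ := (hae.and h1).exists
    exact hz i hi
  obtain ⟨i, hi⟩ := hex
  exact ⟨i, (eq_lineMeasure hΦ hline hμ.invariant (i := i) hi).symm⟩

end Hedlund

end

/-! ### Assembly of the proposition -/

open Hedlund in
theorem propositionP30 (lam : Fin 3 → ℝ) (hlam : ∀ i, 0 < lam i) (hsum : ∑ i, lam i = 1)
    (ε : ℝ) (hε : 0 < ε) (hε' : ε < 1 / 100)
    (hsmall : ∀ i, 3 * ε ^ 2 < (1 - 2 * ε ^ 2) * lam i ^ 2)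
    (g : LorentzMetric) (hg : IsHedlundMetric lam ε g) :
    stableTimeCone g = (PointedCone.hull ℝ {stdE 0, stdE 1, stdE 2} : Set E3) ∧
    (∀ l : E3 → ℝ, IsStableTimeSeparation g l ↔
      ∀ h ∈ PointedCone.hull ℝ {stdE 0, stdE 1, stdE 2}, l h = ∑ i, lam i * h i) ∧
    (∀ i, IsGeodesic g (line i) ∧ (∀ t, FutureCausal g (proj (line i t)) (deriv (line i) t) ∧
        g.lift (line i t) (deriv (line i) t) (deriv (line i) t) < 0) ∧
      Function.Periodic (fun t => proj (line i t)) 1) ∧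
    Function.Injective lineMeasure ∧
    (∀ i, (lineMeasure i).support = Set.range (tangentLine i)) ∧
    ∃ Φ : ℝ → UT → UT, IsPregeodesicFlow g Φ ∧
      ∀ l : E3 → ℝ, IsStableTimeSeparation g l →
        {μ : Measure UT | IsMaximalErgodic g Φ l μ} = Set.range lineMeasure := by
  have hcal : Calibrated lam g := fun x v hv => hg.exists_index hlam hε hε' hsmall hv
  have hhull : ∀ h, h ∈ PointedCone.hull ℝ {stdE 0, stdE 1, stdE 2} ↔ h ∈ octant := fun h => by
    rw [← SetLike.mem_coe, hull_eq_octant]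
  refine ⟨?_, fun l => ?_, fun i => ⟨hg.isGeodesic_line hε i, fun t => ⟨?_, ?_⟩, fun t => ?_⟩,
    lineMeasure_injective, support_lineMeasure, ?_⟩
  · rw [hull_eq_octant, hg.stableTimeCone_eq hcal hlam hε]
  · simp only [hhull]
    exact ⟨hg.eq_of_isStableTimeSeparation hcal hlam hε,
      hg.isStableTimeSeparation_of_eq hcal hlam hε⟩
  · rw [deriv_line]
    exact hg.futureCausal_stdE hε (hlam i) (line_mem_lineFamily i t)
  · rw [deriv_line]
    change g.form (proj (line i t)) (stdE i) (stdE i) < 0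
    rw [hg.form_eq hε (line_mem_lineFamily i t), tubeForm_stdE, neg_lt_zero]
    exact pow_pos (hlam i) 2
  · exact congrArg Prod.fst (periodic_tangentLine i t)
  · obtain ⟨Φ, hΦ, hm, hline, hback⟩ := hg.exists_flow hε
    refine ⟨Φ, hΦ, fun l hl => ?_⟩
    have hl' := hg.eq_of_isStableTimeSeparation hcal hlam hε hl
    refine Set.Subset.antisymm
      (fun μ hμ => IsMaximalErgodic.mem_range_lineMeasure hcal hlam hΦ hline hback hl' hμ) ?_
    rintro _ ⟨i, rfl⟩
    exact hg.isMaximalErgodic_lineMeasure hε hlam hm hline hl' i
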